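/- A \emph{2-adic lattice} is a finite-rank free $\mathbb{Z}_2$-module with a nondegenerate symmetric $\mathbb{Q}_2$-valued bilinear form. A \emph{Jordan decomposition} of it is an orthogonal direct sum decomposition whose constituents are unimodular lattices $U_k$ with inner products scaled by distinct powers $2^k$ of $2$ ($k\in\mathbb{Z}$). The term of scale $2^k$ has dimension $\dim U_k$; type $\mathrm{II}$ if all norms of $U_k$ are even and type $\mathrm{I}$ otherwise; and sign the Legendre symbol $\left(\frac{\det U_k}{2}\right)$, which is $+$ if $\det U_k\equiv\pm1$ and $-$ if $\det U_k\equiv\pm3$ modulo $8$. The oddity of $U_k$, in $\mathbb{Z}/8$, is computed by diagonalizing $U_k$ over $\mathbb{Q}_2$ and adding up the odd parts of the diagonal entries, plus $4$ for each diagonal entry of the form $2^{\mathrm{odd}}u$ with $u\in\mathbb{Z}_2^\times$, $u\equiv\pm3$ modulo $8$. A \emph{compartment} is a maximal nonempty set of type $\mathrm{I}$ terms whose scales are consecutive powers of $2$, and its oddity is the sum in $\mathbb{Z}/8$ of the oddities of the $U_k$ in it. The \emph{2-adic symbol} of the Jordan decomposition records the scales, dimensions, types and signs of its nontrivial terms and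 the oddities of its compartments. A \emph{sign walk} on a 2-adic symbol between two nontrivial terms is possible when (1) their scales are adjacent (ratio $2$) and their types differ; or (2) their scales are adjacent, both have type $\mathrm{I}$, and their compartment has total dimension $>2$ or oddity $\pm2$; or (3) both have type $\mathrm{I}$, their scales differ by a factor of $4$, and the term between them is trivial. It negates the signs of the two terms and changes by $4$ the oddity of each compartment containing at least one of them. It is thereby regarded as an element of $\{\pm1\}^T\oplus(\mathbb{Z}/8)^C$, where $T$ is the set of nontrivial terms and $C$ the set of compartments. \textbf{Theorem.} Suppose two given 2-adic lattices $L$, $L'$ have Jordan decompositions whose 2-adic symbols $S$, $S'$ have the same scales, dimensions, types and signs. Then $L$ and $L'$ are isometric if and only if $S=S'$; and $S=S'$ if and only if $S$ and $S'$ have the same compartment oddities. Moreover, the subgroup of $\{\pm1\}^T\oplus(\mathbb{Z}/8)^C$ generated by the sign walks possible on $S$ is an elementary abelian $2$-group, and its projection to $\{\pm1\}^T$ is injective. -/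

import Mathlib

namespace TwoAdic

open scoped Matrix

/-! ## Arithmetic of 2-adic numbers -/

/-- The Legendre symbol `(u/2)` of an odd 2-adic integer: `+` if `u ≡ ±1`, and `-` if
`u ≡ ±3` modulo `8`. -/
noncomputable def legendreTwo (u : ℤ_[2]) : ℤˣ :=
  if PadicInt.toZModPow 3 u = 3 ∨ PadicInt.toZModPow 3 u = -3 then -1 else 1

theorem norm_oddPart_le (a : ℚ_[2]) : ‖a * (2 : ℚ_[2]) ^ (-a.valuation)‖ ≤ 1 := by
  by_cases ha : a = 0
  · simp [ha]
  · have h2 : ‖(2 : ℚ_[2])‖ = (2 : ℝ)⁻¹ := by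
      simpa using Padic.norm_p (p := 2)
    rw [norm_mul, norm_zpow, h2, Padic.norm_eq_zpow_neg_valuation ha]
    have h : (2 : ℝ)⁻¹ ^ (-a.valuation) * (2 : ℝ) ^ (-a.valuation) = 1 := by
      rw [← mul_zpow]
      simp
    rw [mul_comm]
    exact_mod_cast h.le

/-- The odd part of a nonzero 2-adic number: `a = 2 ^ v * u` with `u` a 2-adic unit has odd part
`u`. (The odd part of `0` is `0`.) -/
noncomputable def oddPart (a : ℚ_[2]) : ℤ_[2] :=
  ⟨a * (2 : ℚ_[2]) ^ (-a.valuation), norm_oddPart_le a⟩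

/-- An antisquare is a 2-adic number `2 ^ odd * u` with `u` a unit and `(u/2) = -`. -/
def IsAntisquare (a : ℚ_[2]) : Prop :=
  a ≠ 0 ∧ Odd a.valuation ∧ legendreTwo (oddPart a) = -1

open Classical in
/-- The contribution of a diagonal entry to the oddity: its odd part modulo `8`, plus `4` if the
entry is an antisquare. -/
noncomputable def oddityEntry (a : ℚ_[2]) : ZMod 8 :=
  PadicInt.toZModPow 3 (oddPart a) + if IsAntisquare a then 4 else 0

/-- `d` is the list of diagonal entries of a diagonalization over `ℚ₂` of the symmetric
matrix `G`. -/
def IsDiagonalization {n : ℕ} (G : Matrix (Fin n) (Fin n) ℚ_[2]) (d : Fin n → ℚ_[2]) : Prop :=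
  ∃ P : Matrix (Fin n) (Fin n) ℚ_[2], IsUnit P.det ∧ Pᵀ * G * P = Matrix.diagonal d

open Classical in
/-- The oddity of a symmetric matrix over `ℚ₂`: diagonalize it over `ℚ₂` and add up the
contributions of the diagonal entries. For nondegenerate matrices the result does not depend on
the diagonalization. -/
noncomputable def matrixOddity {n : ℕ} (G : Matrix (Fin n) (Fin n) ℚ_[2]) : ZMod 8 :=
  if h : ∃ d, IsDiagonalization G d then ∑ i, oddityEntry (h.choose i) else 0

/-! ## Integral forms: unimodularity, type, sign, oddity -/

section Forms

variable {M : Type*} [AddCommGroup M] [Module ℤ_[2] M]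

/-- The natural map from the lattice to its dual lattice is an isomorphism. -/
def IsUnimodular (b : LinearMap.BilinForm ℤ_[2] M) : Prop :=
  Function.Bijective (b : M → (M →ₗ[ℤ_[2]] ℤ_[2]))

/-- All norms are even. -/
def IsEvenForm (b : LinearMap.BilinForm ℤ_[2] M) : Prop :=
  ∀ x, (2 : ℤ_[2]) ∣ b x x

variable [Module.Free ℤ_[2] M] [Module.Finite ℤ_[2] M]

/-- The inner product matrix in a basis. -/
noncomputable def gram (b : LinearMap.BilinForm ℤ_[2] M) :
    Matrix (Fin (Module.finrank ℤ_[2] M)) (Fin (Module.finrank ℤ_[2] M)) ℤ_[2] :=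
  Matrix.of fun i j => b (Module.finBasis ℤ_[2] M i) (Module.finBasis ℤ_[2] M j)

/-- The sign of a unimodular lattice: the Legendre symbol of its determinant. -/
noncomputable def formSign (b : LinearMap.BilinForm ℤ_[2] M) : ℤˣ :=
  legendreTwo (gram b).det

/-- The oddity of a lattice. -/
noncomputable def formOddity (b : LinearMap.BilinForm ℤ_[2] M) : ZMod 8 :=
  matrixOddity ((gram b).map fun a => (a : ℚ_[2]))

end Forms

/-! ## Lattices and Jordan decompositions -/

/-- A (nondegenerate) 2-adic lattice structure on a finite free `ℤ₂`-module: a `ℚ₂`-valued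
nondegenerate symmetric bilinear form. -/
structure Lattice (L : Type*) [AddCommGroup L] [Module ℤ_[2] L] where
  form : L →ₗ[ℤ_[2]] L →ₗ[ℤ_[2]] ℚ_[2]
  symm : ∀ x y, form x y = form y x
  nondegenerate : ∀ x, (∀ y, form x y = 0) → x = 0

/-- Isometry of lattices. -/
def Isometric {L L' : Type*} [AddCommGroup L] [Module ℤ_[2] L]
    [AddCommGroup L'] [Module ℤ_[2] L'] (Λ : Lattice L) (Λ' : Lattice L') : Prop :=
  ∃ e : L ≃ₗ[ℤ_[2]] L', ∀ x y, Λ'.form (e x) (e y) = Λ.form x y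

/-- A Jordan decomposition: an orthogonal direct sum decomposition, whose constituent `term k` is a
unimodular lattice with inner products scaled by `2 ^ k` (trivial constituents allowed, and all
but finitely many are trivial because the module is finitely generated). The form `unscaled k` of
that unimodular lattice is determined by `form_eq`. -/
structure JordanDecomposition {L : Type*} [AddCommGroup L] [Module ℤ_[2] L] (Λ : Lattice L) where
  term : ℤ → Submodule ℤ_[2] L
  isInternal : DirectSum.IsInternal term
  orthogonal : ∀ i j, i ≠ j → ∀ x ∈ term i, ∀ y ∈ term j, Λ.form x y = 0
  unscaled : (k : ℤ) → LinearMap.BilinForm ℤ_[2] (term k)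
  form_eq : ∀ (k : ℤ) (x y : term k),
    Λ.form (x : L) (y : L) = (2 : ℚ_[2]) ^ k * ((unscaled k x y : ℤ_[2]) : ℚ_[2])
  unimodular : ∀ k, IsUnimodular (unscaled k)

/-! ## 2-adic symbols -/

/-- The type `I` (odd) or `II` (even) of a term. -/
inductive TermType
  | I
  | II

/-- A compartment (given by the exponents of its scales): a nonempty set of type `I` terms whose
scales are consecutive powers of `2`, maximal with these properties. -/
def IsCompartment (type : ℤ → TermType) (C : Finset ℤ) : Prop :=
  Maximal (fun D : Finset ℤ =>
    D.Nonempty ∧ (∀ k ∈ D, type k = TermType.I) ∧ (D : Set ℤ).OrdConnected) C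

/-- A 2-adic symbol: for each scale `2 ^ k` the dimension, type and sign of the term (terms of
dimension `0` being absent, with type `II` and sign `+` by convention), and for each compartment
its oddity. -/
structure Symbol where
  dim : ℤ → ℕ
  type : ℤ → TermType
  sign : ℤ → ℤˣ
  oddity : {C : Finset ℤ // IsCompartment type C} → ZMod 8

section OfLattice

variable {L : Type*} [AddCommGroup L] [Module ℤ_[2] L] [Module.Free ℤ_[2] L]
  [Module.Finite ℤ_[2] L] {Λ : Lattice L}

open Classical in
/-- The 2-adic symbol of a Jordan decomposition. The oddity of a compartment is the sum of the
oddities of the (unscaled) unimodular lattices in it. -/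
noncomputable def JordanDecomposition.symbol (J : JordanDecomposition Λ) : Symbol where
  dim k := Module.finrank ℤ_[2] (J.term k)
  type k := if IsEvenForm (J.unscaled k) then TermType.II else TermType.I
  sign k := formSign (J.unscaled k)
  oddity C := ∑ k ∈ C.1, formOddity (J.unscaled k)

end OfLattice

/-! ## Sign walks -/

namespace Symbol

variable (S : Symbol)

/-- A sign walk between the nontrivial terms of scales `2 ^ i` and `2 ^ j`, `i < j`, is possible:
(1) the scales are adjacent and the types differ; or (2) the scales are adjacent, both types
are `I`, and their compartment has dimension `> 2` or oddity `±2`; or (3) both types are `I`, the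
scales differ by a factor of `4`, and the term between them is trivial. -/
def CanWalk (i j : ℤ) : Prop :=
  S.dim i ≠ 0 ∧ S.dim j ≠ 0 ∧
    ((j = i + 1 ∧ S.type i ≠ S.type j) ∨
     (j = i + 1 ∧ S.type i = TermType.I ∧ S.type j = TermType.I ∧
        ∃ C : {C : Finset ℤ // IsCompartment S.type C}, i ∈ C.1 ∧ j ∈ C.1 ∧
          (2 < ∑ k ∈ C.1, S.dim k ∨ S.oddity C = 2 ∨ S.oddity C = -2)) ∨
     (j = i + 2 ∧ S.type i = TermType.I ∧ S.type j = TermType.I ∧ S.dim (i + 1) = 0))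

/-- The group `{±1}^T ⊕ (ℤ/8)^C`, with `T` the set of nontrivial terms and `C` the set of
compartments, written additively. It acts on signs and compartment oddities by translation. -/
abbrev Coordinates : Type :=
  ({k : ℤ // S.dim k ≠ 0} → Additive ℤˣ) ×
    ({C : Finset ℤ // IsCompartment S.type C} → ZMod 8)

/-- The sign walk between the terms of scales `2 ^ i` and `2 ^ j`: negate their two signs and
change by `4` the oddity of each compartment involved. -/
def walk (i j : ℤ) : S.Coordinates :=
  (fun k => Additive.ofMul (if k.1 = i ∨ k.1 = j then -1 else 1),
   fun C => if i ∈ C.1 ∨ j ∈ C.1 then 4 else 0)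

/-- The group generated by the sign walks that are possible on `S`. -/
def walkGroup : AddSubgroup S.Coordinates :=
  AddSubgroup.closure {a | ∃ i j, S.CanWalk i j ∧ a = S.walk i j}

end Symbol

end TwoAdic

namespace TwoAdic

/-! ## Isometry of functions on modules -/

section Isom

variable {V : Type*} {M M' M'' N N' : Type*}
  [AddCommGroup M] [Module ℤ_[2] M] [AddCommGroup M'] [Module ℤ_[2] M']
  [AddCommGroup M''] [Module ℤ_[2] M''] [AddCommGroup N] [Module ℤ_[2] N]
  [AddCommGroup N'] [Module ℤ_[2] N']

/-- Two functions on `ℤ₂`-modules (in practice quadratic forms) that correspond under a linear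
isomorphism. -/
def Isom (q : M → V) (q' : M' → V) : Prop :=
  ∃ e : M ≃ₗ[ℤ_[2]] M', ∀ x, q' (e x) = q x

theorem Isom.refl (q : M → V) : Isom q q := ⟨LinearEquiv.refl _ _, fun _ => rfl⟩

theorem Isom.symm {q : M → V} {q' : M' → V} (h : Isom q q') : Isom q' q := by
  obtain ⟨e, he⟩ := h
  exact ⟨e.symm, fun x => by rw [← he, e.apply_symm_apply]⟩

theorem Isom.trans {q : M → V} {q' : M' → V} {q'' : M'' → V} (h : Isom q q') (h' : Isom q' q'') :
    Isom q q'' := by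
  obtain ⟨e, he⟩ := h
  obtain ⟨e', he'⟩ := h'
  exact ⟨e.trans e', fun x => by simp [he, he']⟩

theorem Isom.map {W : Type*} (f : V → W) {q : M → V} {q' : M' → V} (h : Isom q q') :
    Isom (fun x => f (q x)) (fun x => f (q' x)) := by
  obtain ⟨e, he⟩ := h
  exact ⟨e, fun x => by simp [he]⟩

variable [AddCommMonoid V]

theorem Isom.prod {q : M → V} {q' : M' → V} {r : N → V} {r' : N' → V} (h : Isom q q')
    (h' : Isom r r') :
    Isom (fun x : M × N => q x.1 + r x.2) (fun x : M' × N' => q' x.1 + r' x.2) := by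
  obtain ⟨e, he⟩ := h
  obtain ⟨e', he'⟩ := h'
  exact ⟨e.prodCongr e', fun x => by simp [he, he']⟩

theorem Isom.pi {ι : Type*} [Fintype ι] {A B : ι → Type*}
    [∀ i, AddCommGroup (A i)] [∀ i, Module ℤ_[2] (A i)]
    [∀ i, AddCommGroup (B i)] [∀ i, Module ℤ_[2] (B i)]
    {q : ∀ i, A i → V} {q' : ∀ i, B i → V} (h : ∀ i, Isom (q i) (q' i)) :
    Isom (fun x : ∀ i, A i => ∑ i, q i (x i)) (fun x : ∀ i, B i => ∑ i, q' i (x i)) := by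
  choose e he using h
  exact ⟨LinearEquiv.piCongrRight e, fun x => by simp [he]⟩

/-- The orthogonal sum of a family of functions on the same module. -/
def piSum {ι : Type*} [Fintype ι] (q : ι → M → V) (x : ι → M) : V := ∑ i, q i (x i)

theorem isom_piSum {ι : Type*} [Fintype ι] {q : ι → M → V} {q' : ι → N → V}
    (h : ∀ i, Isom (q i) (q' i)) : Isom (piSum q) (piSum q') := Isom.pi h

theorem isom_piSum_reindex {ι κ : Type*} [Fintype ι] [Fintype κ] (e : κ ≃ ι) (q : ι → M → V) :
    Isom (piSum q) (piSum fun j => q (e j)) := by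
  refine ⟨LinearEquiv.funCongrLeft ℤ_[2] M e, fun x => ?_⟩
  simp only [piSum, LinearEquiv.funCongrLeft_apply, LinearMap.funLeft_apply]
  exact e.sum_comp fun i => q i (x i)

theorem isom_piSum_sum {α β : Type*} [Fintype α] [Fintype β] (q : α ⊕ β → M → V) :
    Isom (piSum q) (fun x : (α → M) × (β → M) =>
      piSum (fun a => q (Sum.inl a)) x.1 + piSum (fun b => q (Sum.inr b)) x.2) := by
  refine ⟨LinearEquiv.sumArrowLequivProdArrow α β ℤ_[2] M, fun x => ?_⟩
  simp [piSum, Fintype.sum_sum_type]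

/-- Isometric changes of some of the summands. -/
theorem isom_piSum_of_injective {ι κ : Type*} [Fintype ι] [Fintype κ] (f : κ → ι)
    (hf : Function.Injective f) {q q' : ι → M → V} (hq : ∀ i ∉ Set.range f, q i = q' i)
    (h : Isom (piSum fun j => q (f j)) (piSum fun j => q' (f j))) :
    Isom (piSum q) (piSum q') := by
  classical
  let e : κ ⊕ {i // i ∉ Set.range f} ≃ ι :=
    ((Equiv.ofInjective f hf).sumCongr (Equiv.refl _)).trans (Equiv.sumCompl (· ∈ Set.range f))
  have hl : ∀ j, e (Sum.inl j) = f j := fun j => by simp [e]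
  have hr : ∀ j, e (Sum.inr j) = j.1 := fun j => by simp [e]
  refine (isom_piSum_reindex e q).trans <| (isom_piSum_sum _).trans <| Isom.trans ?_ <|
    Isom.symm <| (isom_piSum_reindex e q').trans <| isom_piSum_sum _
  refine Isom.prod (by simpa only [hl] using h) ?_
  rw [show (fun b => q (e (Sum.inr b))) = fun b => q' (e (Sum.inr b)) from
    funext fun b => by rw [hr, hq _ b.2]]
  exact Isom.refl _

/-- Isometric changes of two summands. -/
theorem isom_piSum_of_pair {ι : Type*} [Fintype ι] {p r : ι} (hpr : p ≠ r)
    {q q' : ι → M → V} (hq : ∀ i, i ≠ p → i ≠ r → q i = q' i)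
    (h : Isom (fun x : M × M => q p x.1 + q r x.2) (fun x : M × M => q' p x.1 + q' r x.2)) :
    Isom (piSum q) (piSum q') := by
  refine isom_piSum_of_injective ![p, r] ?_ ?_ ?_
  · intro i j hij
    fin_cases i <;> fin_cases j <;> simp_all
  · intro i hi
    apply hq
    · rintro rfl; exact hi ⟨0, rfl⟩
    · rintro rfl; exact hi ⟨1, rfl⟩
  · obtain ⟨e, he⟩ := h
    refine ⟨((LinearEquiv.finTwoArrow ℤ_[2] M).trans e).trans (LinearEquiv.finTwoArrow ℤ_[2] M).symm,
      fun x => ?_⟩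
    simpa [piSum, Fin.sum_univ_two] using he (x 0, x 1)

end Isom

/-! ## Units of `ℤ₂` -/

theorem not_dvd_iff_isUnit {u : ℤ_[2]} : ¬ (2 : ℤ_[2]) ∣ u ↔ IsUnit u := by
  rw [← not_iff_not, not_not, PadicInt.not_isUnit_iff, PadicInt.norm_lt_one_iff_dvd]
  norm_cast

theorem isUnit_add_two_mul {u : ℤ_[2]} (hu : IsUnit u) (x : ℤ_[2]) : IsUnit (u + 2 * x) := by
  rw [← not_dvd_iff_isUnit] at hu ⊢
  rwa [Dvd.dvd.mul_right dvd_rfl x |> (dvd_add_left ·)]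

theorem isUnit_one_add_two_mul (x : ℤ_[2]) : IsUnit (1 + 2 * x) :=
  isUnit_add_two_mul isUnit_one x

theorem toZModPow_eq_zero_iff {n : ℕ} {a : ℤ_[2]} :
    PadicInt.toZModPow n a = 0 ↔ (2 : ℤ_[2]) ^ n ∣ a := by
  rw [← RingHom.mem_ker, PadicInt.ker_toZModPow, Ideal.mem_span_singleton]
  norm_cast

/-- A quadratic equation `a x ^ 2 + b x + c = 0` with `b` odd and `c` even is soluble. -/
theorem exists_quadratic_root {a b c : ℤ_[2]} (hb : IsUnit b) (hc : (2 : ℤ_[2]) ∣ c) :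
    ∃ x : ℤ_[2], a * x ^ 2 + b * x + c = 0 := by
  open Polynomial in
  obtain ⟨z, hz, -⟩ := hensels_lemma (p := 2) (R := ℤ_[2])
    (F := C a * X ^ 2 + C b * X + C c) (a := (0 : ℤ_[2])) (by
      have h1 := (PadicInt.norm_lt_one_iff_dvd (p := 2) c).2 (by exact_mod_cast hc)
      simpa [PadicInt.isUnit_iff.1 hb] using h1)
  exact ⟨z, by simpa using hz⟩

theorem exists_sq_eq {u : ℤ_[2]} (h : PadicInt.toZModPow 3 u = 1) :
    ∃ t : ℤ_[2], IsUnit t ∧ t ^ 2 = u := by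
  have h1 : (2 : ℤ_[2]) ^ 3 ∣ 1 - u := toZModPow_eq_zero_iff.1 (by simp [h])
  obtain ⟨c, hc⟩ := h1
  obtain ⟨x, hx⟩ := exists_quadratic_root (a := 1) (b := 1) (c := 2 * c) isUnit_one ⟨c, rfl⟩
  refine ⟨1 + 2 * x, isUnit_one_add_two_mul x, ?_⟩
  linear_combination 4 * hx + hc

/-- The residue modulo `8` of a 2-adic unit is odd. -/
theorem toZModPow_three_of_isUnit {u : ℤ_[2]} (hu : IsUnit u) :
    PadicInt.toZModPow 3 u = 1 ∨ PadicInt.toZModPow 3 u = 3 ∨ PadicInt.toZModPow 3 u = 5 ∨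
      PadicInt.toZModPow 3 u = 7 := by
  have h := hu.map (PadicInt.toZModPow (p := 2) 3)
  generalize PadicInt.toZModPow (p := 2) 3 u = a at h
  obtain ⟨b, hb⟩ := h.exists_right_inv
  clear h
  change a * b = (1 : ZMod 8) at hb
  change a = (1 : ZMod 8) ∨ a = (3 : ZMod 8) ∨ a = (5 : ZMod 8) ∨ a = (7 : ZMod 8)
  change ZMod 8 at a b
  revert a b
  decide

theorem legendreTwo_mul {u v : ℤ_[2]} (hu : IsUnit u) (hv : IsUnit v) :
    legendreTwo (u * v) = legendreTwo u * legendreTwo v := by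
  unfold legendreTwo
  rw [map_mul]
  rcases toZModPow_three_of_isUnit hu with h | h | h | h <;>
    rcases toZModPow_three_of_isUnit hv with h' | h' | h' | h' <;> rw [h, h'] <;> decide

theorem legendreTwo_one : legendreTwo 1 = 1 := by
  unfold legendreTwo
  rw [map_one]
  decide

theorem legendreTwo_mul_sq {u t : ℤ_[2]} (hu : IsUnit u) (ht : IsUnit t) :
    legendreTwo (u * t ^ 2) = legendreTwo u := by
  rw [legendreTwo_mul hu (ht.pow 2), pow_two, legendreTwo_mul ht ht, Int.units_mul_self, mul_one]

theorem legendreTwo_prod {ι : Type*} (s : Finset ι) (u : ι → ℤ_[2]) (hu : ∀ i, IsUnit (u i)) :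
    legendreTwo (∏ i ∈ s, u i) = ∏ i ∈ s, legendreTwo (u i) := by
  classical
  induction s using Finset.induction_on with
  | empty => simp [legendreTwo_one]
  | insert i s hi ih =>
    rw [Finset.prod_insert hi, Finset.prod_insert hi, legendreTwo_mul (hu i) _, ih]
    exact (Finset.prod_induction _ IsUnit (fun _ _ => IsUnit.mul) isUnit_one fun i _ => hu i)

/-- Units congruent modulo `8` differ by a square. -/
theorem exists_eq_mul_sq {u v : ℤ_[2]} (hv : IsUnit v)
    (h : PadicInt.toZModPow 3 u = PadicInt.toZModPow 3 v) :
    ∃ t : ℤ_[2], IsUnit t ∧ u = v * t ^ 2 := by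
  obtain ⟨w, hw⟩ := hv.exists_right_inv
  have h1 : PadicInt.toZModPow 3 (u * w) = 1 := by rw [map_mul, h, ← map_mul, hw, map_one]
  obtain ⟨t, ht, htu⟩ := exists_sq_eq h1
  exact ⟨t, ht, by rw [htu]; linear_combination -u * hw⟩

/-- The representatives `±1, ±5` of the units modulo squares. -/
def stdUnit (x s : Bool) : ℤ := (if x then -1 else 1) * (if s then 5 else 1)

theorem toZModPow_intCast (n : ℕ) (a : ℤ) :
    PadicInt.toZModPow n (a : ℤ_[2]) = (a : ZMod (2 ^ n)) := map_intCast _ _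

theorem isUnit_intCast {a : ℤ} (h : a % 2 = 1) : IsUnit (a : ℤ_[2]) := by
  have h1 : a = 1 + 2 * (a / 2) := by omega
  rw [h1]
  push_cast
  exact isUnit_one_add_two_mul _

theorem stdUnit_emod_two (x s : Bool) : stdUnit x s % 2 = 1 := by
  revert x s; decide

theorem exists_stdUnit {u : ℤ_[2]} (hu : IsUnit u) :
    ∃ x s, PadicInt.toZModPow 3 u = PadicInt.toZModPow 3 (stdUnit x s : ℤ_[2]) := by
  rcases toZModPow_three_of_isUnit hu with h | h | h | h
  · exact ⟨false, false, by rw [h, toZModPow_intCast]; decide⟩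
  · exact ⟨true, true, by rw [h, toZModPow_intCast]; decide⟩
  · exact ⟨false, true, by rw [h, toZModPow_intCast]; decide⟩
  · exact ⟨true, false, by rw [h, toZModPow_intCast]; decide⟩

theorem legendreTwo_stdUnit (x s : Bool) :
    legendreTwo (stdUnit x s : ℤ_[2]) = if s then -1 else 1 := by
  unfold legendreTwo
  rw [toZModPow_intCast]
  revert x s
  decide

/-- The unary form of a unit depends only on the unit modulo `8`. -/
theorem isom_unary {u v : ℤ_[2]} (hv : IsUnit v)
    (h : PadicInt.toZModPow 3 u = PadicInt.toZModPow 3 v) :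
    Isom (fun X : ℤ_[2] => u * X ^ 2) (fun X : ℤ_[2] => v * X ^ 2) := by
  obtain ⟨t, ht, rfl⟩ := exists_eq_mul_sq hv h
  obtain ⟨t, rfl⟩ := ht
  refine ⟨LinearEquiv.smulOfUnit t, fun X => ?_⟩
  change v * ((t : ℤ_[2]) * X) ^ 2 = _
  ring

/-! ## Diagonal forms -/

/-- The unary form of norm `2 ^ k * u`. -/
noncomputable def unary (k : ℤ) (u : ℤ_[2]) (X : ℤ_[2]) : ℚ_[2] :=
  (2 : ℚ_[2]) ^ k * ((u * X ^ 2 : ℤ_[2]) : ℚ_[2])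

theorem isom_unary_congr (k : ℤ) {u v : ℤ_[2]} (hv : IsUnit v)
    (h : PadicInt.toZModPow 3 u = PadicInt.toZModPow 3 v) : Isom (unary k u) (unary k v) :=
  (isom_unary hv h).map fun z : ℤ_[2] => (2 : ℚ_[2]) ^ k * (z : ℚ_[2])

theorem isom_binary (k : ℤ) (e : ℕ) {a b c w : ℤ_[2]} (hw : IsUnit w)
    (h : a + 2 ^ e * b * c ^ 2 = w) :
    Isom (fun X : ℤ_[2] × ℤ_[2] => unary k a X.1 + unary (k + e) b X.2)
      (fun X : ℤ_[2] × ℤ_[2] => unary k w X.1 + unary (k + e) (a * b * w) X.2) := by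
  obtain ⟨w, rfl⟩ := hw
  refine Isom.symm ⟨LinearEquiv.ofLinearMap
    (LinearMap.prod
      (LinearMap.fst _ _ _ - (2 ^ e * b * c) • LinearMap.snd _ _ _)
      (c • LinearMap.fst _ _ _ + a • LinearMap.snd _ _ _))
    (((↑w⁻¹ : ℤ_[2])) • LinearMap.prod
      (a • LinearMap.fst _ _ _ + (2 ^ e * b * c) • LinearMap.snd _ _ _)
      (LinearMap.snd _ _ _ - c • LinearMap.fst _ _ _)) ?_ ?_, ?_⟩
  · have h1 := w.inv_mul
    ext <;> simp <;> first | ring1 | linear_combination h1 + (↑w⁻¹ : ℤ_[2]) * h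
  · have h1 := w.inv_mul
    ext <;> simp <;> first | ring1 | linear_combination h | linear_combination -h
  · rintro ⟨X, Y⟩
    have h2 : (2 : ℚ_[2]) ^ (k + (e : ℤ)) = 2 ^ k * 2 ^ e := by
      rw [zpow_add₀ (by norm_num), zpow_natCast]
    have h3 : ((2 : ℤ_[2]) : ℚ_[2]) = 2 := rfl
    have h' := congrArg (fun z : ℤ_[2] => (z : ℚ_[2])) h
    simp only [unary, LinearEquiv.coe_ofLinearMap, h2]
    simp [h3]
    push_cast [h3] at h'
    rw [← h']
    ring

theorem isom_binary_std (k : ℤ) (e : ℕ) (a b c a' b' : ℤ) (ha' : a' % 2 = 1) (hb' : b' % 2 = 1)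
    (ha : (a + 2 ^ e * b * c ^ 2) % 8 = a' % 8)
    (hb : (a * b * (a + 2 ^ e * b * c ^ 2)) % 8 = b' % 8) :
    Isom (fun X : ℤ_[2] × ℤ_[2] => unary k (a : ℤ_[2]) X.1 + unary (k + e) (b : ℤ_[2]) X.2)
      (fun X : ℤ_[2] × ℤ_[2] => unary k (a' : ℤ_[2]) X.1 + unary (k + e) (b' : ℤ_[2]) X.2) := by
  have hc : ∀ y z : ℤ, y % 8 = z % 8 →
      PadicInt.toZModPow 3 (y : ℤ_[2]) = PadicInt.toZModPow 3 (z : ℤ_[2]) := fun y z h => by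
    rw [toZModPow_intCast, toZModPow_intCast]
    exact (ZMod.intCast_eq_intCast_iff _ _ 8).2 h
  have hw : IsUnit ((a + 2 ^ e * b * c ^ 2 : ℤ) : ℤ_[2]) := isUnit_intCast (by omega)
  refine (isom_binary k e (c := (c : ℤ_[2])) hw (by push_cast; ring)).trans ?_
  refine Isom.prod (isom_unary_congr _ (isUnit_intCast ha') (hc _ _ ha))
    (isom_unary_congr _ (isUnit_intCast hb') ?_)
  rw [← hc _ _ hb]
  push_cast
  rfl

theorem isom_quaternary (k : ℤ) (a b : Fin 4 → ℤ) (P : Matrix (Fin 4) (Fin 4) ℤ)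
    (hP : P.det % 2 = 1)
    (h : P.transpose * Matrix.diagonal a * P = Matrix.diagonal b) :
    Isom (piSum fun i => unary k (a i : ℤ_[2])) (piSum fun i => unary k (b i : ℤ_[2])) := by
  let f := (Int.castRingHom ℤ_[2])
  have hu : IsUnit (P.map f) := by
    rw [Matrix.isUnit_iff_isUnit_det, ← RingHom.mapMatrix_apply, ← RingHom.map_det]
    exact isUnit_intCast hP
  have h1 := congrArg (fun Q : Matrix (Fin 4) (Fin 4) ℤ => Q.map f) h
  simp only [Matrix.map_mul] at h1
  have hd : ∀ d : Fin 4 → ℤ, (Matrix.diagonal d).map f = Matrix.diagonal fun i => (d i : ℤ_[2]) :=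
    fun d => by rw [Matrix.diagonal_map (by simp)]; rfl
  rw [hd, hd] at h1
  have key : ∀ (d : Fin 4 → ℤ) (X : Fin 4 → ℤ_[2]), piSum (fun i => unary k (d i : ℤ_[2])) X =
      2 ^ k * ((X ⬝ᵥ (Matrix.diagonal fun i => (d i : ℤ_[2])).mulVec X : ℤ_[2]) : ℚ_[2]) := by
    intro d X
    simp only [piSum, unary, ← Finset.mul_sum, ← PadicInt.coe_sum, dotProduct,
      Matrix.mulVec_diagonal]
    congr 3
    ext i
    ring_nf
  refine Isom.symm ⟨Matrix.toLinearEquiv' (P.map f) hu.invertible, fun X => ?_⟩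
  have h2 : Matrix.toLinearEquiv' (P.map f) hu.invertible X = (P.map f).mulVec X := rfl
  rw [h2, key, key, ← h1, Matrix.dotProduct_mulVec, Matrix.vecMul_mulVec,
    ← Matrix.dotProduct_mulVec, Matrix.mulVec_mulVec, Matrix.transpose_map]

/-! ## Configurations of diagonal entries -/

section Configurations

variable {ι : Type*} [Fintype ι] [DecidableEq ι]

/-- The diagonal form with entries `2 ^ κ i * stdUnit (x i) (s i)`. -/
noncomputable def stdForm (κ : ι → ℤ) (x s : ι → Bool) : (ι → ℤ_[2]) → ℚ_[2] :=
  piSum fun i => unary (κ i) (stdUnit (x i) (s i) : ℤ_[2])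

/-- Negate the bits in `F`. -/
def flip (F : Finset ι) (x : ι → Bool) (i : ι) : Bool := xor (x i) (decide (i ∈ F))

omit [Fintype ι] in
theorem flip_empty (x : ι → Bool) : flip ∅ x = x := by
  funext i; simp [flip]

omit [Fintype ι] in
theorem flip_flip_of_subset {F D : Finset ι} (h : F ⊆ D) (x : ι → Bool) :
    flip (D \ F) (flip F x) = flip D x := by
  funext i
  by_cases h1 : i ∈ F
  · simp [flip, h1, h h1]
  · simp [flip, h1]

omit [Fintype ι] in
theorem flip_flip (F : Finset ι) (x : ι → Bool) : flip F (flip F x) = x := by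
  funext i
  by_cases h1 : i ∈ F <;> simp [flip, h1]

omit [DecidableEq ι] in
theorem stdForm_pair (κ : ι → ℤ) {x s x' s' : ι → Bool} {p q : ι} (hpq : p ≠ q) {e : ℕ}
    (he : κ q = κ p + e) (c : ℤ)
    (hx : ∀ i, i ≠ p → i ≠ q → x' i = x i) (hs : ∀ i, i ≠ p → i ≠ q → s' i = s i)
    (ha : (stdUnit (x p) (s p) + 2 ^ e * stdUnit (x q) (s q) * c ^ 2) % 8 =
      stdUnit (x' p) (s' p) % 8)
    (hb : (stdUnit (x p) (s p) * stdUnit (x q) (s q) *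
      (stdUnit (x p) (s p) + 2 ^ e * stdUnit (x q) (s q) * c ^ 2)) % 8 =
      stdUnit (x' q) (s' q) % 8) :
    Isom (stdForm κ x s) (stdForm κ x' s') := by
  refine isom_piSum_of_pair hpq (fun i h1 h2 => by rw [hx i h1 h2, hs i h1 h2]) ?_
  rw [he]
  exact isom_binary_std (κ p) e _ _ c _ _ (stdUnit_emod_two _ _) (stdUnit_emod_two _ _) ha hb

theorem stdForm_flip_signs (κ : ι → ℤ) (x s : ι → Bool) {p q : ι} (hpq : p ≠ q)
    (he : κ p = κ q) : Isom (stdForm κ x s) (stdForm κ x (flip {p, q} s)) := by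
  refine stdForm_pair κ hpq (e := 0) (by simp [he]) 2 (fun _ _ _ => rfl)
    (fun i h1 h2 => by simp [flip, h1, h2]) ?_ ?_ <;>
  · simp only [flip, Finset.mem_insert, Finset.mem_singleton, true_or, or_true, decide_true]
    generalize x p = a; generalize x q = b; generalize s p = c; generalize s q = d
    revert a b c d; decide

theorem stdForm_flip_adjacent_of_ne (κ : ι → ℤ) (x s : ι → Bool) {p q : ι}
    (he : κ q = κ p + 1) (hx : x p ≠ x q) :
    Isom (stdForm κ x s) (stdForm κ (flip {p, q} x) s) := by
  have hpq : p ≠ q := fun h => hx (by rw [h])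
  refine stdForm_pair κ hpq (e := 1) (by simp [he]) 1
    (fun i h1 h2 => by simp [flip, h1, h2]) (fun _ _ _ => rfl) ?_ ?_ <;>
  · simp only [flip, Finset.mem_insert, Finset.mem_singleton, true_or, or_true, decide_true]
    revert hx
    generalize x p = a; generalize x q = b; generalize s p = c; generalize s q = d
    revert a b c d; decide

theorem stdForm_flip_adjacent_of_eq (κ : ι → ℤ) (x s : ι → Bool) {p q : ι}
    (he : κ q = κ p + 1) (hx : x p = x q) :
    Isom (stdForm κ x s) (stdForm κ (flip {p, q} x) (flip {p, q} s)) := by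
  have hpq : p ≠ q := fun h => by rw [h] at he; omega
  refine stdForm_pair κ hpq (e := 1) (by simp [he]) 1
    (fun i h1 h2 => by simp [flip, h1, h2]) (fun i h1 h2 => by simp [flip, h1, h2]) ?_ ?_ <;>
  · simp only [flip, Finset.mem_insert, Finset.mem_singleton, true_or, or_true, decide_true]
    revert hx
    generalize x p = a; generalize x q = b; generalize s p = c; generalize s q = d
    revert a b c d; decide

omit [Fintype ι] in
theorem comp_swap_eq_flip {x : ι → Bool} {p q : ι} (hx : x p ≠ x q) :
    x ∘ Equiv.swap p q = flip {p, q} x := by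
  funext i
  by_cases h1 : i = p
  · subst h1; simpa [flip] using (Bool.eq_not.2 hx.symm)
  by_cases h2 : i = q
  · subst h2; simpa [flip] using (Bool.eq_not.2 hx)
  simp [flip, h1, h2, Equiv.swap_apply_of_ne_of_ne h1 h2]

omit [Fintype ι] in
theorem comp_swap_eq_self {x : ι → Bool} {p q : ι} (hx : x p = x q) :
    x ∘ Equiv.swap p q = x := by
  funext i
  by_cases h1 : i = p
  · simp [h1, hx]
  by_cases h2 : i = q
  · simp [h2, hx]
  simp [Equiv.swap_apply_of_ne_of_ne h1 h2]

theorem stdForm_swap (κ : ι → ℤ) (x s : ι → Bool) {p q : ι} (he : κ p = κ q) :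
    Isom (stdForm κ x s) (stdForm κ (x ∘ Equiv.swap p q) (s ∘ Equiv.swap p q)) := by
  have hκ : ∀ i, κ (Equiv.swap p q i) = κ i := fun i => by
    rcases Equiv.swap_apply_eq_iff.1 (rfl : Equiv.swap p q i = Equiv.swap p q i) with h
    by_cases h1 : i = p
    · simp [h1, he]
    by_cases h2 : i = q
    · simp [h2, he]
    rw [Equiv.swap_apply_of_ne_of_ne h1 h2]
  refine (isom_piSum_reindex (Equiv.swap p q) _).trans ?_
  simp only [hκ]
  exact Isom.refl _

theorem stdForm_flip_same_of_ne (κ : ι → ℤ) (x s : ι → Bool) {p q : ι}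
    (he : κ p = κ q) (hx : x p ≠ x q) :
    Isom (stdForm κ x s) (stdForm κ (flip {p, q} x) s) := by
  have hpq : p ≠ q := fun h => hx (by rw [h])
  have h := stdForm_swap κ x s he
  rw [comp_swap_eq_flip hx] at h
  by_cases hs : s p = s q
  · rwa [comp_swap_eq_self hs] at h
  · rw [comp_swap_eq_flip hs] at h
    have h' := stdForm_flip_signs κ (flip {p, q} x) (flip {p, q} s) hpq he
    rw [flip_flip] at h'
    exact h.trans h'

/-- Every integer between the scales of `i` and `j` is a scale. -/
def Linked (κ : ι → ℤ) (i j : ι) : Prop := ∀ k ∈ Set.uIcc (κ i) (κ j), ∃ r, κ r = k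

omit [Fintype ι] [DecidableEq ι] in
theorem Linked.symm {κ : ι → ℤ} {i j : ι} (h : Linked κ i j) : Linked κ j i := by
  intro k hk
  exact h k (by rwa [Set.uIcc_comm])

omit [Fintype ι] [DecidableEq ι] in
theorem Linked.trans {κ : ι → ℤ} {i j l : ι} (h : Linked κ i j) (h' : Linked κ j l) :
    Linked κ i l := by
  intro k hk
  rcases Set.uIcc_subset_uIcc_union_uIcc hk with h1 | h1
  · exact h k h1
  · exact h' k h1

theorem stdForm_flip_of_linked (κ : ι → ℤ) (s : ι → Bool) (d : ℕ) : ∀ (x : ι → Bool) {p q : ι},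
    Linked κ p q → κ q = κ p + d → x p ≠ x q →
    Isom (stdForm κ x s) (stdForm κ (flip {p, q} x) s) := by
  induction d with
  | zero => intro x p q _ he hx; exact stdForm_flip_same_of_ne κ x s (by simpa using he.symm) hx
  | succ d ih =>
    intro x p q hl he hx
    by_cases hd : d = 0
    · subst hd; exact stdForm_flip_adjacent_of_ne κ x s (by simpa using he) hx
    obtain ⟨r, hr⟩ := hl (κ p + 1) (by rw [Set.mem_uIcc]; left; push_cast at he; omega)
    have hrq : Linked κ r q := fun k hk => hl k (by
      rw [Set.mem_uIcc] at hk ⊢; push_cast at he; omega)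
    have hpq : p ≠ q := fun h => hx (by rw [h])
    have hpr : p ≠ r := fun h => by rw [h] at hr; omega
    have hqr : q ≠ r := fun h => by rw [h] at he; push_cast at he; omega
    by_cases hxr : x r = x p
    · refine (ih x (p := r) (q := q) hrq (by push_cast at he; omega) (hxr ▸ hx)).trans ?_
      have := stdForm_flip_adjacent_of_ne κ (flip {r, q} x) s (p := p) (q := r) hr (by
        simp [flip, hpr, hpq]; grind)
      rwa [show flip {p, r} (flip {r, q} x) = flip {p, q} x from ?_] at this
      funext i
      simp only [flip, Finset.mem_insert, Finset.mem_singleton]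
      by_cases h1 : i = p <;> by_cases h2 : i = q <;> by_cases h3 : i = r <;> simp_all
    · refine (stdForm_flip_adjacent_of_ne κ x s (p := p) (q := r) hr (Ne.symm hxr)).trans ?_
      have := ih (flip {p, r} x) (p := r) (q := q) hrq (by push_cast at he; omega) (by
        simp only [flip]
        revert hx hxr
        cases x p <;> cases x q <;> cases x r <;> simp [hqr, hpq.symm])
      rwa [show flip {r, q} (flip {p, r} x) = flip {p, q} x from ?_] at this
      funext i
      simp only [flip, Finset.mem_insert, Finset.mem_singleton]
      by_cases h1 : i = p <;> by_cases h2 : i = q <;> by_cases h3 : i = r <;> simp_all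

theorem stdForm_flip_linked (κ : ι → ℤ) (x s : ι → Bool) {p q : ι} (hl : Linked κ p q)
    (hx : x p ≠ x q) : Isom (stdForm κ x s) (stdForm κ (flip {p, q} x) s) := by
  rcases le_total (κ p) (κ q) with h | h
  · exact stdForm_flip_of_linked κ s (κ q - κ p).toNat x hl (by omega) hx
  · rw [Finset.pair_comm]
    exact stdForm_flip_of_linked κ s (κ p - κ q).toNat x hl.symm (by omega) hx.symm

theorem stdForm_swap_linked (κ : ι → ℤ) (x s : ι → Bool) {p q : ι} (hl : Linked κ p q) :
    Isom (stdForm κ x s) (stdForm κ (x ∘ Equiv.swap p q) s) := by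
  by_cases hx : x p = x q
  · rw [comp_swap_eq_self hx]
    exact Isom.refl _
  · rw [comp_swap_eq_flip hx]
    exact stdForm_flip_linked κ x s hl hx

theorem stdForm_flip_of_adjacent (κ : ι → ℤ) (x s : ι → Bool) {p q r t : ι} (hpq : p ≠ q)
    (hx : x p = x q) (hp : Linked κ p r) (hq : Linked κ q r) (hrt : κ t = κ r + 1) :
    Isom (stdForm κ x s) (stdForm κ (flip {p, q} x) (flip {r, t} s)) := by
  have hne : r ≠ t := fun h => by rw [h] at hrt; omega
  have hl : Linked κ r t := fun k hk => by
    rw [Set.mem_uIcc] at hk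
    rcases (by omega : k = κ r ∨ k = κ t) with rfl | rfl <;> exact ⟨_, rfl⟩
  set τ₁ := Equiv.swap p r with hτ₁
  set τ₂ := Equiv.swap t (τ₁ q) with hτ₂
  have hqr : τ₁ q ≠ r := by
    rw [hτ₁, Ne, Equiv.swap_apply_eq_iff, Equiv.swap_apply_right]; exact hpq.symm
  have h2 : τ₂ r = r := Equiv.swap_apply_of_ne_of_ne hne hqr.symm
  have hl2 : Linked κ t (τ₁ q) := by
    by_cases h : q = r
    · subst h
      rw [hτ₁, Equiv.swap_apply_right]
      exact hl.symm.trans hp.symm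
    · rw [hτ₁, Equiv.swap_apply_of_ne_of_ne hpq.symm h]
      exact hl.symm.trans hq.symm
  refine (stdForm_swap_linked κ x s hp).trans <| (stdForm_swap_linked κ _ s hl2).trans <|
    (stdForm_flip_adjacent_of_eq κ _ s hrt ?_).trans <|
    (stdForm_swap_linked κ _ _ hl2).trans <| (stdForm_swap_linked κ _ _ hp).trans ?_
  · change x (τ₁ (τ₂ r)) = x (τ₁ (τ₂ t))
    rw [h2, hτ₂, Equiv.swap_apply_left, hτ₁, Equiv.swap_apply_right, Equiv.swap_apply_self, hx]
  · rw [show (flip {r, t} ((x ∘ τ₁) ∘ τ₂) ∘ τ₂) ∘ τ₁ = flip {p, q} x from ?_]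
    · exact Isom.refl _
    funext i
    have h3 : τ₂ (τ₁ i) = r ↔ i = p := by
      rw [hτ₂, Equiv.swap_apply_eq_iff, ← hτ₂, h2, hτ₁, Equiv.swap_apply_eq_iff,
        Equiv.swap_apply_right]
    have h4 : τ₂ (τ₁ i) = t ↔ i = q := by
      rw [hτ₂, Equiv.swap_apply_eq_iff, Equiv.swap_apply_left, τ₁.injective.eq_iff]
    simp only [flip, Function.comp_apply, Finset.mem_insert, Finset.mem_singleton, h3, h4]
    rw [hτ₂, Equiv.swap_apply_self, hτ₁, Equiv.swap_apply_self]

/-- The sign attached to a bit. -/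
def bitSign (b : Bool) : ℤˣ := if b then -1 else 1

/-- Two families of bits with the same product of signs on each scale. -/
def SameSigns (κ : ι → ℤ) (s s' : ι → Bool) : Prop :=
  ∀ k, ∏ i with κ i = k, bitSign (s i) = ∏ i with κ i = k, bitSign (s' i)

omit [Fintype ι] in
theorem prod_bitSign_flip (F D : Finset ι) (s : ι → Bool) :
    ∏ i ∈ F, bitSign (flip D s i) = (∏ i ∈ F, bitSign (s i)) * (-1) ^ (F ∩ D).card := by
  rw [← Finset.prod_const, ← Finset.filter_mem_eq_inter, Finset.prod_filter,
    ← Finset.prod_mul_distrib]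
  refine Finset.prod_congr rfl fun i _ => ?_
  by_cases h : i ∈ D <;> cases hs : s i <;> simp [flip, bitSign, h, hs]

omit [Fintype ι] in
theorem neg_one_pow_eq_one_iff {n : ℕ} : ((-1 : ℤˣ)) ^ n = 1 ↔ Even n := by
  rcases Nat.even_or_odd n with h | h
  · simp [h]
  · simp [h.neg_one_pow, h]

omit [Fintype ι] in
theorem eq_flip_of_ne {s s' : ι → Bool} {D : Finset ι} (h : ∀ i, i ∈ D ↔ s i ≠ s' i) :
    s' = flip D s := by
  funext i
  by_cases hi : s i = s' i
  · simp [flip, h, hi]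
  · have := Bool.eq_not.2 (Ne.symm hi)
    simp [flip, h, this]

/-- A relation closed under negating pairs of bits on the same scale relates all families of
bits with the same signs. -/
theorem relation_of_sameSigns {κ : ι → ℤ} (R : (ι → Bool) → (ι → Bool) → Prop)
    (hrefl : ∀ s, R s s) (htrans : ∀ {s t u}, R s t → R t u → R s u)
    (hpair : ∀ s p q, p ≠ q → κ p = κ q → R s (flip {p, q} s)) {s s' : ι → Bool}
    (h : SameSigns κ s s') : R s s' := by
  have key : ∀ (n : ℕ) (D : Finset ι), D.card = n →
      (∀ k, Even ((Finset.univ.filter fun i => κ i = k) ∩ D).card) → ∀ s, R s (flip D s) := by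
    intro n
    induction n using Nat.strong_induction_on with
    | _ n ih =>
    intro D hn hD s
    rcases D.eq_empty_or_nonempty with rfl | ⟨p, hp⟩
    · rw [flip_empty]; exact hrefl s
    have hp' : p ∈ (Finset.univ.filter fun i => κ i = κ p) ∩ D := by simp [hp]
    obtain ⟨q, hq, hqp⟩ : ∃ q ∈ (Finset.univ.filter fun i => κ i = κ p) ∩ D, q ≠ p := by
      apply Finset.exists_mem_ne _ p
      have h1 := Finset.card_pos.2 ⟨p, hp'⟩
      have h2 := hD (κ p)
      rcases h2 with ⟨m, hm⟩
      omega
    simp only [Finset.mem_inter, Finset.mem_filter, Finset.mem_univ, true_and] at hq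
    have hsub : {p, q} ⊆ D := by simp [Finset.insert_subset_iff, hp, hq.2]
    refine htrans (hpair s p q hqp.symm hq.1.symm) ?_
    rw [← flip_flip_of_subset hsub s]
    have hcard := Finset.card_sdiff_add_card_eq_card hsub
    rw [Finset.card_pair hqp.symm] at hcard
    refine ih _ (by omega) (D \ {p, q}) rfl (fun k => ?_) _
    rw [← Finset.inter_sdiff_assoc]
    by_cases hk : κ p = k
    · have hsub' : {p, q} ⊆ (Finset.univ.filter fun i => κ i = k) ∩ D := by
        simp [Finset.insert_subset_iff, hp, hq.2, hk, ← hq.1.trans hk]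
      have hcard' := Finset.card_sdiff_add_card_eq_card hsub'
      rw [Finset.card_pair hqp.symm] at hcard'
      have := hD k
      rw [← hcard'] at this
      simpa [Nat.even_add] using this
    · rw [Finset.sdiff_eq_self_of_disjoint]
      · exact hD k
      · rw [Finset.disjoint_left]
        simp only [Finset.mem_inter, Finset.mem_filter, Finset.mem_univ, true_and,
          Finset.mem_insert, Finset.mem_singleton, not_or]
        rintro i ⟨hi, -⟩
        exact ⟨by rintro rfl; exact hk hi, by rintro rfl; exact hk (hq.1.symm.trans hi)⟩
  have hfl := eq_flip_of_ne (s := s) (s' := s') (D := Finset.univ.filter fun i => s i ≠ s' i)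
    (by simp)
  rw [hfl]
  refine key _ _ rfl (fun k => ?_) s
  have := h k
  rw [hfl, prod_bitSign_flip, left_eq_mul, neg_one_pow_eq_one_iff] at this
  exact this

theorem stdForm_of_sameSigns {κ : ι → ℤ} (x : ι → Bool) {s s' : ι → Bool}
    (h : SameSigns κ s s') : Isom (stdForm κ x s) (stdForm κ x s') :=
  relation_of_sameSigns (fun s s' => Isom (stdForm κ x s) (stdForm κ x s')) (fun _ => Isom.refl _)
    (fun h h' => h.trans h') (fun s _ _ hpq he => stdForm_flip_signs κ x s hpq he) h

omit [DecidableEq ι] in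
theorem SameSigns.symm {κ : ι → ℤ} {s s' : ι → Bool} (h : SameSigns κ s s') : SameSigns κ s' s :=
  fun k => (h k).symm

omit [DecidableEq ι] in
theorem SameSigns.trans {κ : ι → ℤ} {s s' s'' : ι → Bool} (h : SameSigns κ s s')
    (h' : SameSigns κ s' s'') : SameSigns κ s s'' :=
  fun k => (h k).trans (h' k)

/-- Four entries of the same scale and with the same residue modulo `4`, in standard position. -/
theorem isom_four (k : ℤ) (t : Bool) :
    ∃ c : Fin 4 → Bool, ∏ i, bitSign (c i) = bitSign t ∧
      Isom (piSum fun i : Fin 4 => unary k (stdUnit false (![t, false, false, false] i) : ℤ_[2]))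
        (piSum fun i => unary k (stdUnit true (c i) : ℤ_[2])) := by
  have hc : ∀ (b : Fin 4 → ℤ) (c : Fin 4 → Bool), (∀ i, b i % 8 = stdUnit true (c i) % 8) →
      Isom (piSum fun i => unary k (b i : ℤ_[2]))
        (piSum fun i => unary k (stdUnit true (c i) : ℤ_[2])) := fun b c h =>
    isom_piSum fun i => isom_unary_congr k (isUnit_intCast (stdUnit_emod_two _ _)) (by
      rw [toZModPow_intCast, toZModPow_intCast]
      exact (ZMod.intCast_eq_intCast_iff _ _ 8).2 (h i))
  cases t
  · refine ⟨fun _ => false, by decide, (isom_quaternary k _ ![7, 7, 7, 7]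
      !![2, -1, -1, -1; 1, 2, -1, 1; 1, 1, 2, -1; 1, -1, 1, 2] ?_ ?_).trans (hc _ _ ?_)⟩
    · simp [Matrix.det_succ_row_zero, Fin.sum_univ_succ, Fin.succAbove]
    · ext i j; fin_cases i <;> fin_cases j <;>
        simp [Matrix.mul_apply, Fin.sum_univ_succ, Matrix.diagonal, stdUnit]
    · decide
  · refine ⟨![false, true, true, true], by decide, (isom_quaternary k _ ![7, 3, 19, 1995]
      !![1, 0, 1, 3; 1, 1, -2, -25; 1, -1, -3, 10; 0, 1, -1, 35] ?_ ?_).trans (hc _ _ ?_)⟩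
    · simp [Matrix.det_succ_row_zero, Fin.sum_univ_succ, Fin.succAbove]
    · ext i j; fin_cases i <;> fin_cases j <;>
        simp [Matrix.mul_apply, Fin.sum_univ_succ, Matrix.diagonal, stdUnit]
    · decide

omit [DecidableEq ι] in
theorem SameSigns.extend {κ : ι → ℤ} {f : Fin 4 → ι} (hf : Function.Injective f) {k : ℤ}
    (hk : ∀ j, κ (f j) = k) (s : ι → Bool) (c : Fin 4 → Bool)
    (h : ∏ j, bitSign (c j) = ∏ j, bitSign (s (f j))) :
    SameSigns κ s (Function.extend f c s) := by
  classical
  intro l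
  by_cases hl : l = k
  · subst hl
    have hsub : Finset.univ.map ⟨f, hf⟩ ⊆ Finset.univ.filter fun i => κ i = l := by
      intro i hi
      obtain ⟨j, -, rfl⟩ := Finset.mem_map.1 hi
      simp [hk]
    rw [← Finset.prod_sdiff hsub, ← Finset.prod_sdiff hsub, Finset.prod_map, Finset.prod_map]
    congr 1
    · refine Finset.prod_congr rfl fun i hi => ?_
      rw [Function.extend_apply' _ _ _ ?_]
      rintro ⟨j, rfl⟩
      simp at hi
    · simp only [Function.Embedding.coeFn_mk, hf.extend_apply]
      exact h.symm
  · refine Finset.prod_congr rfl fun i hi => ?_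
    rw [Function.extend_apply' _ _ _ ?_]
    rintro ⟨j, rfl⟩
    simp only [Finset.mem_filter, hk] at hi
    exact hl hi.2.symm

theorem exists_bitSign_eq (ε : ℤˣ) : ∃ t, bitSign t = ε := by
  rcases Int.units_eq_one_or ε with rfl | rfl
  · exact ⟨false, rfl⟩
  · exact ⟨true, rfl⟩

theorem stdForm_flip_four_of_scale_eq {κ : ι → ℤ} (x s : ι → Bool) {F : Finset ι}
    (hF : F.card = 4) {k : ℤ} (hk : ∀ i ∈ F, κ i = k) {b : Bool} (hx : ∀ i ∈ F, x i = b) :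
    ∃ s', SameSigns κ s s' ∧ Isom (stdForm κ x s) (stdForm κ (flip F x) s') := by
  have key : ∀ x : ι → Bool, (∀ i ∈ F, x i = false) →
      ∃ s', SameSigns κ s s' ∧ Isom (stdForm κ x s) (stdForm κ (flip F x) s') := by
    intro x hx
    let e := (Finset.equivFinOfCardEq hF).symm
    let f : Fin 4 → ι := fun j => e j
    have hf : Function.Injective f := Subtype.val_injective.comp e.injective
    have hfF : ∀ j, f j ∈ F := fun j => (e j).2
    have hrange : ∀ i, i ∈ Set.range f ↔ i ∈ F := fun i =>
      ⟨by rintro ⟨j, rfl⟩; exact hfF j, fun h => ⟨e.symm ⟨i, h⟩, by simp [f]⟩⟩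
    have hκ : ∀ j, κ (f j) = k := fun j => hk _ (hfF j)
    obtain ⟨t, ht⟩ := exists_bitSign_eq (∏ j, bitSign (s (f j)))
    obtain ⟨c, hc, hiso⟩ := isom_four k t
    have h0 : SameSigns κ s (Function.extend f ![t, false, false, false] s) :=
      SameSigns.extend hf hκ s _ (by
        rw [← ht]; simp [Fin.prod_univ_four, bitSign]; rfl)
    refine ⟨Function.extend f c s, SameSigns.extend hf hκ s _ (by rw [hc, ht]),
      (stdForm_of_sameSigns x h0).trans ?_⟩
    refine isom_piSum_of_injective f hf (fun i hi => ?_) ?_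
    · rw [Function.extend_apply' _ _ _ hi, Function.extend_apply' _ _ _ hi]
      rw [hrange] at hi
      simp [flip, hi]
    · simp only [hf.extend_apply, hκ, flip, hfF, hx, decide_true, Bool.xor_true, Bool.not_false]
      exact hiso
  cases b
  · exact key x hx
  · obtain ⟨s', hs, h⟩ := key (flip F x) fun i hi => by simp [flip, hi, hx]
    rw [flip_flip] at h
    exact ⟨s, fun _ => rfl, (stdForm_of_sameSigns x hs).trans h.symm⟩

theorem stdForm_flip_four {κ : ι → ℤ} (x s : ι → Bool) {F : Finset ι} (hF : F.card = 4)
    (hl : ∀ i ∈ F, ∀ j ∈ F, Linked κ i j) {b : Bool} (hx : ∀ i ∈ F, x i = b) :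
    ∃ s', SameSigns κ s s' ∧ Isom (stdForm κ x s) (stdForm κ (flip F x) s') := by
  by_cases hk : ∀ i ∈ F, ∀ j ∈ F, κ i = κ j
  · obtain ⟨p, hp⟩ := Finset.card_pos.1 (by omega : 0 < F.card)
    exact stdForm_flip_four_of_scale_eq x s hF (fun i hi => hk i hi p hp) hx
  have hlt : ∃ p ∈ F, ∃ q ∈ F, κ p < κ q := by
    push Not at hk
    obtain ⟨p, hp, q, hq, hpq⟩ := hk
    rcases lt_or_gt_of_ne hpq with h | h
    · exact ⟨p, hp, q, hq, h⟩
    · exact ⟨q, hq, p, hp, h⟩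
  obtain ⟨r, hr, q, hq, hrq⟩ := hlt
  obtain ⟨t, ht⟩ := hl r hr q hq (κ r + 1) (by rw [Set.mem_uIcc]; omega)
  obtain ⟨a, b', c, d, hab, hac, had, hbc, hbd, hcd, rfl⟩ := Finset.card_eq_four.1 hF
  refine ⟨s, fun _ => rfl, ?_⟩
  have h1 := stdForm_flip_of_adjacent κ x s hab ((hx a (by simp)).trans (hx b' (by simp)).symm)
    (hl a (by simp) r hr) (hl b' (by simp) r hr) ht
  have h2 := stdForm_flip_of_adjacent κ (flip {a, b'} x) (flip {r, t} s) hcd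
    (by simp [flip, hac.symm, had.symm, hbc.symm, hbd.symm, hx c, hx d])
    (hl c (by simp) r hr) (hl d (by simp) r hr) ht
  rw [flip_flip, show flip {c, d} (flip {a, b'} x) = flip {a, b', c, d} x from ?_] at h2
  · exact h1.trans h2
  · have h3 := flip_flip_of_subset (F := {a, b'}) (D := {a, b', c, d})
      (by intro i; simp; tauto) x
    rw [← h3]
    congr 1
    ext i
    simp only [Finset.mem_sdiff, Finset.mem_insert, Finset.mem_singleton]
    constructor
    · rintro (rfl | rfl) <;> simp [hac.symm, had.symm, hbc.symm, hbd.symm]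
    · tauto

/-- The contribution of a bit to the oddity. -/
def bitOddity (b : Bool) : ZMod 4 := if b then -1 else 1

open Classical in
theorem exists_stdForm_flip {κ : ι → ℤ} (n : ℕ) : ∀ (D : Finset ι), D.card = n →
    ∀ (x s : ι → Bool), (∀ i, ∑ j ∈ D with Linked κ i j, bitOddity (x j) = 0) →
    ∃ s', SameSigns κ s s' ∧ Isom (stdForm κ x s) (stdForm κ (flip D x) s') := by
  induction n using Nat.strong_induction_on with
  | _ n ih =>
  intro D hn x s hD
  rcases D.eq_empty_or_nonempty with rfl | ⟨p, hp⟩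
  · exact ⟨s, fun _ => rfl, by rw [flip_empty]; exact Isom.refl _⟩
  have hrefl : ∀ i, Linked κ i i := fun i k hk => ⟨i, by simpa [eq_comm] using hk⟩
  have step : ∀ F : Finset ι, F ⊆ D → F.Nonempty → (∀ i ∈ F, Linked κ p i) →
      ∑ j ∈ F, bitOddity (x j) = 0 →
      (∃ s', SameSigns κ s s' ∧ Isom (stdForm κ x s) (stdForm κ (flip F x) s')) →
      ∃ s', SameSigns κ s s' ∧ Isom (stdForm κ x s) (stdForm κ (flip D x) s') := by
    rintro F hFD hF hl hsum ⟨s₁, hs₁, h₁⟩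
    have hcard := Finset.card_sdiff_add_card_eq_card hFD
    have hpos := hF.card_pos
    obtain ⟨s₂, hs₂, h₂⟩ := ih _ (by omega) (D \ F) rfl (flip F x) s₁ fun i => by
      have h3 : ∑ j ∈ D \ F with Linked κ i j, bitOddity (flip F x j) =
          ∑ j ∈ D \ F with Linked κ i j, bitOddity (x j) := by
        refine Finset.sum_congr rfl fun j hj => ?_
        simp only [Finset.mem_filter, Finset.mem_sdiff] at hj
        simp [flip, hj.1.2]
      have h4 : ∑ j ∈ F with Linked κ i j, bitOddity (x j) = 0 := by
        by_cases hip : Linked κ i p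
        · rw [Finset.filter_true_of_mem fun j hj => hip.trans (hl j hj), hsum]
        · rw [Finset.filter_false_of_mem fun j hj h => hip (h.trans (hl j hj).symm),
            Finset.sum_empty]
      have h5 := hD i
      rw [Finset.sum_filter] at h3 h4 h5 ⊢
      rw [← Finset.sum_sdiff hFD, h4, add_zero] at h5
      rw [h3, Finset.sum_filter, h5]
    rw [flip_flip_of_subset hFD] at h₂
    exact ⟨s₂, hs₁.trans hs₂, h₁.trans h₂⟩
  by_cases hq : ∃ q ∈ D, Linked κ p q ∧ x q ≠ x p
  · obtain ⟨q, hq, hpq, hx⟩ := hq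
    have hne : p ≠ q := fun h => hx (by rw [h])
    refine step {p, q} (by simp [Finset.insert_subset_iff, hp, hq]) ⟨p, by simp⟩ ?_ ?_
      ⟨s, fun _ => rfl, stdForm_flip_linked κ x s hpq hx.symm⟩
    · simp [hrefl, hpq]
    · rw [Finset.sum_pair hne]
      revert hx
      cases x p <;> cases x q <;> decide
  · push Not at hq
    have h1 : ∑ j ∈ D with Linked κ p j, bitOddity (x j) =
        ((D.filter fun j => Linked κ p j).card : ZMod 4) * bitOddity (x p) := by
      rw [Finset.sum_congr rfl (g := fun _ => bitOddity (x p)), Finset.sum_const, nsmul_eq_mul]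
      intro j hj
      rw [Finset.mem_filter] at hj
      rw [hq j hj.1 hj.2]
    have h2 : ((D.filter fun j => Linked κ p j).card : ZMod 4) = 0 := by
      have h3 := hD p
      rw [h1] at h3
      revert h3
      generalize ((D.filter fun j => Linked κ p j).card : ZMod 4) = a
      cases x p <;> revert a <;> decide
    rw [ZMod.natCast_eq_zero_iff] at h2
    have h4 : 0 < (D.filter fun j => Linked κ p j).card :=
      Finset.card_pos.2 ⟨p, by simp [hp, hrefl]⟩
    obtain ⟨F, hF, hF4⟩ := Finset.exists_subset_card_eq (Nat.le_of_dvd h4 h2)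
    have hFm : ∀ i ∈ F, i ∈ D ∧ Linked κ p i := fun i hi => Finset.mem_filter.1 (hF hi)
    refine step F (fun i hi => (hFm i hi).1) (Finset.card_pos.1 (by omega))
      (fun i hi => (hFm i hi).2) ?_
      (stdForm_flip_four x s hF4 (fun i hi j hj => (hFm i hi).2.symm.trans (hFm j hj).2)
        fun i hi => hq i (hFm i hi).1 (hFm i hi).2)
    rw [Finset.sum_congr rfl (g := fun _ => bitOddity (x p)), Finset.sum_const, hF4]
    · cases x p <;> decide
    · intro j hj
      rw [hq j (hFm j hj).1 (hFm j hj).2]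

/-- The correction to the oddity attached to a sign. -/
def signOddity (ε : ℤˣ) : ZMod 8 := if ε = 1 then 0 else 4

theorem signOddity_mul (ε δ : ℤˣ) : signOddity (ε * δ) = signOddity ε + signOddity δ := by
  rcases Int.units_eq_one_or ε with rfl | rfl <;> rcases Int.units_eq_one_or δ with rfl | rfl <;>
    decide

theorem signOddity_prod {α : Type*} (F : Finset α) (ε : α → ℤˣ) :
    signOddity (∏ i ∈ F, ε i) = ∑ i ∈ F, signOddity (ε i) := by
  classical
  induction F using Finset.induction_on with
  | empty => simp [signOddity]
  | insert i F hi ih => rw [Finset.prod_insert hi, Finset.sum_insert hi, signOddity_mul, ih]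

omit [DecidableEq ι] in
theorem SameSigns.prod_eq {κ : ι → ℤ} {s s' : ι → Bool} (h : SameSigns κ s s')
    (p : ℤ → Prop) [DecidablePred p] :
    ∏ j with p (κ j), bitSign (s j) = ∏ j with p (κ j), bitSign (s' j) := by
  classical
  rw [← Finset.prod_fiberwise_of_maps_to (g := κ) (t := Finset.univ.image κ) (by simp),
    ← Finset.prod_fiberwise_of_maps_to (g := κ) (t := Finset.univ.image κ) (by simp)]
  refine Finset.prod_congr rfl fun k _ => ?_
  rw [Finset.filter_filter]
  by_cases hk : p k
  · rw [Finset.filter_congr (q := fun i => κ i = k) fun i _ =>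
      ⟨fun h => h.2, fun h => ⟨h ▸ hk, h⟩⟩]
    exact h k
  · rw [Finset.filter_false_of_mem (p := fun i => p (κ i) ∧ κ i = k) fun i _ hi => hk (hi.2 ▸ hi.1)]
    rfl

theorem stdUnit_cast (x s : Bool) :
    ((stdUnit x s : ℤ) : ZMod 8) = (if x then -1 else 1 : ℤ) + signOddity (bitSign s) := by
  revert x s; decide

open Classical in
/-- Diagonal forms with the same scales, signs and compartment oddities are isometric. -/
theorem isom_stdForm {κ : ι → ℤ} {x s x' s' : ι → Bool} (hs : SameSigns κ s s')
    (hx : ∀ i, ∑ j with Linked κ i j, ((stdUnit (x j) (s j) : ℤ) : ZMod 8) =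
      ∑ j with Linked κ i j, ((stdUnit (x' j) (s' j) : ℤ) : ZMod 8)) :
    Isom (stdForm κ x s) (stdForm κ x' s') := by
  have hfl := eq_flip_of_ne (s := x) (s' := x') (D := Finset.univ.filter fun i => x i ≠ x' i)
    (by simp)
  obtain ⟨s₁, hs₁, h₁⟩ := exists_stdForm_flip (κ := κ) _ (Finset.univ.filter fun i => x i ≠ x' i)
    rfl x s fun i => by
      have h := hx i
      simp only [stdUnit_cast, Finset.sum_add_distrib, ← signOddity_prod] at h
      have hp : ∏ j with Linked κ i j, bitSign (s j) = ∏ j with Linked κ i j, bitSign (s' j) :=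
        hs.prod_eq fun k => ∀ l ∈ Set.uIcc (κ i) k, ∃ r, κ r = l
      rw [hp] at h
      have h' := add_right_cancel h
      rw [← Int.cast_sum, ← Int.cast_sum, ← sub_eq_zero, ← Int.cast_sub,
        ← Finset.sum_sub_distrib] at h'
      have h2 : ∀ j, ((if x j then -1 else 1 : ℤ) - if x' j then -1 else 1) =
          2 * if x j ≠ x' j then (if x j then -1 else 1 : ℤ) else 0 := fun j => by
        cases x j <;> cases x' j <;> decide
      simp only [h2, ← Finset.mul_sum] at h'
      rw [← Finset.sum_filter, Finset.filter_filter] at h'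
      have h3 := (ZMod.intCast_zmod_eq_zero_iff_dvd _ 8).1 h'
      have h4 : (4 : ℤ) ∣ ∑ j with Linked κ i j ∧ x j ≠ x' j, (if x j then -1 else 1 : ℤ) := by
        have : (2 * 4 : ℤ) ∣ 2 * ∑ j with Linked κ i j ∧ x j ≠ x' j, (if x j then -1 else 1 : ℤ) :=
          by exact_mod_cast h3
        exact (mul_dvd_mul_iff_left (by norm_num)).1 this
      have h5 := (ZMod.intCast_zmod_eq_zero_iff_dvd _ 4).2 h4
      push_cast at h5
      rw [Finset.filter_filter]
      simp only [and_comm] at h5 ⊢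
      exact h5
  rw [← hfl] at h₁
  exact h₁.trans (stdForm_of_sameSigns x' (hs₁.symm.trans hs))

end Configurations

/-! ## Unimodular forms -/

section Splitting

variable {W M : Type*} [AddCommGroup W] [Module ℤ_[2] W] [AddCommGroup M] [Module ℤ_[2] M]

/-- The orthogonal complement of the image of `j`. -/
noncomputable def orthComplement (b : LinearMap.BilinForm ℤ_[2] M) (j : W →ₗ[ℤ_[2]] M) : Submodule ℤ_[2] M :=
  LinearMap.ker ((LinearMap.lcomp ℤ_[2] ℤ_[2] j) ∘ₗ b)

theorem mem_orthComplement {b : LinearMap.BilinForm ℤ_[2] M} {j : W →ₗ[ℤ_[2]] M} {y : M} :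
    y ∈ orthComplement b j ↔ ∀ w, b y (j w) = 0 := by
  rw [orthComplement, LinearMap.mem_ker, LinearMap.ext_iff]
  rfl

/-- A unimodular subspace splits off. -/
theorem exists_splitting {bW : LinearMap.BilinForm ℤ_[2] W} {b : LinearMap.BilinForm ℤ_[2] M}
    (hW : IsUnimodular bW) (hb : IsUnimodular b) (hs : ∀ x y, b x y = b y x)
    (j : W →ₗ[ℤ_[2]] M) (hj : ∀ w w', b (j w) (j w') = bW w w') :
    IsUnimodular (b.restrict (orthComplement b j)) ∧
      ∃ e : (W × orthComplement b j) ≃ₗ[ℤ_[2]] M,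
        ∀ z, b (e z) (e z) = bW z.1 z.1 + b z.2 z.2 := by
  let eW := LinearEquiv.ofBijective bW hW
  let π : M →ₗ[ℤ_[2]] W := eW.symm.toLinearMap ∘ₗ (LinearMap.lcomp ℤ_[2] ℤ_[2] j) ∘ₗ b
  have hπ : ∀ y w, bW (π y) w = b y (j w) := fun y w => by
    have : eW (π y) = (LinearMap.lcomp ℤ_[2] ℤ_[2] j) (b y) := eW.apply_symm_apply _
    exact congrArg (fun φ : W →ₗ[ℤ_[2]] ℤ_[2] => φ w) this
  have hπj : ∀ w, π (j w) = w := fun w => hW.1 (LinearMap.ext fun w' => by rw [hπ, hj])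
  have hmem : ∀ y, y - j (π y) ∈ orthComplement b j := fun y => mem_orthComplement.2 fun w => by
    rw [map_sub, LinearMap.sub_apply, hj, hπ, sub_self]
  have hker : ∀ y ∈ orthComplement b j, π y = 0 := fun y hy => hW.1 (LinearMap.ext fun w' => by
    rw [hπ, mem_orthComplement.1 hy, map_zero, LinearMap.zero_apply])
  let p : M →ₗ[ℤ_[2]] orthComplement b j :=
    (LinearMap.id - j ∘ₗ π).codRestrict _ hmem
  have hp : ∀ y, (p y : M) = y - j (π y) := fun _ => rfl
  refine ⟨⟨?_, ?_⟩, LinearEquiv.ofLinearMap (j.coprod (Submodule.subtype _)) (π.prod p) ?_ ?_, ?_⟩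
  · rw [← LinearMap.ker_eq_bot, LinearMap.ker_eq_bot']
    intro n hn
    apply Subtype.ext
    refine hb.1 (LinearMap.ext fun y => ?_)
    have h1 := congrArg (fun φ : orthComplement b j →ₗ[ℤ_[2]] ℤ_[2] => φ (p y)) hn
    change b n (p y) = 0 at h1
    rw [hp, map_sub, mem_orthComplement.1 n.2, sub_zero] at h1
    simpa using h1
  · intro φ
    obtain ⟨m, hm⟩ := hb.2 (φ ∘ₗ p)
    refine ⟨p m, LinearMap.ext fun n => ?_⟩
    change b (p m) n = φ n
    have h2 : p n = n := Subtype.ext (by rw [hp, hker _ n.2, map_zero, sub_zero])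
    rw [hp, map_sub, LinearMap.sub_apply, hm, hs (j _), mem_orthComplement.1 n.2, sub_zero,
      LinearMap.comp_apply, h2]
  · ext y
    simp [hp]
  · apply LinearMap.prod_ext
    · ext w
      · simp [hπj]
      · simp [hp, hπj]
    · ext n
      · simp [hker _ n.2]
      · simp [hp, hker _ n.2]
  · rintro ⟨w, n⟩
    have h1 := mem_orthComplement.1 n.2 w
    have h2 := h1
    rw [hs] at h2
    simp [hj, h1, h2]

end Splitting

section Models

/-- The form `u x y`. -/
noncomputable def unaryBilin (u : ℤ_[2]) : LinearMap.BilinForm ℤ_[2] ℤ_[2] :=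
  u • LinearMap.mul ℤ_[2] ℤ_[2]

theorem isUnimodular_unaryBilin {u : ℤ_[2]} (hu : IsUnit u) : IsUnimodular (unaryBilin u) := by
  obtain ⟨u, rfl⟩ := hu
  constructor
  · intro x y h
    have := congrArg (fun φ : ℤ_[2] →ₗ[ℤ_[2]] ℤ_[2] => φ 1) h
    simpa [unaryBilin] using this
  · intro φ
    refine ⟨(↑u⁻¹ : ℤ_[2]) * φ 1, ?_⟩
    ext
    simp [unaryBilin]

/-- The binary form with matrix `[2a, 1; 1, 2c]`. -/
noncomputable def planeBilin (a c : ℤ_[2]) : LinearMap.BilinForm ℤ_[2] (ℤ_[2] × ℤ_[2]) :=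
  LinearMap.mk₂ ℤ_[2]
    (fun z w => 2 * a * (z.1 * w.1) + z.1 * w.2 + z.2 * w.1 + 2 * c * (z.2 * w.2))
    (fun z z' w => by simp; ring) (fun r z w => by simp; ring)
    (fun z w w' => by simp; ring) (fun r z w => by simp; ring)

theorem planeBilin_apply (a c : ℤ_[2]) (z w : ℤ_[2] × ℤ_[2]) : planeBilin a c z w =
    2 * a * (z.1 * w.1) + z.1 * w.2 + z.2 * w.1 + 2 * c * (z.2 * w.2) := rfl

theorem isUnimodular_planeBilin (a c : ℤ_[2]) : IsUnimodular (planeBilin a c) := by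
  obtain ⟨d, hd⟩ := isUnit_one_add_two_mul (-(2 * a * c)) 
  have h1 := d.inv_mul
  rw [hd] at h1
  constructor
  · rw [← LinearMap.ker_eq_bot, LinearMap.ker_eq_bot']
    rintro ⟨x, y⟩ h
    have e1 := congrArg (fun φ : ℤ_[2] × ℤ_[2] →ₗ[ℤ_[2]] ℤ_[2] => φ (1, 0)) h
    have e2 := congrArg (fun φ : ℤ_[2] × ℤ_[2] →ₗ[ℤ_[2]] ℤ_[2] => φ (0, 1)) h
    simp only [planeBilin_apply, LinearMap.zero_apply] at e1 e2
    ext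
    · change x = 0
      linear_combination (-x) * h1 + (↑d⁻¹ : ℤ_[2]) * (e2 - 2 * c * e1)
    · change y = 0
      linear_combination (-y) * h1 + (↑d⁻¹ : ℤ_[2]) * (e1 - 2 * a * e2)
  · intro φ
    refine ⟨((↑d⁻¹ : ℤ_[2]) * (φ (0, 1) - 2 * c * φ (1, 0)),
      (↑d⁻¹ : ℤ_[2]) * (φ (1, 0) - 2 * a * φ (0, 1))), ?_⟩
    ext
    · simp [planeBilin_apply]
      linear_combination φ (1, 0) * h1
    · simp [planeBilin_apply]
      linear_combination φ (0, 1) * h1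

/-- Linear change of two variables. -/
theorem exists_linearEquiv_pair (p r s t : ℤ_[2]) (h : IsUnit (p * t - r * s)) :
    ∃ e : (ℤ_[2] × ℤ_[2]) ≃ₗ[ℤ_[2]] (ℤ_[2] × ℤ_[2]),
      ∀ z, e z = (p * z.1 + r * z.2, s * z.1 + t * z.2) := by
  obtain ⟨d, hd⟩ := h
  have h1 := d.inv_mul
  rw [hd] at h1
  refine ⟨LinearEquiv.ofLinearMap
    (LinearMap.prod (p • LinearMap.fst _ _ _ + r • LinearMap.snd _ _ _)
      (s • LinearMap.fst _ _ _ + t • LinearMap.snd _ _ _))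
    ((↑d⁻¹ : ℤ_[2]) • LinearMap.prod (t • LinearMap.fst _ _ _ - r • LinearMap.snd _ _ _)
      (p • LinearMap.snd _ _ _ - s • LinearMap.fst _ _ _)) ?_ ?_, fun _ => rfl⟩
  · ext <;> simp <;> first | ring1 | linear_combination h1
  · ext <;> simp <;> first | ring1 | linear_combination h1 | linear_combination hd

/-- The norm form of the hyperbolic plane (`false`) or of the anisotropic plane (`true`). -/
noncomputable def planeNorm (ε : Bool) (z : ℤ_[2] × ℤ_[2]) : ℤ_[2] :=
  planeBilin (if ε then 1 else 0) (if ε then 1 else 0) z z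

theorem isom_planeNorm_of_dvd {a c : ℤ_[2]} (hc : 2 ∣ c) :
    Isom (fun z => planeBilin a c z z) (planeNorm false) := by
  obtain ⟨x, hx⟩ := exists_quadratic_root (a := a) isUnit_one hc
  obtain ⟨d, hd⟩ := isUnit_one_add_two_mul (a * x)
  have h1 := d.inv_mul
  rw [hd] at h1
  set μ : ℤ_[2] := ↑d⁻¹
  obtain ⟨e, he⟩ := exists_linearEquiv_pair x (μ - a * μ ^ 2 * x) 1 (-(a * μ ^ 2)) (by
    convert d⁻¹.isUnit.neg using 1; ring)
  refine Isom.symm ⟨e, fun z => ?_⟩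
  simp only [he, planeNorm, planeBilin_apply, Bool.false_eq_true, if_false]
  linear_combination
    (2 * z.1 ^ 2 - 4 * a * μ ^ 2 * z.1 * z.2 + 2 * a ^ 2 * μ ^ 4 * z.2 ^ 2) * hx +
    (2 * z.1 * z.2 - 2 * a * μ ^ 2 * z.2 ^ 2) * h1

theorem isom_planeBilin_swap (a c : ℤ_[2]) :
    Isom (fun z => planeBilin a c z z) (fun z => planeBilin c a z z) :=
  ⟨LinearEquiv.prodComm _ _ _, fun z => by
    simp only [LinearEquiv.prodComm_apply, planeBilin_apply, Prod.fst_swap, Prod.snd_swap]; ring⟩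

theorem two_dvd_sub_one {a : ℤ_[2]} (h : ¬ 2 ∣ a) : 2 ∣ a - 1 := by
  have h1 := not_dvd_iff_isUnit.1 h
  by_contra h2
  have h3 := (not_dvd_iff_isUnit.1 h2).map (PadicInt.toZMod (p := 2))
  have h4 := h1.map (PadicInt.toZMod (p := 2))
  rw [map_sub, map_one] at h3
  revert h3 h4
  generalize PadicInt.toZMod (p := 2) a = y
  rw [isUnit_iff_ne_zero, isUnit_iff_ne_zero]
  revert y
  decide

theorem isom_planeNorm_of_not_dvd {a c : ℤ_[2]} (ha : ¬ 2 ∣ a) (hc : ¬ 2 ∣ c) :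
    Isom (fun z => planeBilin a c z z) (planeNorm true) := by
  have key : ∀ c : ℤ_[2], ¬ 2 ∣ c → Isom (planeNorm true) (fun z => planeBilin 1 c z z) := by
    intro c hc
    obtain ⟨α, hα⟩ := exists_quadratic_root (a := 4 * c - 1) (b := 1 - 4 * c) (c := c - 1)
      (by convert isUnit_one_add_two_mul (-(2 * c)) using 1; ring) (two_dvd_sub_one hc)
    obtain ⟨e, he⟩ := exists_linearEquiv_pair 1 α 0 (1 - 2 * α)
      (by convert isUnit_one_add_two_mul (-α) using 1; ring)
    refine ⟨e, fun z => ?_⟩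
    simp only [he, planeNorm, planeBilin_apply, if_true]
    linear_combination 2 * z.2 ^ 2 * hα
  obtain ⟨y, hy⟩ := exists_quadratic_root (a := c) isUnit_one (two_dvd_sub_one ha)
  obtain ⟨d, hd⟩ := isUnit_one_add_two_mul (c * y)
  have h1 := d.inv_mul
  rw [hd] at h1
  obtain ⟨e, he⟩ := exists_linearEquiv_pair 1 0 y (↑d⁻¹ : ℤ_[2]) (by simp)
  refine Isom.symm ((key (c * (↑d⁻¹ : ℤ_[2]) ^ 2) ?_).trans ⟨e, fun z => ?_⟩)
  · rw [not_dvd_iff_isUnit] at hc ⊢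
    exact hc.mul (d⁻¹.isUnit.pow 2)
  · simp only [he, planeBilin_apply]
    linear_combination 2 * z.1 ^ 2 * hy + 2 * z.1 * z.2 * h1

theorem exists_isom_planeNorm (a c : ℤ_[2]) :
    ∃ ε, Isom (fun z => planeBilin a c z z) (planeNorm ε) := by
  by_cases hc : 2 ∣ c
  · exact ⟨false, isom_planeNorm_of_dvd hc⟩
  by_cases ha : 2 ∣ a
  · exact ⟨false, (isom_planeBilin_swap a c).trans (isom_planeNorm_of_dvd ha)⟩
  exact ⟨true, isom_planeNorm_of_not_dvd ha hc⟩

/-- The sum of two anisotropic planes is the sum of two hyperbolic planes. -/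
theorem isom_planeNorm_sq :
    Isom (fun z : (ℤ_[2] × ℤ_[2]) × (ℤ_[2] × ℤ_[2]) => planeNorm true z.1 + planeNorm true z.2)
      (fun z : (ℤ_[2] × ℤ_[2]) × (ℤ_[2] × ℤ_[2]) =>
        planeNorm false z.1 + planeNorm false z.2) := by
  obtain ⟨θ, hθ⟩ := exists_quadratic_root (a := (1 : ℤ_[2])) (b := 1) (c := 2) isUnit_one dvd_rfl
  obtain ⟨e, he⟩ := exists_linearEquiv_pair θ (-1) 1 (θ + 1)
    (by rw [show θ * (θ + 1) - -1 * 1 = -1 by linear_combination hθ]; exact isUnit_one.neg)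
  have h1 : Isom (planeNorm true) (fun z => - planeNorm true z) := by
    refine ⟨e, fun z => ?_⟩
    simp only [he, planeNorm, planeBilin_apply, if_true]
    linear_combination (-2 * (z.1 ^ 2 + z.1 * z.2 + z.2 ^ 2)) * hθ
  refine ((Isom.refl _).prod h1).trans ?_
  obtain ⟨d, hd⟩ := isUnit_one_add_two_mul (1 : ℤ_[2])
  have h2 := d.inv_mul
  rw [hd] at h2
  set ν : ℤ_[2] := ↑d⁻¹
  refine Isom.symm ⟨LinearEquiv.mk
    { toFun := fun z =>
        let w₁ := ν * (2 * (z.1.2 - z.1.1 - z.2.1) - (z.2.2 - z.2.1))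
        let w₂ := ν * (2 * (z.2.2 - z.2.1) - (z.1.2 - z.1.1 - z.2.1))
        ((z.1.1 + w₁, z.2.1 + w₂), (w₁, w₂))
      map_add' := fun z w => by ext <;> simp <;> ring
      map_smul' := fun r z => by ext <;> simp <;> ring }
    (fun z =>
      ((z.1.1 - z.2.1, z.1.1 - z.2.1 + (z.1.2 - z.2.2) + 2 * z.2.1 + z.2.2),
        (z.1.2 - z.2.2, z.1.2 - z.2.2 + z.2.1 + 2 * z.2.2))) ?_ ?_, fun z => ?_⟩
  · rintro ⟨⟨a, b⟩, ⟨c, f⟩⟩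
    ext <;> simp <;> first
      | ring1
      | linear_combination (b - a - c) * h2
      | linear_combination (f - c) * h2
  · rintro ⟨⟨a, b⟩, ⟨c, f⟩⟩
    ext <;> simp <;> first
      | ring1
      | linear_combination c * h2
      | linear_combination f * h2
  · obtain ⟨⟨a, b⟩, ⟨c, f⟩⟩ := z
    simp only [planeNorm, planeBilin_apply]
    simp
    linear_combination (2 * a * (b - a - c) + 2 * c * (f - c)) * h2

end Models

section Decompositions

theorem isom_piSum_cons {A V : Type*} [AddCommGroup A] [Module ℤ_[2] A] [AddCommMonoid V] {n : ℕ}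
    (q : Fin (n + 1) → A → V) :
    Isom (fun z : A × (Fin n → A) => q 0 z.1 + piSum (fun i => q i.succ) z.2) (piSum q) := by
  refine ⟨Fin.consLinearEquiv ℤ_[2] (fun _ => A), fun z => ?_⟩
  simp [piSum, Fin.sum_univ_succ]

theorem finrank_eq_of_equiv_prod {W M N : Type*} [AddCommGroup W] [Module ℤ_[2] W]
    [AddCommGroup M] [Module ℤ_[2] M] [AddCommGroup N] [Module ℤ_[2] N]
    [Module.Free ℤ_[2] W] [Module.Finite ℤ_[2] W]
    [Module.Free ℤ_[2] N] [Module.Finite ℤ_[2] N] (e : (W × N) ≃ₗ[ℤ_[2]] M) :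
    Module.finrank ℤ_[2] M = Module.finrank ℤ_[2] W + Module.finrank ℤ_[2] N := by
  rw [← e.finrank_eq, Module.finrank_prod]

variable {M : Type*} [AddCommGroup M] [Module ℤ_[2] M] [Module.Free ℤ_[2] M]
  [Module.Finite ℤ_[2] M]

omit [Module.Finite ℤ_[2] M] in
theorem exists_apply_eq_one [Nontrivial M] {b : LinearMap.BilinForm ℤ_[2] M}
    (hb : IsUnimodular b) : ∃ e f, b e f = 1 := by
  let v := Module.Free.chooseBasis ℤ_[2] M
  obtain ⟨i⟩ := v.index_nonempty
  obtain ⟨e, he⟩ := hb.2 (v.coord i)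
  exact ⟨e, v i, by rw [he]; simp⟩

/-- Split off a vector of odd norm in such a way that the complement is odd or trivial. -/
theorem exists_isUnit_norm {b : LinearMap.BilinForm ℤ_[2] M} (hb : IsUnimodular b)
    (hs : ∀ x y, b x y = b y x) (ho : ¬ IsEvenForm b) :
    ∃ x, IsUnit (b x x) ∧
      ((¬ ∀ y ∈ orthComplement b (LinearMap.toSpanSingleton ℤ_[2] M x), (2 : ℤ_[2]) ∣ b y y) ∨
      ∀ y ∈ orthComplement b (LinearMap.toSpanSingleton ℤ_[2] M x), y = 0) := by
  have hmem : ∀ x y, y ∈ orthComplement b (LinearMap.toSpanSingleton ℤ_[2] M x) ↔ b y x = 0 := by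
    intro x y
    rw [mem_orthComplement]
    refine ⟨fun h => by simpa using h 1, fun h w => by simp [h]⟩
  unfold IsEvenForm at ho
  push Not at ho
  obtain ⟨x, hx⟩ := ho
  rw [not_dvd_iff_isUnit] at hx
  by_contra hcon
  push Not at hcon
  obtain ⟨he, y₀, hy₀, hy₀'⟩ := hcon x hx
  have hsplit := exists_splitting (isUnimodular_unaryBilin hx) hb hs
    (LinearMap.toSpanSingleton ℤ_[2] M x) (fun w w' => by simp [unaryBilin]; ring)
  set N := orthComplement b (LinearMap.toSpanSingleton ℤ_[2] M x)
  have : Nontrivial N := ⟨⟨y₀, hy₀⟩, 0, fun h => hy₀' (congrArg Subtype.val h)⟩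
  obtain ⟨e, f, hef⟩ := exists_apply_eq_one hsplit.1
  change b e f = 1 at hef
  obtain ⟨u, hu⟩ := hx
  have hex : b e x = 0 := (hmem _ _).1 e.2
  have hfx : b f x = 0 := (hmem _ _).1 f.2
  obtain ⟨a, ha⟩ := he e e.2
  obtain ⟨c, hc⟩ := he f f.2
  obtain ⟨h1, -⟩ := hcon (x + e) (by
    simp only [map_add, LinearMap.add_apply, hs x e, hex, ha, ← hu]
    convert isUnit_add_two_mul u.isUnit a using 1; ring)
  have h2 := h1 ((-(↑u⁻¹ : ℤ_[2])) • x + f) ((hmem _ _).2 (by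
    simp only [map_add, LinearMap.add_apply, map_smul, LinearMap.smul_apply, smul_eq_mul,
      hs x e, hex, hfx, hs f e, hef, ← hu]
    linear_combination -u.inv_mul))
  refine not_dvd_iff_isUnit.2 ?_ h2
  simp only [map_add, LinearMap.add_apply, map_smul, LinearMap.smul_apply, smul_eq_mul,
      hs x f, hfx, hc, ← hu]
  convert isUnit_add_two_mul u⁻¹.isUnit c using 1
  linear_combination (↑u⁻¹ : ℤ_[2]) * u.inv_mul

theorem exists_isom_diagonal (n : ℕ) : ∀ {M : Type*} [AddCommGroup M] [Module ℤ_[2] M]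
    [Module.Free ℤ_[2] M] [Module.Finite ℤ_[2] M] {b : LinearMap.BilinForm ℤ_[2] M},
    IsUnimodular b → (∀ x y, b x y = b y x) → ¬ IsEvenForm b → Module.finrank ℤ_[2] M = n →
    ∃ u : Fin n → ℤ_[2], (∀ i, IsUnit (u i)) ∧
      Isom (fun x => b x x) (piSum fun i X => u i * X ^ 2) := by
  induction n with
  | zero =>
    intro M _ _ _ _ b _ _ ho hn
    have := (Module.finrank_eq_zero_iff_of_free ℤ_[2] M).1 hn
    exact absurd (fun x => by rw [Subsingleton.elim x 0]; simp) ho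
  | succ n ih =>
    intro M _ _ _ _ b hb hs ho hn
    obtain ⟨x, hx, h⟩ := exists_isUnit_norm hb hs ho
    let N := orthComplement b (LinearMap.toSpanSingleton ℤ_[2] M x)
    obtain ⟨hN, e, he⟩ := exists_splitting (isUnimodular_unaryBilin hx) hb hs
      (LinearMap.toSpanSingleton ℤ_[2] M x) (fun w w' => by simp [unaryBilin]; ring)
    have hrank : n + 1 = 1 + Module.finrank ℤ_[2] N := by
      rw [← hn, finrank_eq_of_equiv_prod e, Module.finrank_self]
    have hrank' : Module.finrank ℤ_[2] N = n := by omega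
    obtain ⟨u, hu, hiso⟩ : ∃ u : Fin n → ℤ_[2], (∀ i, IsUnit (u i)) ∧
        Isom (fun y : N => b y y) (piSum fun i X => u i * X ^ 2) := by
      rcases h with h | h
      · exact ih (M := N) hN (fun y z => hs y z) (fun h' => h fun y hy => h' ⟨y, hy⟩) hrank'
      · have : Subsingleton N := ⟨fun y z => Subtype.ext ((h y y.2).trans (h z z.2).symm)⟩
        have hN0 : Module.finrank ℤ_[2] N = 0 := Module.finrank_zero_of_subsingleton
        obtain rfl : n = 0 := by omega
        refine ⟨fun _ => 1, fun _ => isUnit_one, LinearEquiv.ofFinrankEq _ _ (by simp [hN0]), ?_⟩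
        intro y
        rw [Subsingleton.elim y 0]
        simp [piSum]
    refine ⟨Fin.cons (b x x) u, Fin.cases hx hu, ?_⟩
    refine Isom.trans (q' := fun z : ℤ_[2] × N => unaryBilin (b x x) z.1 z.1 + b z.2 z.2)
      (Isom.symm ⟨e, he⟩) (Isom.trans ?_ (isom_piSum_cons _))
    refine Isom.prod (q := fun X => unaryBilin (b x x) X X) (q' := fun X => b x x * X ^ 2)
      ⟨LinearEquiv.refl _ _, fun X => ?_⟩ hiso
    simp only [unaryBilin, LinearMap.smul_apply, LinearMap.mul_apply', smul_eq_mul,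
      LinearEquiv.refl_apply]
    ring

theorem exists_isom_planes (n : ℕ) : ∀ {M : Type*} [AddCommGroup M] [Module ℤ_[2] M]
    [Module.Free ℤ_[2] M] [Module.Finite ℤ_[2] M] {b : LinearMap.BilinForm ℤ_[2] M},
    IsUnimodular b → (∀ x y, b x y = b y x) → IsEvenForm b → Module.finrank ℤ_[2] M = n →
    ∃ m, n = 2 * m ∧ ∃ ε : Fin m → Bool,
      Isom (fun x => b x x) (piSum fun i => planeNorm (ε i)) := by
  induction n using Nat.strong_induction_on with
  | _ n ih =>
    intro M _ _ _ _ b hb hs he hn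
    rcases Nat.eq_zero_or_pos n with rfl | hpos
    · have := (Module.finrank_eq_zero_iff_of_free ℤ_[2] M).1 hn
      refine ⟨0, rfl, fun _ => false,
        LinearEquiv.ofFinrankEq _ _ (by rw [hn, Module.finrank_zero_of_subsingleton]), fun y => ?_⟩
      rw [Subsingleton.elim y 0]
      simp [piSum]
    have : Nontrivial M := Module.nontrivial_of_finrank_pos (R := ℤ_[2]) (by omega)
    obtain ⟨v, w, hvw⟩ := exists_apply_eq_one hb
    obtain ⟨a, ha⟩ := he v
    obtain ⟨c, hc⟩ := he w
    obtain ⟨hN, e, hiso⟩ := exists_splitting (isUnimodular_planeBilin a c) hb hs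
      (LinearMap.coprod (LinearMap.toSpanSingleton ℤ_[2] M v)
        (LinearMap.toSpanSingleton ℤ_[2] M w)) (fun z z' => by
          simp [planeBilin_apply, ha, hc, hs w v, hvw]; ring)
    have hrank := finrank_eq_of_equiv_prod e
    rw [hn, Module.finrank_prod, Module.finrank_self] at hrank
    obtain ⟨m, hm, ε, hε⟩ := ih _ (by omega) hN (fun y z => hs y z) (fun y => he y) rfl
    obtain ⟨δ, hδ⟩ := exists_isom_planeNorm a c
    refine ⟨m + 1, by omega, Fin.cons δ ε, ?_⟩
    exact Isom.trans (Isom.symm ⟨e, hiso⟩) (Isom.trans (Isom.prod hδ hε)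
      (isom_piSum_cons fun i => planeNorm ((Fin.cons δ ε : Fin (m + 1) → Bool) i)))

/-! ## Gram matrices and signs -/

theorem isUnit_det_gram {b : LinearMap.BilinForm ℤ_[2] M} (hb : IsUnimodular b) :
    IsUnit (gram b).det := by
  let v := Module.finBasis ℤ_[2] M
  have h := (LinearEquiv.ofBijective b hb).isUnit_det v v.dualBasis
  rw [← Matrix.det_transpose] at h
  convert h using 2
  ext i j
  simp [gram, LinearMap.toMatrix_apply, v]
  rfl

theorem exists_gram_eq {ι : Type*} [Fintype ι] [DecidableEq ι] (b : LinearMap.BilinForm ℤ_[2] M)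
    (v : Module.Basis ι ℤ_[2] M) :
    ∃ (σ : Fin (Module.finrank ℤ_[2] M) ≃ ι)
      (P : Matrix (Fin (Module.finrank ℤ_[2] M)) (Fin (Module.finrank ℤ_[2] M)) ℤ_[2]),
      IsUnit P.det ∧ P.transpose * gram b * P = Matrix.of fun i j => b (v (σ i)) (v (σ j)) := by
  let w := Module.finBasis ℤ_[2] M
  let σ := w.indexEquiv v
  let v' := v.reindex σ.symm
  refine ⟨σ, w.toMatrix v', ?_, ?_⟩
  · rw [← Matrix.isUnit_iff_isUnit_det]
    exact @isUnit_of_invertible _ _ _ (w.invertibleToMatrix v')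
  · have := LinearMap.BilinForm.toMatrix_mul_basis_toMatrix w v' b
    have hg : gram b = LinearMap.BilinForm.toMatrix w b := by
      ext i j
      simp [gram, LinearMap.BilinForm.toMatrix_apply, w]
    rw [hg, this]
    ext i j
    simp [LinearMap.BilinForm.toMatrix_apply, v']

theorem legendreTwo_det_eq_formSign {ι : Type*} [Fintype ι] [DecidableEq ι]
    {b : LinearMap.BilinForm ℤ_[2] M} (hb : IsUnimodular b) (v : Module.Basis ι ℤ_[2] M) :
    legendreTwo (Matrix.of fun i j => b (v i) (v j)).det = formSign b := by
  obtain ⟨σ, P, hP, h⟩ := exists_gram_eq b v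
  have h1 : (Matrix.of fun i j => b (v (σ i)) (v (σ j))) =
      (Matrix.of fun i j => b (v i) (v j)).submatrix σ σ := rfl
  rw [← Matrix.det_submatrix_equiv_self σ, ← h1, ← h, formSign, Matrix.det_mul, Matrix.det_mul,
    Matrix.det_transpose, ← legendreTwo_mul_sq (isUnit_det_gram hb) hP]
  congr 1
  ring

omit [Module.Free ℤ_[2] M] [Module.Finite ℤ_[2] M] in
theorem apply_eq_of_norm_eq {M' : Type*} [AddCommGroup M'] [Module ℤ_[2] M']
    {b : LinearMap.BilinForm ℤ_[2] M} {b' : LinearMap.BilinForm ℤ_[2] M'}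
    (hs : ∀ x y, b x y = b y x) (hs' : ∀ x y, b' x y = b' y x) (e : M ≃ₗ[ℤ_[2]] M')
    (h : ∀ x, b' (e x) (e x) = b x x) (x y : M) : b' (e x) (e y) = b x y := by
  have h1 := h (x + y)
  simp only [map_add, LinearMap.add_apply, h, hs y x, hs' (e y) (e x)] at h1
  have h2 : (2 : ℤ_[2]) * b' (e x) (e y) = 2 * b x y := by linear_combination h1
  exact mul_left_cancel₀ two_ne_zero h2

/-- The orthogonal sum of bilinear forms on the same module. -/
noncomputable def piBilin {ι A : Type*} [Fintype ι] [AddCommGroup A] [Module ℤ_[2] A]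
    (β : ι → LinearMap.BilinForm ℤ_[2] A) : LinearMap.BilinForm ℤ_[2] (ι → A) :=
  ∑ i, (β i).compl₁₂ (LinearMap.proj i) (LinearMap.proj i)

theorem piBilin_apply {ι A : Type*} [Fintype ι] [AddCommGroup A] [Module ℤ_[2] A]
    (β : ι → LinearMap.BilinForm ℤ_[2] A) (x y : ι → A) :
    piBilin β x y = ∑ i, β i (x i) (y i) := by
  simp [piBilin, LinearMap.sum_apply]

omit [Module.Free ℤ_[2] M] [Module.Finite ℤ_[2] M] in
/-- The Gram matrix of a form isometric to an orthogonal sum. -/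
theorem exists_basis_of_isom_piSum {ι κ A : Type*} [Fintype ι] [DecidableEq ι] [Finite κ]
    [AddCommGroup A] [Module ℤ_[2] A] {b : LinearMap.BilinForm ℤ_[2] M}
    (hs : ∀ x y, b x y = b y x) {β : ι → LinearMap.BilinForm ℤ_[2] A}
    (hβ : ∀ i x y, β i x y = β i y x) (v : Module.Basis κ ℤ_[2] A)
    (h : Isom (fun x => b x x) (piSum fun i X => β i X X)) :
    ∃ w : Module.Basis (κ × ι) ℤ_[2] M, (Matrix.of fun i j => b (w i) (w j)) =
      Matrix.blockDiagonal fun i => Matrix.of fun k l => β i (v k) (v l) := by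
  obtain ⟨e, he⟩ := h
  have key := apply_eq_of_norm_eq (b := b) (b' := piBilin β) hs
    (fun x y => by simp [piBilin_apply, hβ]) e
    (fun x => by rw [piBilin_apply]; exact he x)
  refine ⟨((Pi.basis fun _ : ι => v).map e.symm).reindex
    ((Equiv.sigmaEquivProd ι κ).trans (Equiv.prodComm _ _)), ?_⟩
  ext ⟨k, i⟩ ⟨l, j⟩
  rw [Matrix.of_apply, ← key, Matrix.blockDiagonal_apply, piBilin_apply]
  simp only [Module.Basis.reindex_apply, Module.Basis.map_apply, LinearEquiv.apply_symm_apply,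
    Pi.basis_apply, Equiv.symm_trans_apply, Equiv.prodComm_symm, Equiv.prodComm_apply,
    Prod.swap_prod_mk, Equiv.sigmaEquivProd_symm_apply]
  split_ifs with hij
  · subst hij
    rw [Finset.sum_eq_single i]
    · simp
    · intro a _ ha
      simp [Pi.single_eq_of_ne ha]
    · simp
  · rw [Finset.sum_eq_zero]
    intro a _
    by_cases ha : a = i
    · subst ha
      simp [Pi.single_eq_of_ne hij]
    · simp [Pi.single_eq_of_ne ha]

theorem formSign_of_isom_planes {m : ℕ} {b : LinearMap.BilinForm ℤ_[2] M} (hb : IsUnimodular b)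
    (hs : ∀ x y, b x y = b y x) {ε : Fin m → Bool}
    (h : Isom (fun x => b x x) (piSum fun i => planeNorm (ε i))) :
    formSign b = ∏ i, bitSign (ε i) := by
  obtain ⟨w, hw⟩ := exists_basis_of_isom_piSum hs
    (β := fun i => planeBilin (if ε i then 1 else 0) (if ε i then 1 else 0))
    (fun i x y => by simp only [planeBilin_apply]; ring) (Module.Basis.finTwoProd ℤ_[2]) h
  have hdet : ∀ i, (Matrix.of fun k l => planeBilin (if ε i then 1 else 0) (if ε i then 1 else 0)
      (Module.Basis.finTwoProd ℤ_[2] k) (Module.Basis.finTwoProd ℤ_[2] l)).det =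
      (((if ε i then 3 else -1 : ℤ)) : ℤ_[2]) := fun i => by
    cases ε i <;> simp [Matrix.det_fin_two, planeBilin_apply]; norm_num
  rw [← legendreTwo_det_eq_formSign hb w, hw, Matrix.det_blockDiagonal]
  simp only [hdet]
  rw [legendreTwo_prod]
  · refine Finset.prod_congr rfl fun i _ => ?_
    rw [legendreTwo, toZModPow_intCast]
    cases ε i <;> decide
  · intro i
    apply isUnit_intCast
    cases ε i <;> rfl

theorem isom_planes_of_prod_eq {m : ℕ} {ε ε' : Fin m → Bool}
    (h : ∏ i, bitSign (ε i) = ∏ i, bitSign (ε' i)) :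
    Isom (piSum fun i => planeNorm (ε i)) (piSum fun i => planeNorm (ε' i)) := by
  refine relation_of_sameSigns (κ := fun _ => 0)
    (fun ε ε' => Isom (piSum fun i => planeNorm (ε i)) (piSum fun i => planeNorm (ε' i)))
    (fun _ => Isom.refl _) (fun h h' => h.trans h') (fun ε p q hpq _ => ?_) (fun k => ?_)
  · refine isom_piSum_of_pair hpq (fun i h1 h2 => by simp [flip, h1, h2]) ?_
    have hc : ∀ δ δ', Isom (fun z : (ℤ_[2] × ℤ_[2]) × (ℤ_[2] × ℤ_[2]) =>
        planeNorm δ z.1 + planeNorm δ' z.2)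
        (fun z : (ℤ_[2] × ℤ_[2]) × (ℤ_[2] × ℤ_[2]) => planeNorm δ' z.1 + planeNorm δ z.2) :=
      fun δ δ' => ⟨LinearEquiv.prodComm _ _ _, fun z => by simp [add_comm]⟩
    simp only [flip, Finset.mem_insert, Finset.mem_singleton, true_or, or_true, decide_true,
      Bool.xor_true]
    cases ε p <;> cases ε q <;> simp only [Bool.not_true, Bool.not_false]
    · exact isom_planeNorm_sq.symm
    · exact hc _ _
    · exact hc _ _
    · exact isom_planeNorm_sq
  · by_cases hk : 0 = k
    · simpa [hk] using h
    · simp [hk]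

theorem isom_of_isEvenForm {M' : Type*} [AddCommGroup M'] [Module ℤ_[2] M']
    [Module.Free ℤ_[2] M'] [Module.Finite ℤ_[2] M'] {b : LinearMap.BilinForm ℤ_[2] M}
    {b' : LinearMap.BilinForm ℤ_[2] M'} (hb : IsUnimodular b) (hb' : IsUnimodular b')
    (hs : ∀ x y, b x y = b y x) (hs' : ∀ x y, b' x y = b' y x)
    (he : IsEvenForm b) (he' : IsEvenForm b')
    (hrank : Module.finrank ℤ_[2] M = Module.finrank ℤ_[2] M')
    (hsign : formSign b = formSign b') : Isom (fun x => b x x) (fun x => b' x x) := by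
  obtain ⟨m, hm, ε, h⟩ := exists_isom_planes _ hb hs he rfl
  obtain ⟨m', hm', ε', h'⟩ := exists_isom_planes _ hb' hs' he' rfl
  obtain rfl : m = m' := by omega
  refine h.trans ((isom_planes_of_prod_eq ?_).trans h'.symm)
  rw [← formSign_of_isom_planes hb hs h, ← formSign_of_isom_planes hb' hs' h', hsign]

/-- An odd unimodular form has an orthogonal basis with entries in standard form. -/
theorem exists_isom_stdUnit {b : LinearMap.BilinForm ℤ_[2] M} (hb : IsUnimodular b)
    (hs : ∀ x y, b x y = b y x) (ho : ¬ IsEvenForm b) {n : ℕ}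
    (hn : Module.finrank ℤ_[2] M = n) :
    ∃ x s : Fin n → Bool, Isom (fun y => b y y)
      (piSum fun i X => (stdUnit (x i) (s i) : ℤ_[2]) * X ^ 2) := by
  obtain ⟨u, hu, h⟩ := exists_isom_diagonal n hb hs ho hn
  choose x s hxs using fun i => exists_stdUnit (hu i)
  exact ⟨x, s, h.trans (isom_piSum fun i =>
    isom_unary (isUnit_intCast (stdUnit_emod_two _ _)) (hxs i))⟩

theorem formSign_of_isom_stdUnit {n : ℕ} {b : LinearMap.BilinForm ℤ_[2] M} (hb : IsUnimodular b)
    (hs : ∀ x y, b x y = b y x) {x s : Fin n → Bool}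
    (h : Isom (fun y => b y y) (piSum fun i X => (stdUnit (x i) (s i) : ℤ_[2]) * X ^ 2)) :
    formSign b = ∏ i, bitSign (s i) := by
  obtain ⟨w, hw⟩ := exists_basis_of_isom_piSum hs
    (β := fun i => unaryBilin (stdUnit (x i) (s i) : ℤ_[2]))
    (fun i x y => by simp [unaryBilin, mul_comm x y]) (Module.Basis.singleton Unit ℤ_[2])
    (by simpa [unaryBilin, pow_two] using h)
  rw [← legendreTwo_det_eq_formSign hb w, hw, Matrix.det_blockDiagonal]
  simp only [Matrix.det_unique, Matrix.of_apply, Module.Basis.singleton_apply, unaryBilin,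
    LinearMap.smul_apply, LinearMap.mul_apply', mul_one, smul_eq_mul]
  rw [legendreTwo_prod _ _ fun i => isUnit_intCast (stdUnit_emod_two _ _)]
  exact Finset.prod_congr rfl fun i _ => legendreTwo_stdUnit _ _

/-- An orthogonal basis over `ℤ₂` gives a diagonalization over `ℚ₂`. -/
theorem exists_isDiagonalization_of_isom_stdUnit {n : ℕ} {b : LinearMap.BilinForm ℤ_[2] M}
    (hs : ∀ x y, b x y = b y x) {x s : Fin n → Bool}
    (h : Isom (fun y => b y y) (piSum fun i X => (stdUnit (x i) (s i) : ℤ_[2]) * X ^ 2)) :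
    ∃ σ : Fin (Module.finrank ℤ_[2] M) ≃ Fin n,
      IsDiagonalization ((gram b).map fun a => (a : ℚ_[2]))
        (fun i => ((stdUnit (x (σ i)) (s (σ i)) : ℤ) : ℚ_[2])) := by
  obtain ⟨w, hw⟩ := exists_basis_of_isom_piSum hs
    (β := fun i => unaryBilin (stdUnit (x i) (s i) : ℤ_[2]))
    (fun i x y => by simp [unaryBilin, mul_comm x y]) (Module.Basis.singleton Unit ℤ_[2])
    (by simpa [unaryBilin, pow_two] using h)
  obtain ⟨σ, P, hP, hPG⟩ := exists_gram_eq b w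
  let τ : Unit × Fin n ≃ Fin n := Equiv.uniqueProd (Fin n) Unit
  refine ⟨σ.trans τ, P.map PadicInt.Coe.ringHom, ?_, ?_⟩
  · rw [← RingHom.mapMatrix_apply, ← RingHom.map_det]
    exact hP.map _
  · have h1 : (Matrix.of fun i j => b (w (σ i)) (w (σ j))) =
        (Matrix.of fun i j => b (w i) (w j)).submatrix σ σ := rfl
    rw [h1, hw] at hPG
    have h2 := congrArg (fun Q => Q.map PadicInt.Coe.ringHom) hPG
    simp only [Matrix.map_mul] at h2
    rw [Matrix.transpose_map] at h2
    refine h2.trans ?_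
    ext i j
    by_cases hij : i = j
    · subst hij
      simp [Matrix.blockDiagonal_apply, unaryBilin, τ]
    · have h3 : (σ i).2 ≠ (σ j).2 := fun h => hij (σ.injective (Prod.ext rfl h))
      simp [Matrix.blockDiagonal_apply, Matrix.diagonal_apply_ne _ hij, h3]

end Decompositions

/-! ## Quadratic Gauss sums -/

section PosRel

/-- Equality up to a positive real factor. -/
def PosRel (z w : ℂ) : Prop := ∃ c : ℝ, 0 < c ∧ z = c * w

theorem PosRel.refl (z : ℂ) : PosRel z z := ⟨1, one_pos, by simp⟩

theorem PosRel.symm {z w : ℂ} (h : PosRel z w) : PosRel w z := by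
  obtain ⟨c, hc, rfl⟩ := h
  refine ⟨c⁻¹, inv_pos.2 hc, ?_⟩
  have : (c : ℂ) ≠ 0 := by exact_mod_cast hc.ne'
  push_cast
  field_simp

theorem PosRel.trans {z w v : ℂ} (h : PosRel z w) (h' : PosRel w v) : PosRel z v := by
  obtain ⟨c, hc, rfl⟩ := h
  obtain ⟨d, hd, rfl⟩ := h'
  exact ⟨c * d, mul_pos hc hd, by push_cast; ring⟩

theorem PosRel.prod {α : Type*} (s : Finset α) {z w : α → ℂ} (h : ∀ i ∈ s, PosRel (z i) (w i)) :
    PosRel (∏ i ∈ s, z i) (∏ i ∈ s, w i) := by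
  classical
  induction s using Finset.induction_on with
  | empty => exact PosRel.refl _
  | insert i s hi ih =>
    rw [Finset.prod_insert hi, Finset.prod_insert hi]
    obtain ⟨c, hc, h1⟩ := h i (Finset.mem_insert_self _ _)
    obtain ⟨d, hd, h2⟩ := ih fun j hj => h j (Finset.mem_insert_of_mem hj)
    exact ⟨c * d, mul_pos hc hd, by rw [h1, h2]; push_cast; ring⟩

theorem posRel_natCast_mul {n : ℕ} (hn : 0 < n) (z : ℂ) : PosRel (n * z) z :=
  ⟨n, by exact_mod_cast hn, by simp⟩

/-- The standard character of `ℤ/8`. -/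
noncomputable def eighth (a : ZMod 8) : ℂ := ZMod.stdAddChar a

theorem eighth_add (a b : ZMod 8) : eighth (a + b) = eighth a * eighth b :=
  AddChar.map_add_eq_mul _ _ _

theorem eighth_zero : eighth 0 = 1 := AddChar.map_zero_eq_one _

theorem map_sum_eq_prod {A α : Type*} [AddCommGroup A] (χ : AddChar A ℂ) (s : Finset α)
    (f : α → A) : χ (∑ i ∈ s, f i) = ∏ i ∈ s, χ (f i) := by
  classical
  induction s using Finset.induction_on with
  | empty => simp
  | insert i s hi ih =>
    rw [Finset.sum_insert hi, Finset.prod_insert hi, AddChar.map_add_eq_mul, ih]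

theorem eighth_sum {α : Type*} (s : Finset α) (f : α → ZMod 8) :
    eighth (∑ i ∈ s, f i) = ∏ i ∈ s, eighth (f i) :=
  map_sum_eq_prod _ _ _

theorem norm_eighth (a : ZMod 8) : ‖eighth a‖ = 1 := by
  rw [eighth, ZMod.stdAddChar_apply]
  exact Circle.norm_coe _

theorem eq_of_posRel_eighth {a b : ZMod 8} (h : PosRel (eighth a) (eighth b)) : a = b := by
  obtain ⟨c, hc, h⟩ := h
  have h1 := congrArg norm h
  rw [norm_mul, norm_eighth, norm_eighth, Complex.norm_real, Real.norm_of_nonneg hc.le,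
    mul_one] at h1
  rw [← h1, Complex.ofReal_one, one_mul] at h
  exact ZMod.injective_stdAddChar h

end PosRel

section Sums

theorem sum_comp_addMonoidHom {A B : Type*} [AddCommGroup A] [Fintype A] [AddCommGroup B]
    [Fintype B] [DecidableEq B] (f : A →+ B) (F : B → ℂ) :
    ∃ c : ℕ, 0 < c ∧ ∑ a, F (f a) = c * ∑ b with b ∈ f.range, F b := by
  classical
  refine ⟨(Finset.univ.filter fun a => f a = 0).card, Finset.card_pos.2 ⟨0, by simp⟩, ?_⟩
  have hfib : ∀ b ∈ f.range, (Finset.univ.filter fun a => f a = b).card =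
      (Finset.univ.filter fun a => f a = 0).card := by
    rintro b ⟨a₀, rfl⟩
    refine Finset.card_bij (fun a _ => a - a₀) (fun a ha => ?_) (fun a _ a' _ h => ?_)
      (fun a ha => ⟨a + a₀, ?_, by simp⟩)
    · simp only [Finset.mem_filter, Finset.mem_univ, true_and] at ha ⊢
      rw [map_sub, ha, sub_self]
    · simpa using h
    · simpa using ha
  rw [Finset.mul_sum, ← Finset.sum_fiberwise_of_maps_to (g := f)
    (t := Finset.univ.filter fun b => b ∈ f.range) (by simp)]
  refine Finset.sum_congr rfl fun b hb => ?_
  rw [Finset.mem_filter] at hb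
  rw [← hfib b hb.2, Finset.sum_congr rfl (g := fun _ => F b), Finset.sum_const, nsmul_eq_mul]
  intro a ha
  rw [(Finset.mem_filter.1 ha).2]

variable {ι : Type*} [Fintype ι] [DecidableEq ι]

theorem sum_stdAddChar_dotProduct {N : ℕ} [NeZero N] (w : ι → ZMod N) :
    ∑ y : ι → ZMod N, ZMod.stdAddChar (w ⬝ᵥ y) =
      if w = 0 then (Fintype.card (ι → ZMod N) : ℂ) else 0 := by
  let φ : (ι → ZMod N) →+ ZMod N :=
    { toFun := fun y => w ⬝ᵥ y
      map_zero' := dotProduct_zero w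
      map_add' := dotProduct_add w }
  let χ : AddChar (ι → ZMod N) ℂ := ZMod.stdAddChar.compAddMonoidHom φ
  have hχ : ∀ y, ZMod.stdAddChar (w ⬝ᵥ y) = χ y := fun y => rfl
  classical
  simp only [hχ, AddChar.sum_eq_ite]
  refine if_congr ⟨fun h => ?_, fun h => ?_⟩ rfl rfl
  · funext i
    by_contra hi
    apply ZMod.isPrimitive_stdAddChar N hi
    ext r
    have h1 : χ (Pi.single i r) = 1 := by rw [h]; rfl
    rw [← hχ, dotProduct_single] at h1
    rw [AddChar.mulShift_apply, h1]
    rfl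
  · ext y
    rw [← hχ, h, zero_dotProduct, AddChar.map_zero_eq_one]
    rfl

/-- The values of a quadratic form modulo `2 ^ M`. -/
noncomputable def quadMod (M : ℕ) (G : Matrix ι ι ℤ_[2]) (x : ι → ZMod (2 ^ M)) : ZMod (2 ^ M) :=
  x ⬝ᵥ (G.map (PadicInt.toZModPow M)).mulVec x

/-- The quadratic Gauss sum of level `2 ^ M`. -/
noncomputable def quadGauss (M : ℕ) (G : Matrix ι ι ℤ_[2]) : ℂ :=
  ∑ x : ι → ZMod (2 ^ M), ZMod.stdAddChar (quadMod M G x)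

omit [DecidableEq ι] in
theorem quadMod_transform (M : ℕ) (G P : Matrix ι ι ℤ_[2]) (x : ι → ZMod (2 ^ M)) :
    quadMod M (P.transpose * G * P) x =
      quadMod M G ((P.map (PadicInt.toZModPow M)).mulVec x) := by
  simp only [quadMod, Matrix.map_mul]
  rw [Matrix.transpose_map, Matrix.mul_assoc, ← Matrix.mulVec_mulVec, Matrix.dotProduct_mulVec,
    Matrix.vecMul_transpose, Matrix.mulVec_mulVec]

theorem quadGauss_transform (M : ℕ) (G P : Matrix ι ι ℤ_[2]) (hP : IsUnit P.det) :
    quadGauss M (P.transpose * G * P) = quadGauss M G := by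
  have hu : IsUnit (P.map (PadicInt.toZModPow M)) := by
    rw [Matrix.isUnit_iff_isUnit_det, ← RingHom.mapMatrix_apply, ← RingHom.map_det]
    exact hP.map _
  refine Fintype.sum_equiv (Matrix.toLinearEquiv' _ hu.invertible).toEquiv _ _ fun x => ?_
  rw [quadMod_transform]
  rfl

omit [DecidableEq ι] in
theorem quadGauss_submatrix {κ : Type*} [Fintype κ] [DecidableEq κ] [DecidableEq ι] (M : ℕ)
    (G : Matrix ι ι ℤ_[2]) (σ : κ ≃ ι) : quadGauss M (G.submatrix σ σ) = quadGauss M G := by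
  refine Fintype.sum_equiv (Equiv.arrowCongr σ (Equiv.refl _)) _ _ fun x => ?_
  congr 1
  simp only [quadMod, dotProduct, Matrix.mulVec, Matrix.map_apply, Matrix.submatrix_apply]
  refine Fintype.sum_equiv σ _ _ fun i => ?_
  simp only [Equiv.arrowCongr_apply, Function.comp_apply, Equiv.symm_apply_apply, Equiv.coe_refl,
    id]
  congr 1
  refine Fintype.sum_equiv σ _ _ fun j => ?_
  simp

theorem quadGauss_blockDiagonal {o : Type*} [Fintype o] [DecidableEq o] {n : o → Type*}
    [∀ k, Fintype (n k)] [∀ k, DecidableEq (n k)] (M : ℕ) (G : ∀ k, Matrix (n k) (n k) ℤ_[2]) :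
    quadGauss M (Matrix.blockDiagonal' G) = ∏ k, quadGauss M (G k) := by
  simp only [quadGauss]
  rw [Finset.prod_univ_sum, Fintype.piFinset_univ]
  refine Fintype.sum_equiv (Equiv.piCurry fun (k : o) (_ : n k) => ZMod (2 ^ M)) _ _ fun x => ?_
  rw [← map_sum_eq_prod]
  congr 1
  simp only [quadMod, dotProduct, Matrix.mulVec, Matrix.map_apply, Fintype.sum_sigma]
  refine Finset.sum_congr rfl fun k _ => Finset.sum_congr rfl fun i _ => ?_
  congr 1
  rw [Finset.sum_eq_single k]
  · simp [Matrix.blockDiagonal'_apply]; rfl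
  · intro l _ hl
    refine Finset.sum_eq_zero fun j _ => ?_
    rw [Matrix.blockDiagonal'_apply_ne _ _ _ hl.symm]
    simp
  · simp

/-- The matrix of a unary form. -/
def unaryMatrix (u : ℤ_[2]) : Matrix Unit Unit ℤ_[2] := Matrix.of fun _ _ => u

theorem quadGauss_diagonal (M : ℕ) (d : ι → ℤ_[2]) :
    quadGauss M (Matrix.diagonal d) = ∏ i, quadGauss M (unaryMatrix (d i)) := by
  rw [← quadGauss_blockDiagonal]
  refine (quadGauss_submatrix M _ (Equiv.sigmaUnique ι fun _ => Unit)).symm.trans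
    (congrArg (quadGauss M) ?_)
  ext ⟨i, _⟩ ⟨j, _⟩
  by_cases h : i = j
  · subst h; simp [unaryMatrix, Matrix.blockDiagonal'_apply]
  · simp [Matrix.blockDiagonal'_apply, h]

theorem quadGauss_unaryMatrix (M : ℕ) (u : ℤ_[2]) : quadGauss M (unaryMatrix u) =
    ∑ x : ZMod (2 ^ M), ZMod.stdAddChar (PadicInt.toZModPow M u * x ^ 2) := by
  refine Fintype.sum_equiv (Equiv.funUnique Unit _) _ _ fun x => ?_
  congr 1
  simp [quadMod, unaryMatrix, dotProduct, Matrix.mulVec]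
  ring

end Sums

section Localization

variable {ι : Type*} [Fintype ι] [DecidableEq ι]

theorem stdAddChar_two_pow_mul (M j : ℕ) (a : ZMod (2 ^ (M + j))) :
    ZMod.stdAddChar (2 ^ j * a) =
      ZMod.stdAddChar (ZMod.castHom (pow_dvd_pow 2 (Nat.le_add_right M j)) (ZMod (2 ^ M)) a) := by
  obtain ⟨z, rfl⟩ := ZMod.intCast_surjective a
  have h : (2 ^ j * (z : ZMod (2 ^ (M + j)))) = ((2 ^ j * z : ℤ) : ZMod (2 ^ (M + j))) := by
    push_cast; rfl
  have h' : ZMod.castHom (pow_dvd_pow 2 (Nat.le_add_right M j)) (ZMod (2 ^ M))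
      (z : ZMod (2 ^ (M + j))) = (z : ZMod (2 ^ M)) := map_intCast _ z
  rw [h, h', ZMod.stdAddChar_coe, ZMod.stdAddChar_coe]
  congr 1
  push_cast
  rw [pow_add]
  field_simp

omit [DecidableEq ι] in
theorem quadMod_smul (M : ℕ) (r : ℤ_[2]) (G : Matrix ι ι ℤ_[2]) (x : ι → ZMod (2 ^ M)) :
    quadMod M (r • G) x = PadicInt.toZModPow M r * quadMod M G x := by
  have h : (r • G).map (PadicInt.toZModPow M) =
      PadicInt.toZModPow M r • G.map (PadicInt.toZModPow M) := by
    ext i j; simp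
  rw [quadMod, h, Matrix.smul_mulVec, dotProduct_smul, smul_eq_mul, quadMod]

omit [DecidableEq ι] in
theorem castHom_quadMod (M j : ℕ) (G : Matrix ι ι ℤ_[2]) (x : ι → ZMod (2 ^ (M + j))) :
    ZMod.castHom (pow_dvd_pow 2 (Nat.le_add_right M j)) (ZMod (2 ^ M)) (quadMod (M + j) G x) =
      quadMod M G (fun i =>
        ZMod.castHom (pow_dvd_pow 2 (Nat.le_add_right M j)) (ZMod (2 ^ M)) (x i)) := by
  have h : ∀ a : ℤ_[2], ZMod.castHom (pow_dvd_pow 2 (Nat.le_add_right M j)) (ZMod (2 ^ M))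
      (PadicInt.toZModPow (M + j) a) = PadicInt.toZModPow M a := fun a => by
    rw [← PadicInt.zmod_cast_comp_toZModPow M (M + j) (Nat.le_add_right M j)]
    rfl
  simp only [quadMod, dotProduct, Matrix.mulVec, map_sum, map_mul, Matrix.map_apply, h]

theorem quadGauss_two_pow_smul (M j : ℕ) (G : Matrix ι ι ℤ_[2]) :
    PosRel (quadGauss (M + j) ((2 : ℤ_[2]) ^ j • G)) (quadGauss M G) := by
  let c := ZMod.castHom (pow_dvd_pow 2 (Nat.le_add_right M j)) (ZMod (2 ^ M))
  let f : (ι → ZMod (2 ^ (M + j))) →+ (ι → ZMod (2 ^ M)) := c.toAddMonoidHom.compLeft ι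
  obtain ⟨n, hn, h⟩ := sum_comp_addMonoidHom f fun b => ZMod.stdAddChar (quadMod M G b)
  have h1 : quadGauss (M + j) ((2 : ℤ_[2]) ^ j • G) =
      ∑ a, ZMod.stdAddChar (quadMod M G (f a)) := by
    refine Finset.sum_congr rfl fun x _ => ?_
    rw [quadMod_smul, map_pow, map_ofNat, stdAddChar_two_pow_mul, castHom_quadMod]
    rfl
  have h2 : ∀ b, b ∈ f.range := fun b => by
    choose a ha using fun i => ZMod.castHom_surjective
      (pow_dvd_pow 2 (Nat.le_add_right M j)) (b i)
    exact ⟨a, funext ha⟩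
  rw [h1, h, Finset.filter_true_of_mem fun b _ => h2 b]
  exact posRel_natCast_mul hn _

omit [DecidableEq ι] in
theorem quadMod_add (M : ℕ) {G : Matrix ι ι ℤ_[2]} (hG : G.transpose = G)
    (x y : ι → ZMod (2 ^ M)) (r : ZMod (2 ^ M)) :
    quadMod M G (x + r • y) = quadMod M G x +
      (2 * r) • (G.map (PadicInt.toZModPow M)).mulVec x ⬝ᵥ y + r ^ 2 * quadMod M G y := by
  have h : x ⬝ᵥ (G.map (PadicInt.toZModPow M)).mulVec y =
      (G.map (PadicInt.toZModPow M)).mulVec x ⬝ᵥ y := by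
    rw [Matrix.dotProduct_mulVec, ← Matrix.mulVec_transpose, ← Matrix.transpose_map, hG]
  simp only [quadMod, Matrix.mulVec_add, Matrix.mulVec_smul, add_dotProduct, dotProduct_add,
    smul_dotProduct, dotProduct_smul, smul_eq_mul, h]
  rw [dotProduct_comm y]
  ring

theorem sum_localize (M t : ℕ) {G : Matrix ι ι ℤ_[2]} (hG : G.transpose = G)
    (S : Finset (ι → ZMod (2 ^ M)))
    (hS : ∀ x ∈ S, ∀ y, x + (2 : ZMod (2 ^ M)) ^ t • y ∈ S)
    (hq : ∀ y, (2 : ZMod (2 ^ M)) ^ (2 * t) * quadMod M G y = 0) :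
    ∑ x ∈ S, ZMod.stdAddChar (quadMod M G x) =
      ∑ x ∈ S with (2 : ZMod (2 ^ M)) ^ (t + 1) • (G.map (PadicInt.toZModPow M)).mulVec x = 0,
        ZMod.stdAddChar (quadMod M G x) := by
  have hcard : (Fintype.card (ι → ZMod (2 ^ M)) : ℂ) ≠ 0 :=
    Nat.cast_ne_zero.2 Fintype.card_ne_zero
  have hshift : ∀ y, ∑ x ∈ S, ZMod.stdAddChar (quadMod M G x) =
      ∑ x ∈ S, ZMod.stdAddChar (quadMod M G x) * ZMod.stdAddChar
        (((2 : ZMod (2 ^ M)) ^ (t + 1) • (G.map (PadicInt.toZModPow M)).mulVec x) ⬝ᵥ y) := by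
    intro y
    refine Finset.sum_nbij' (fun x => x + (2 : ZMod (2 ^ M)) ^ t • (-y))
      (fun x => x + (2 : ZMod (2 ^ M)) ^ t • y) (fun x hx => hS x hx _) (fun x hx => hS x hx _)
      (fun x _ => by simp) (fun x _ => by simp) (fun x _ => ?_)
    rw [← AddChar.map_add_eq_mul]
    congr 1
    set z := x + (2 : ZMod (2 ^ M)) ^ t • (-y) with hz
    have hxz : x = z + (2 : ZMod (2 ^ M)) ^ t • y := by simp [hz]
    conv_lhs => rw [hxz, quadMod_add M hG, ← pow_mul, mul_comm t 2, hq, add_zero]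
    rw [pow_succ']
  apply mul_left_cancel₀ hcard
  calc (Fintype.card (ι → ZMod (2 ^ M)) : ℂ) * ∑ x ∈ S, ZMod.stdAddChar (quadMod M G x)
      = ∑ y : ι → ZMod (2 ^ M), ∑ x ∈ S, ZMod.stdAddChar (quadMod M G x) := by
        rw [Finset.sum_const, nsmul_eq_mul, Finset.card_univ]
    _ = ∑ x ∈ S, ZMod.stdAddChar (quadMod M G x) *
        if (2 : ZMod (2 ^ M)) ^ (t + 1) • (G.map (PadicInt.toZModPow M)).mulVec x = 0 then
          (Fintype.card (ι → ZMod (2 ^ M)) : ℂ) else 0 := by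
        rw [Finset.sum_congr rfl fun y _ => hshift y, Finset.sum_comm]
        refine Finset.sum_congr rfl fun x _ => ?_
        rw [← Finset.mul_sum, sum_stdAddChar_dotProduct]
    _ = _ := by
        rw [Finset.mul_sum, Finset.sum_filter]
        refine Finset.sum_congr rfl fun x _ => ?_
        split_ifs <;> ring

theorem exists_eq_two_pow_mul {M a : ℕ} (ha : a ≤ M) {z : ZMod (2 ^ M)}
    (h : (2 : ZMod (2 ^ M)) ^ a * z = 0) : ∃ w, z = 2 ^ (M - a) * w := by
  obtain ⟨n, rfl⟩ := ZMod.natCast_zmod_surjective z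
  have h1 : ((2 ^ a * n : ℕ) : ZMod (2 ^ M)) = 0 := by push_cast; exact h
  rw [ZMod.natCast_eq_zero_iff, ← Nat.sub_add_cancel ha, pow_add, mul_comm (2 ^ (M - a))] at h1
  obtain ⟨w, rfl⟩ := Nat.dvd_of_mul_dvd_mul_left (by positivity) h1
  exact ⟨w, by push_cast; rfl⟩

theorem mulVec_eq_zero_of_isUnit_det {M : ℕ} {U : Matrix ι ι ℤ_[2]} (hU : IsUnit U.det) {a : ℕ}
    (ha : a ≤ M) {x : ι → ZMod (2 ^ M)}
    (h : (2 : ZMod (2 ^ M)) ^ a • (U.map (PadicInt.toZModPow M)).mulVec x = 0) :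
    ∃ w, x = (2 : ZMod (2 ^ M)) ^ (M - a) • w := by
  have hu : IsUnit (U.map (PadicInt.toZModPow M)) := by
    rw [Matrix.isUnit_iff_isUnit_det, ← RingHom.mapMatrix_apply, ← RingHom.map_det]
    exact hU.map _
  have hx : (2 : ZMod (2 ^ M)) ^ a • x = 0 := by
    rw [← Matrix.mulVec_smul] at h
    exact Matrix.mulVec_injective_of_isUnit hu (by rw [h, Matrix.mulVec_zero])
  choose w hw using fun i => exists_eq_two_pow_mul ha (congrFun hx i)
  exact ⟨w, funext hw⟩

/-- Gauss sums of unimodular forms depend only on the parity of the level. -/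
theorem quadGauss_add_two {U : Matrix ι ι ℤ_[2]} (hU : IsUnit U.det) (hs : U.transpose = U)
    {m : ℕ} (hq : ∀ y, (2 : ZMod (2 ^ (m + 2))) ^ (2 * m) * quadMod (m + 2) U y = 0) :
    PosRel (quadGauss (m + 2) U) (quadGauss m U) := by
  have h1 := sum_localize (m + 2) m hs Finset.univ (fun _ _ _ => Finset.mem_univ _) hq
  let f : (ι → ZMod (2 ^ (m + 2))) →+ (ι → ZMod (2 ^ (m + 2))) :=
    DistribSMul.toAddMonoidHom _ (2 : ZMod (2 ^ (m + 2)))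
  obtain ⟨n, hn, h2⟩ := sum_comp_addMonoidHom f fun b => ZMod.stdAddChar (quadMod (m + 2) U b)
  have hfilter : (Finset.univ.filter fun x => (2 : ZMod (2 ^ (m + 2))) ^ (m + 1) •
      (U.map (PadicInt.toZModPow (m + 2))).mulVec x = 0) =
      Finset.univ.filter fun x => x ∈ f.range := by
    ext x
    simp only [Finset.mem_filter, Finset.mem_univ, true_and]
    constructor
    · intro h
      obtain ⟨w, hw⟩ := mulVec_eq_zero_of_isUnit_det hU (by omega) h
      exact ⟨w, by rw [hw, show m + 2 - (m + 1) = 1 by omega, pow_one]; rfl⟩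
    · rintro ⟨w, rfl⟩
      change (2 : ZMod (2 ^ (m + 2))) ^ (m + 1) • Matrix.mulVec _ ((2 : ZMod (2 ^ (m + 2))) • w) = 0
      rw [Matrix.mulVec_smul, smul_smul, ← pow_succ]
      have : (2 : ZMod (2 ^ (m + 2))) ^ (m + 2) = 0 := by
        exact_mod_cast ZMod.natCast_self (2 ^ (m + 2))
      rw [this, zero_smul]
  have h3 : ∑ a, ZMod.stdAddChar (quadMod (m + 2) U (f a)) =
      quadGauss (m + 2) ((2 : ℤ_[2]) ^ 2 • U) := by
    refine Finset.sum_congr rfl fun x _ => ?_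
    congr 1
    change quadMod (m + 2) U ((2 : ZMod (2 ^ (m + 2))) • x) = _
    rw [quadMod_smul, map_pow, map_ofNat]
    simp only [quadMod, Matrix.mulVec_smul, dotProduct_smul, smul_dotProduct, smul_eq_mul]
    ring
  rw [hfilter] at h1
  rw [h3, ← h1] at h2
  refine PosRel.trans ?_ (quadGauss_two_pow_smul m 2 U)
  rw [h2]
  exact (posRel_natCast_mul hn _).symm

theorem two_pow_eq_zero {M a : ℕ} (h : M ≤ a) : (2 : ZMod (2 ^ M)) ^ a = 0 := by
  have : (2 : ZMod (2 ^ M)) ^ M = 0 := by exact_mod_cast ZMod.natCast_self (2 ^ M)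
  rw [← Nat.add_sub_cancel' h, pow_add, this, zero_mul]

theorem quadGauss_add_two_mul {U : Matrix ι ι ℤ_[2]} (hU : IsUnit U.det) (hs : U.transpose = U)
    {m : ℕ} (hm : 2 ≤ m) (k : ℕ) : PosRel (quadGauss (m + 2 * k) U) (quadGauss m U) := by
  induction k with
  | zero => exact PosRel.refl _
  | succ k ih =>
    refine PosRel.trans ?_ ih
    exact quadGauss_add_two hU hs (m := m + 2 * k) fun y => by
      rw [two_pow_eq_zero (by omega), zero_mul]

/-- At high level the Gauss sum of a unimodular form agrees with that of a sublattice. -/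
theorem quadGauss_sublattice {U P : Matrix ι ι ℤ_[2]} (hU : IsUnit U.det) (hs : U.transpose = U)
    (hP : P.det ≠ 0) : ∃ M₀, ∀ M, M₀ ≤ M →
      PosRel (quadGauss M (P.transpose * U * P)) (quadGauss M U) := by
  set s := P.det.valuation
  have hdet := PadicInt.unitCoeff_spec hP
  refine ⟨2 * s + 3, fun M hM => ?_⟩
  let A := P.map (PadicInt.toZModPow (p := 2) M)
  let f : (ι → ZMod (2 ^ M)) →+ (ι → ZMod (2 ^ M)) := (Matrix.mulVecLin A).toAddMonoidHom
  obtain ⟨n, hn, h⟩ := sum_comp_addMonoidHom f fun b => ZMod.stdAddChar (quadMod M U b)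
  have h0 : ∑ a, ZMod.stdAddChar (quadMod M U (f a)) = quadGauss M (P.transpose * U * P) :=
    Finset.sum_congr rfl fun x _ => by rw [quadMod_transform]; rfl
  have hrange : ∀ t, s ≤ t → ∀ y, (2 : ZMod (2 ^ M)) ^ t • y ∈ f.range := by
    intro t ht y
    obtain ⟨v, hv⟩ : IsUnit (PadicInt.toZModPow (p := 2) M (PadicInt.unitCoeff hP : ℤ_[2])) :=
      (PadicInt.unitCoeff hP).isUnit.map _
    refine ⟨A.adjugate.mulVec ((↑v⁻¹ * (2 : ZMod (2 ^ M)) ^ (t - s)) • y), ?_⟩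
    change A.mulVec _ = _
    have hA : A.det = ↑v * 2 ^ s := by
      have := congrArg (PadicInt.toZModPow (p := 2) M) hdet
      rw [RingHom.map_det] at this
      rw [hv]
      rw [map_mul, map_pow, map_natCast] at this
      exact this
    rw [Matrix.mulVec_mulVec, Matrix.mul_adjugate, hA, Matrix.smul_mulVec, Matrix.one_mulVec,
      smul_smul]
    congr 1
    have h1 := v.mul_inv
    have h2 : (2 : ZMod (2 ^ M)) ^ t = 2 ^ s * 2 ^ (t - s) := by
      rw [← pow_add, Nat.add_sub_cancel' ht]
    rw [h2]
    linear_combination (2 ^ s * 2 ^ (t - s)) * h1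
  set t := (M + 1) / 2
  have hq : ∀ y, (2 : ZMod (2 ^ M)) ^ (2 * t) * quadMod M U y = 0 := fun y => by
    rw [two_pow_eq_zero (by omega), zero_mul]
  have h1 := sum_localize M t hs Finset.univ (fun _ _ _ => Finset.mem_univ _) hq
  have h2 := sum_localize M t hs (Finset.univ.filter fun x => x ∈ f.range) (fun x hx y => by
    simp only [Finset.mem_filter, Finset.mem_univ, true_and] at hx ⊢
    exact f.range.add_mem hx (hrange t (by omega) y)) hq
  rw [← h0, h, h2]
  refine (posRel_natCast_mul hn _).trans ?_
  rw [quadGauss, h1, Finset.filter_filter]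
  rw [Finset.filter_congr (q := fun x => (2 : ZMod (2 ^ M)) ^ (t + 1) •
    (U.map (PadicInt.toZModPow M)).mulVec x = 0)]
  · exact PosRel.refl _
  · intro x _
    refine ⟨fun hx => hx.2, fun hx => ⟨?_, hx⟩⟩
    obtain ⟨w, rfl⟩ := mulVec_eq_zero_of_isUnit_det hU (by omega) hx
    exact hrange _ (by omega) w

end Localization

section Oddity

theorem eighth_four : eighth 4 = -1 := by
  have h : (4 : ZMod 8) = ((4 : ℤ) : ZMod 8) := by decide
  rw [eighth, h, ZMod.stdAddChar_coe]
  rw [show (2 * Real.pi * Complex.I * ((4 : ℤ) : ℂ) / ((8 : ℕ) : ℂ)) = Real.pi * Complex.I by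
    push_cast; ring, Complex.exp_pi_mul_I]

theorem posRel_eighth_one_add : PosRel (eighth 1 + eighth (-1)) 1 := by
  have h1 : (1 : ZMod 8) = ((1 : ℤ) : ZMod 8) := by decide
  have h2 : (-1 : ZMod 8) = ((-1 : ℤ) : ZMod 8) := by decide
  refine ⟨2 * Real.cos (Real.pi / 4), by rw [Real.cos_pi_div_four]; positivity, ?_⟩
  rw [eighth, eighth, h2, ZMod.stdAddChar_coe, h1, ZMod.stdAddChar_coe]
  push_cast
  rw [Complex.two_cos, mul_one (_ + _),
    show 2 * (Real.pi : ℂ) * Complex.I * 1 / 8 = Real.pi / 4 * Complex.I by ring,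
    show 2 * (Real.pi : ℂ) * Complex.I * -1 / 8 = -(Real.pi / 4) * Complex.I by ring]

theorem quadGauss_three {u : ℤ_[2]} (hu : IsUnit u) :
    PosRel (quadGauss 3 (unaryMatrix u)) (eighth (PadicInt.toZModPow 3 u)) := by
  have hsum : ∀ F : ZMod (2 ^ 3) → ℂ, ∑ x, F x = F (0 : ZMod 8) + F (1 : ZMod 8) + F (2 : ZMod 8)
      + F (3 : ZMod 8) + F (4 : ZMod 8) + F (5 : ZMod 8) + F (6 : ZMod 8) + F (7 : ZMod 8) :=
    fun F => Fin.sum_univ_eight F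
  rw [quadGauss_unaryMatrix, hsum]
  have h := toZModPow_three_of_isUnit hu
  generalize PadicInt.toZModPow (p := 2) 3 u = a at h ⊢
  change ZMod 8 at a
  change a = (1 : ZMod 8) ∨ a = (3 : ZMod 8) ∨ a = (5 : ZMod 8) ∨ a = (7 : ZMod 8) at h
  change PosRel (eighth (a * (0 : ZMod 8) ^ 2) + eighth (a * (1 : ZMod 8) ^ 2)
    + eighth (a * (2 : ZMod 8) ^ 2) + eighth (a * (3 : ZMod 8) ^ 2) + eighth (a * (4 : ZMod 8) ^ 2)
    + eighth (a * (5 : ZMod 8) ^ 2) + eighth (a * (6 : ZMod 8) ^ 2)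
    + eighth (a * (7 : ZMod 8) ^ 2)) (eighth a)
  have e : a * (0 : ZMod 8) ^ 2 = 0 ∧ a * (1 : ZMod 8) ^ 2 = a ∧ a * (2 : ZMod 8) ^ 2 = 4 ∧
      a * (3 : ZMod 8) ^ 2 = a ∧ a * (4 : ZMod 8) ^ 2 = 0 ∧ a * (5 : ZMod 8) ^ 2 = a ∧
      a * (6 : ZMod 8) ^ 2 = 4 ∧ a * (7 : ZMod 8) ^ 2 = a := by
    revert a; decide
  obtain ⟨e0, e1, e2, e3, e4, e5, e6, e7⟩ := e
  rw [e0, e1, e2, e3, e4, e5, e6, e7, eighth_zero, eighth_four]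
  exact ⟨4, by norm_num, by push_cast; ring⟩

theorem quadGauss_two {u : ℤ_[2]} (hu : IsUnit u) :
    PosRel (quadGauss 2 (unaryMatrix u))
      (eighth (PadicInt.toZModPow 3 u + signOddity (legendreTwo u))) := by
  have hsum : ∀ F : ZMod (2 ^ 2) → ℂ, ∑ x, F x =
      F (0 : ZMod 4) + F (1 : ZMod 4) + F (2 : ZMod 4) + F (3 : ZMod 4) :=
    fun F => Fin.sum_univ_four F
  have hcast : PadicInt.toZModPow 2 u =
      ZMod.castHom (pow_dvd_pow 2 (Nat.le_add_right 2 1)) (ZMod (2 ^ 2))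
        (PadicInt.toZModPow 3 u) := by
    rw [← PadicInt.zmod_cast_comp_toZModPow 2 3 (by norm_num)]
    rfl
  have hval : ∀ (x : ZMod 4) (y : ZMod 8),
      ZMod.castHom (pow_dvd_pow 2 (Nat.le_add_right 2 1)) (ZMod (2 ^ 2)) y = x ^ 2 →
      ZMod.stdAddChar (N := 2 ^ 2) (PadicInt.toZModPow 2 u * x ^ 2) =
        eighth (2 * (PadicInt.toZModPow 3 u * y)) := fun x y h => by
    rw [hcast, ← h, ← map_mul, ← stdAddChar_two_pow_mul, pow_one]
    rfl
  rw [quadGauss_unaryMatrix, hsum, hval 0 0 (by decide), hval 1 1 (by decide),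
    hval 2 4 (by decide), hval 3 1 (by decide)]
  have h := toZModPow_three_of_isUnit hu
  unfold legendreTwo
  generalize PadicInt.toZModPow (p := 2) 3 u = a at h ⊢
  change ZMod 8 at a
  have key : ∀ b c : ZMod 8, b + b = c → (b = 1 ∨ b = -1) →
      PosRel (eighth 0 + eighth c + eighth 0 + eighth c) (eighth b) := by
    rintro b c rfl hb
    have h1 : eighth b * eighth (-b) = 1 := by rw [← eighth_add, add_neg_cancel, eighth_zero]
    have h2 : eighth 0 + eighth (b + b) + eighth 0 + eighth (b + b) =
        2 * (eighth b * (eighth 1 + eighth (-1))) := by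
      have h3 : eighth 1 + eighth (-1) = eighth b + eighth (-b) := by
        rcases hb with rfl | rfl
        · rfl
        · rw [neg_neg, add_comm]
      rw [h3, eighth_zero, eighth_add]
      linear_combination (-2) * h1
    obtain ⟨c, hc, h4⟩ := posRel_eighth_one_add
    rw [h2, h4]
    exact ⟨2 * c, by positivity, by push_cast; ring⟩
  change a = (1 : ZMod 8) ∨ a = (3 : ZMod 8) ∨ a = (5 : ZMod 8) ∨ a = (7 : ZMod 8) at h
  have e0 : 2 * (a * 0) = 0 := by simp
  have e4 : 2 * (a * 4) = 0 := by revert a; decide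
  change PosRel (eighth (2 * (a * 0)) + eighth (2 * (a * 1)) + eighth (2 * (a * 4)) +
    eighth (2 * (a * 1))) (eighth (a + signOddity (if a = (3 : ZMod 8) ∨ a = -(3 : ZMod 8)
      then -1 else 1)))
  rw [e0, e4]
  refine key _ _ ?_ ?_
  · revert a; decide
  · revert a; decide

theorem two_nsmul_signOddity (ε : ℤˣ) : 2 • signOddity ε = 0 := by
  rcases Int.units_eq_one_or ε with rfl | rfl <;> decide

theorem nsmul_signOddity_congr {m n : ℕ} (h : m % 2 = n % 2) (ε : ℤˣ) :
    m • signOddity ε = n • signOddity ε := by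
  rw [← Nat.div_add_mod m 2, ← Nat.div_add_mod n 2, h]
  simp only [add_smul, mul_comm 2, mul_smul, two_nsmul_signOddity, smul_zero]

theorem zsmul_signOddity_congr {m n : ℤ} (h : m % 2 = n % 2) (ε : ℤˣ) :
    m • signOddity ε = n • signOddity ε := by
  have h2 : (2 : ℤ) • signOddity ε = 0 := by
    rw [← two_nsmul_signOddity ε]; simp
  rw [← Int.mul_ediv_add_emod m 2, ← Int.mul_ediv_add_emod n 2, h]
  rw [add_smul, add_smul, mul_comm, mul_smul, h2, mul_comm, mul_smul, h2, smul_zero, smul_zero]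

theorem quadGauss_unit {u : ℤ_[2]} (hu : IsUnit u) {m : ℕ} (hm : 2 ≤ m) :
    PosRel (quadGauss m (unaryMatrix u))
      (eighth (PadicInt.toZModPow 3 u + (m + 1) • signOddity (legendreTwo u))) := by
  have hdet : IsUnit (unaryMatrix u).det := by simpa [unaryMatrix] using hu
  have hs : (unaryMatrix u).transpose = unaryMatrix u := rfl
  rcases Nat.even_or_odd' m with ⟨k, rfl | rfl⟩
  · obtain ⟨k, rfl⟩ := Nat.exists_eq_add_of_le (by omega : 1 ≤ k)
    rw [nsmul_signOddity_congr (n := 1) (by omega), one_smul, mul_add, mul_one]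
    exact (quadGauss_add_two_mul hdet hs (le_refl 2) k).trans (quadGauss_two hu)
  · obtain ⟨k, rfl⟩ := Nat.exists_eq_add_of_le (by omega : 1 ≤ k)
    rw [nsmul_signOddity_congr (n := 0) (by omega), zero_smul, add_zero,
      show 2 * (1 + k) + 1 = 3 + 2 * k by ring]
    exact (quadGauss_add_two_mul hdet hs (by norm_num : 2 ≤ 3) k).trans (quadGauss_three hu)

theorem valuation_two_zpow_mul (v : ℤ) (u : ℤ_[2]ˣ) :
    ((2 : ℚ_[2]) ^ v * ((u : ℤ_[2]) : ℚ_[2])).valuation = v := by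
  have hu : ((u : ℤ_[2]) : ℚ_[2]) ≠ 0 := by simp
  rw [Padic.valuation_mul (zpow_ne_zero _ two_ne_zero) hu, Padic.valuation_zpow]
  have h2 : (2 : ℚ_[2]).valuation = 1 := by simp
  have h3 : ((u : ℤ_[2]) : ℚ_[2]).valuation = 0 := by
    have h4 := Padic.norm_eq_zpow_neg_valuation hu
    rw [PadicInt.padic_norm_e_of_padicInt, PadicInt.norm_units] at h4
    have h5 := (zpow_eq_one_iff_right₀ (by norm_num : (0 : ℝ) ≤ 2) (by norm_num)).1
      (by exact_mod_cast h4.symm)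
    rw [PadicInt.valuation_coe]
    omega
  rw [h2, h3]
  ring

theorem oddPart_two_zpow_mul (v : ℤ) (u : ℤ_[2]ˣ) :
    oddPart ((2 : ℚ_[2]) ^ v * ((u : ℤ_[2]) : ℚ_[2])) = u := by
  apply PadicInt.ext
  change (2 : ℚ_[2]) ^ v * ((u : ℤ_[2]) : ℚ_[2]) * 2 ^ (-Padic.valuation _) = _
  rw [valuation_two_zpow_mul, mul_right_comm, ← zpow_add₀ two_ne_zero, add_neg_cancel, zpow_zero,
    one_mul]

theorem oddityEntry_two_zpow_mul (v : ℤ) (u : ℤ_[2]ˣ) :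
    oddityEntry ((2 : ℚ_[2]) ^ v * ((u : ℤ_[2]) : ℚ_[2])) =
      PadicInt.toZModPow 3 (u : ℤ_[2]) + v • signOddity (legendreTwo (u : ℤ_[2])) := by
  have hne : (2 : ℚ_[2]) ^ v * ((u : ℤ_[2]) : ℚ_[2]) ≠ 0 :=
    mul_ne_zero (zpow_ne_zero _ two_ne_zero) (by simp)
  rw [oddityEntry, oddPart_two_zpow_mul]
  congr 1
  simp only [IsAntisquare, oddPart_two_zpow_mul, valuation_two_zpow_mul, hne, ne_eq,
    not_false_eq_true, true_and]
  rcases Int.even_or_odd v with hv | hv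
  · rw [if_neg (fun h => (Int.not_odd_iff_even.2 hv) h.1),
      zsmul_signOddity_congr (n := 0) (by rw [Int.even_iff.1 hv]; rfl), zero_smul]
  · rw [zsmul_signOddity_congr (n := 1) (by rw [Int.odd_iff.1 hv]; rfl), one_smul]
    rcases Int.units_eq_one_or (legendreTwo (u : ℤ_[2])) with h | h <;> rw [h]
    · rw [if_neg (by simp)]; rfl
    · rw [if_pos ⟨hv, rfl⟩]; rfl

end Oddity

section Diagonalization

theorem exists_two_pow_mul_unit {a : ℤ_[2]} (ha : a ≠ 0) : ∃ (v : ℕ) (u : ℤ_[2]ˣ), a = 2 ^ v * u :=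
  ⟨a.valuation, PadicInt.unitCoeff ha, by
    have h := PadicInt.unitCoeff_spec ha
    rw [mul_comm]
    exact_mod_cast h⟩

theorem two_pow_mul_unit_injective {a b : ℕ} {u w : ℤ_[2]} (hu : IsUnit u) (hw : IsUnit w)
    (h : 2 ^ a * u = 2 ^ b * w) : u = w := by
  have key : ∀ {a b : ℕ} {u w : ℤ_[2]}, IsUnit u → IsUnit w → 2 ^ a * u = 2 ^ b * w →
      a ≤ b → u = w := by
    intro a b u w hu hw h hab
    obtain ⟨c, rfl⟩ := Nat.exists_eq_add_of_le hab
    rw [pow_add, mul_assoc] at h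
    have h1 := mul_left_cancel₀ (pow_ne_zero a two_ne_zero) h
    rcases Nat.eq_zero_or_pos c with rfl | hc
    · simpa using h1
    · exact absurd (h1 ▸ (dvd_pow_self 2 hc.ne').mul_right w) (not_dvd_iff_isUnit.2 hu)
  rcases le_total a b with hab | hab
  · exact key hu hw h hab
  · exact (key hw hu h.symm hab).symm

theorem coe_two_pow_mul (v : ℕ) (u : ℤ_[2]) :
    ((2 ^ v * u : ℤ_[2]) : ℚ_[2]) = 2 ^ v * (u : ℚ_[2]) := by
  push_cast
  rfl

theorem oddityEntry_sq_mul {c d : ℚ_[2]} (hc : c ≠ 0) (hd : d ≠ 0) :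
    oddityEntry (c ^ 2 * d) = oddityEntry d := by
  have key : ∀ a : ℚ_[2], a ≠ 0 → ∃ (v : ℤ) (u : ℤ_[2]ˣ), a = 2 ^ v * ((u : ℤ_[2]) : ℚ_[2]) := by
    intro a ha
    obtain ⟨x, y, hy, rfl⟩ := IsFractionRing.div_surjective (A := ℤ_[2]) a
    have hx : x ≠ 0 := fun h => ha (by simp [h])
    obtain ⟨v, u, rfl⟩ := exists_two_pow_mul_unit hx
    obtain ⟨t, w, rfl⟩ := exists_two_pow_mul_unit (nonZeroDivisors.ne_zero hy)
    refine ⟨v - t, u * w⁻¹, ?_⟩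
    have hw : ((w : ℤ_[2]) : ℚ_[2]) * (((w⁻¹ : ℤ_[2]ˣ) : ℤ_[2]) : ℚ_[2]) = 1 := by
      rw [← PadicInt.coe_mul, Units.mul_inv, PadicInt.coe_one]
    have hw0 := left_ne_zero_of_mul_eq_one hw
    change (((2 ^ v * u : ℤ_[2])) : ℚ_[2]) / ((2 ^ t * w : ℤ_[2]) : ℚ_[2]) = _
    rw [coe_two_pow_mul, coe_two_pow_mul]
    have h2 : (2 : ℚ_[2]) ^ t ≠ 0 := pow_ne_zero _ two_ne_zero
    rw [zpow_sub₀ two_ne_zero, zpow_natCast, zpow_natCast, div_eq_iff (mul_ne_zero h2 hw0),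
      Units.val_mul, PadicInt.coe_mul, div_mul_eq_mul_div, div_mul_eq_mul_div, eq_div_iff h2]
    linear_combination (-(2 ^ v * ((u : ℤ_[2]) : ℚ_[2]) * 2 ^ t)) * hw
  obtain ⟨v, u, rfl⟩ := key c hc
  obtain ⟨t, w, rfl⟩ := key d hd
  have h : (2 ^ v * ((u : ℤ_[2]) : ℚ_[2])) ^ 2 * (2 ^ t * ((w : ℤ_[2]) : ℚ_[2])) =
      2 ^ (2 * v + t) * (((w * u ^ 2 : ℤ_[2]ˣ) : ℤ_[2]) : ℚ_[2]) := by
    rw [two_mul, zpow_add₀ two_ne_zero, zpow_add₀ two_ne_zero, Units.val_mul,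
      Units.val_pow_eq_pow_val]
    push_cast
    ring
  have hu2 : PadicInt.toZModPow 3 (u : ℤ_[2]) ^ 2 = 1 := by
    have := toZModPow_three_of_isUnit u.isUnit
    generalize PadicInt.toZModPow (p := 2) 3 (u : ℤ_[2]) = a at this ⊢
    change ZMod 8 at a
    revert a; decide
  rw [h, oddityEntry_two_zpow_mul, oddityEntry_two_zpow_mul,
    zsmul_signOddity_congr (m := 2 * v + t) (n := t) (by omega)]
  push_cast
  rw [legendreTwo_mul_sq w.isUnit u.isUnit, map_mul, map_pow, hu2, mul_one]

theorem oddityEntry_coe (v : ℕ) (u : ℤ_[2]ˣ) :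
    oddityEntry ((2 ^ v * u : ℤ_[2]) : ℚ_[2]) =
      PadicInt.toZModPow 3 (u : ℤ_[2]) + v • signOddity (legendreTwo (u : ℤ_[2])) := by
  have := oddityEntry_two_zpow_mul v u
  rw [zpow_natCast, natCast_zsmul] at this
  rw [← this, coe_two_pow_mul]

theorem quadGauss_unaryMatrix_two_pow_mul {M v : ℕ} (u : ℤ_[2]ˣ) (h : v + 2 ≤ M) :
    PosRel (quadGauss M (unaryMatrix (2 ^ v * u))) (eighth (oddityEntry ((2 ^ v * u : ℤ_[2]) : ℚ_[2])
      + (M + 1) • signOddity (legendreTwo (u : ℤ_[2])))) := by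
  obtain ⟨N, rfl⟩ := Nat.exists_eq_add_of_le' (show v ≤ M by omega)
  have h1 : unaryMatrix (2 ^ v * (u : ℤ_[2])) = (2 : ℤ_[2]) ^ v • unaryMatrix u := by
    ext; simp [unaryMatrix]
  rw [h1, oddityEntry_coe, add_assoc, ← add_smul,
    nsmul_signOddity_congr (n := N + 1) (by omega)]
  exact (quadGauss_two_pow_smul N v _).trans (quadGauss_unit u.isUnit (by omega))

/-- The Gauss sum of a unimodular form is determined by any rational diagonalization. -/
theorem quadGauss_of_isDiagonalization {n : ℕ} {U : Matrix (Fin n) (Fin n) ℤ_[2]}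
    (hU : IsUnit U.det) (hs : U.transpose = U) {d : Fin n → ℚ_[2]}
    (hd : IsDiagonalization (U.map fun a => (a : ℚ_[2])) d) {m : ℕ} (hm : 2 ≤ m) :
    PosRel (quadGauss m U)
      (eighth (∑ i, oddityEntry (d i) + (m + 1) • signOddity (legendreTwo U.det))) := by
  obtain ⟨P, hP, hPd⟩ := hd
  obtain ⟨c, hc⟩ := IsLocalization.exist_integer_multiples_of_finite (nonZeroDivisors ℤ_[2])
    fun ij : Fin n × Fin n => P ij.1 ij.2
  choose p hp using hc
  have hc0 : ((c : ℤ_[2]) : ℚ_[2]) ≠ 0 := by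
    simp
  let ρ : ℤ_[2] →+* ℚ_[2] := algebraMap ℤ_[2] ℚ_[2]
  let P₀ : Matrix (Fin n) (Fin n) ℤ_[2] := Matrix.of fun i j => p (i, j)
  have hP₀ : ρ.mapMatrix P₀ = ((c : ℤ_[2]) : ℚ_[2]) • P := by
    ext i j
    exact (hp (i, j)).trans (Algebra.smul_def _ _)
  have hρ : Function.Injective ρ := IsFractionRing.injective ℤ_[2] ℚ_[2]
  let D : Fin n → ℤ_[2] := fun i => (P₀.transpose * U * P₀) i i
  have hdiag : ρ.mapMatrix (P₀.transpose * U * P₀) =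
      Matrix.diagonal fun i => ((c : ℤ_[2]) : ℚ_[2]) ^ 2 * d i := by
    have h1 : ρ.mapMatrix P₀.transpose = (ρ.mapMatrix P₀).transpose := rfl
    have h2 : ρ.mapMatrix U = U.map fun a => (a : ℚ_[2]) := rfl
    rw [map_mul, map_mul, h1, h2, hP₀, Matrix.transpose_smul, Matrix.smul_mul, Matrix.smul_mul,
      Matrix.mul_smul, hPd, smul_smul, ← Matrix.diagonal_smul, pow_two]
    rfl
  have hDd : ∀ i, ((D i : ℤ_[2]) : ℚ_[2]) = ((c : ℤ_[2]) : ℚ_[2]) ^ 2 * d i := fun i => by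
    have := congrFun (congrFun hdiag i) i
    rw [Matrix.diagonal_apply_eq] at this
    exact this
  have hD : P₀.transpose * U * P₀ = Matrix.diagonal D := by
    ext i j
    rcases eq_or_ne i j with rfl | hij
    · rw [Matrix.diagonal_apply_eq]
    · rw [Matrix.diagonal_apply_ne _ hij]
      apply hρ
      have := congrFun (congrFun hdiag i) j
      rw [Matrix.diagonal_apply_ne _ hij] at this
      rw [map_zero]
      exact this
  have hdet : P₀.det ≠ 0 := by
    intro h
    have h1 := congrArg Matrix.det hP₀
    rw [← RingHom.map_det, h, map_zero, Matrix.det_smul] at h1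
    exact mul_ne_zero (pow_ne_zero _ hc0) hP.ne_zero h1.symm
  have hprod : ∏ i, D i = P₀.det ^ 2 * U.det := by
    rw [← Matrix.det_diagonal, ← hD, Matrix.det_mul, Matrix.det_mul, Matrix.det_transpose]
    ring
  have hD0 : ∀ i, D i ≠ 0 := fun i hi => by
    rw [Finset.prod_eq_zero (Finset.mem_univ i) hi] at hprod
    exact mul_ne_zero (pow_ne_zero 2 hdet) hU.ne_zero hprod.symm
  choose v u hvu using fun i => exists_two_pow_mul_unit (hD0 i)
  have hodd : ∀ i, oddityEntry (d i) = oddityEntry ((2 ^ v i * u i : ℤ_[2]) : ℚ_[2]) := fun i => by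
    rw [← hvu, hDd, oddityEntry_sq_mul hc0]
    rintro h
    have := hDd i
    rw [h, mul_zero] at this
    exact hD0 i (hρ (this.trans (map_zero ρ).symm))
  have hsign : legendreTwo U.det = ∏ i, legendreTwo (u i : ℤ_[2]) := by
    obtain ⟨s, w, hw⟩ := exists_two_pow_mul_unit hdet
    rw [← legendreTwo_prod _ _ fun i => (u i).isUnit, ← legendreTwo_mul_sq hU w.isUnit]
    congr 1
    refine (two_pow_mul_unit_injective (a := ∑ i, v i) (b := 2 * s) ?_ (hU.mul (w.isUnit.pow 2))
      ?_).symm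
    · exact IsUnit.prod_iff.2 fun i _ => (u i).isUnit
    · rw [← Finset.prod_pow_eq_pow_sum, ← Finset.prod_mul_distrib]
      simp only [← hvu]
      rw [hprod, hw]
      ring
  obtain ⟨M₀, hM₀⟩ := quadGauss_sublattice hU hs hdet
  let k := M₀ + ∑ i, v i + 2
  have hv : ∀ i, v i ≤ ∑ i, v i := fun i => Finset.single_le_sum (fun _ _ => Nat.zero_le _)
    (Finset.mem_univ i)
  refine (quadGauss_add_two_mul hU hs hm k).symm.trans
    ((hM₀ (m + 2 * k) (by omega)).symm.trans ?_)
  rw [hD, quadGauss_diagonal, hsign, signOddity_prod, Finset.smul_sum, ← Finset.sum_add_distrib,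
    eighth_sum]
  refine PosRel.prod _ fun i _ => ?_
  rw [hvu i, hodd i, nsmul_signOddity_congr (m := m + 1) (n := m + 2 * k + 1) (by omega)]
  exact quadGauss_unaryMatrix_two_pow_mul (u i) (by have := hv i; omega)

theorem exists_isDiagonalization {n : ℕ} {G : Matrix (Fin n) (Fin n) ℚ_[2]}
    (hs : G.transpose = G) : ∃ d, IsDiagonalization G d := by
  obtain ⟨v, hv⟩ := LinearMap.BilinForm.exists_orthogonal_basis
    (B := Matrix.toBilin (Pi.basisFun ℚ_[2] (Fin n)) G) (LinearMap.BilinForm.isSymm_iff.1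
      ((Matrix.isSymm_toBilin_iff_isSymm _).2 hs))
  let w := v.reindex (finCongr (Module.finrank_fin_fun ℚ_[2]))
  have h := LinearMap.BilinForm.toMatrix_mul_basis_toMatrix (Pi.basisFun ℚ_[2] (Fin n)) w
    (Matrix.toBilin (Pi.basisFun ℚ_[2] (Fin n)) G)
  rw [LinearMap.BilinForm.toMatrix_toBilin] at h
  refine ⟨fun i => LinearMap.BilinForm.toMatrix w (Matrix.toBilin (Pi.basisFun ℚ_[2] (Fin n)) G) i i,
    (Pi.basisFun ℚ_[2] (Fin n)).toMatrix w, ?_, h.trans ?_⟩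
  · rw [← Module.Basis.det_apply]
    exact (Pi.basisFun ℚ_[2] (Fin n)).isUnit_det w
  · ext i j
    rcases eq_or_ne i j with rfl | hij
    · rw [Matrix.diagonal_apply_eq]
    · rw [Matrix.diagonal_apply_ne _ hij, LinearMap.BilinForm.toMatrix_apply]
      simp only [w, Module.Basis.reindex_apply]
      exact LinearMap.isOrthoᵢ_def.1 hv _ _ ((finCongr _).symm.injective.ne hij)

end Diagonalization

section FormOddity

theorem quadMod_map {ι : Type*} [Fintype ι] (M : ℕ) (G : Matrix ι ι ℤ_[2]) (z : ι → ℤ_[2]) :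
    quadMod M G (fun i => PadicInt.toZModPow M (z i)) =
      PadicInt.toZModPow M (z ⬝ᵥ G.mulVec z) := by
  simp only [quadMod, dotProduct, Matrix.mulVec, Matrix.map_apply, map_sum, map_mul]

theorem posRel_quadGauss_one {ι : Type*} [Fintype ι] [DecidableEq ι] {M : ℕ}
    {G : Matrix ι ι ℤ_[2]} (h : ∀ x, quadMod M G x = 0) : PosRel (quadGauss M G) 1 := by
  refine ⟨Fintype.card (ι → ZMod (2 ^ M)), by exact_mod_cast Fintype.card_pos, ?_⟩
  simp [quadGauss, h]

variable {M : Type*} [AddCommGroup M] [Module ℤ_[2] M] [Module.Free ℤ_[2] M]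
  [Module.Finite ℤ_[2] M] {b : LinearMap.BilinForm ℤ_[2] M}

theorem gram_transpose (hs : ∀ x y, b x y = b y x) : (gram b).transpose = gram b := by
  ext i j
  exact hs _ _

theorem exists_quadMod_gram (m : ℕ) (y : Fin (Module.finrank ℤ_[2] M) → ZMod (2 ^ m)) :
    ∃ x, quadMod m (gram b) y = PadicInt.toZModPow m (b x x) := by
  choose z hz using fun i => ZMod.ringHom_surjective (PadicInt.toZModPow (p := 2) m) (y i)
  obtain rfl : (fun i => PadicInt.toZModPow m (z i)) = y := funext hz
  refine ⟨(Module.finBasis ℤ_[2] M).equivFun.symm z, ?_⟩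
  rw [quadMod_map]
  have hg : gram b = LinearMap.BilinForm.toMatrix (Module.finBasis ℤ_[2] M) b := by
    ext i j
    rw [LinearMap.BilinForm.toMatrix_apply]
    rfl
  rw [hg, LinearMap.BilinForm.dotProduct_toMatrix_mulVec]

theorem quadGauss_gram_aux (hb : IsUnimodular b) (hs : ∀ x y, b x y = b y x)
    {d : Fin (Module.finrank ℤ_[2] M) → ℚ_[2]}
    (hd : IsDiagonalization ((gram b).map fun a => (a : ℚ_[2])) d) {m : ℕ} (hm : 2 ≤ m) :
    PosRel (quadGauss m (gram b))
      (eighth (∑ i, oddityEntry (d i) + (m + 1) • signOddity (formSign b))) :=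
  quadGauss_of_isDiagonalization (isUnit_det_gram hb) (gram_transpose hs) hd hm

/-- The oddity does not depend on the diagonalization. -/
theorem formOddity_eq_sum (hb : IsUnimodular b) (hs : ∀ x y, b x y = b y x)
    {d : Fin (Module.finrank ℤ_[2] M) → ℚ_[2]}
    (hd : IsDiagonalization ((gram b).map fun a => (a : ℚ_[2])) d) :
    formOddity b = ∑ i, oddityEntry (d i) := by
  have h : ∃ d, IsDiagonalization ((gram b).map fun a => (a : ℚ_[2])) d := ⟨d, hd⟩
  rw [formOddity, matrixOddity, dif_pos h]
  have h1 := (quadGauss_gram_aux hb hs h.choose_spec (le_refl 2)).symm.trans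
    (quadGauss_gram_aux hb hs hd (le_refl 2))
  exact add_right_cancel (eq_of_posRel_eighth h1)

theorem quadGauss_gram (hb : IsUnimodular b) (hs : ∀ x y, b x y = b y x) {m : ℕ} (hm : 2 ≤ m) :
    PosRel (quadGauss m (gram b))
      (eighth (formOddity b + (m + 1) • signOddity (formSign b))) := by
  obtain ⟨d, hd⟩ := exists_isDiagonalization (G := (gram b).map fun a => (a : ℚ_[2]))
    (by rw [← Matrix.transpose_map, gram_transpose hs])
  rw [formOddity_eq_sum hb hs hd]
  exact quadGauss_gram_aux hb hs hd hm

theorem quadGauss_one_of_isEvenForm (he : IsEvenForm b) : PosRel (quadGauss 1 (gram b)) 1 :=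
  posRel_quadGauss_one fun y => by
    obtain ⟨x, hx⟩ := exists_quadMod_gram (b := b) 1 y
    obtain ⟨c, hc⟩ := he x
    rw [hx, hc, map_mul, map_ofNat]
    exact mul_eq_zero_of_left (by decide) _

theorem formOddity_of_isEvenForm (hb : IsUnimodular b) (hs : ∀ x y, b x y = b y x)
    (he : IsEvenForm b) : formOddity b = 0 := by
  have h1 : PosRel (quadGauss (1 + 2) (gram b)) (quadGauss 1 (gram b)) :=
    quadGauss_add_two (isUnit_det_gram hb) (gram_transpose hs) fun y => by
      obtain ⟨x, hx⟩ := exists_quadMod_gram (b := b) (1 + 2) y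
      obtain ⟨c, hc⟩ := he x
      rw [hx, hc, map_mul, map_ofNat, ← mul_assoc]
      exact mul_eq_zero_of_left (by decide) _
  have h2 := (quadGauss_gram hb hs (by norm_num : 2 ≤ 3)).symm.trans
    (h1.trans (quadGauss_one_of_isEvenForm he))
  rw [← eighth_zero] at h2
  have h3 := eq_of_posRel_eighth h2
  rwa [nsmul_signOddity_congr (m := 3 + 1) (n := 0) rfl, zero_smul, add_zero] at h3

theorem oddityEntry_stdUnit (x s : Bool) :
    oddityEntry ((stdUnit x s : ℤ) : ℚ_[2]) = ((stdUnit x s : ℤ) : ZMod 8) := by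
  obtain ⟨u, hu⟩ := isUnit_intCast (stdUnit_emod_two x s)
  have h := oddityEntry_coe 0 u
  rw [pow_zero, one_mul, zero_smul, add_zero, hu, toZModPow_intCast, PadicInt.coe_intCast] at h
  exact h

theorem formOddity_of_isom_stdUnit (hb : IsUnimodular b) (hs : ∀ x y, b x y = b y x) {n : ℕ}
    {x s : Fin n → Bool}
    (h : Isom (fun y => b y y) (piSum fun i X => (stdUnit (x i) (s i) : ℤ_[2]) * X ^ 2)) :
    formOddity b = ∑ i, ((stdUnit (x i) (s i) : ℤ) : ZMod 8) := by
  obtain ⟨σ, hσ⟩ := exists_isDiagonalization_of_isom_stdUnit hs h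
  rw [formOddity_eq_sum hb hs hσ]
  simp only [oddityEntry_stdUnit]
  exact Equiv.sum_comp σ fun i => ((stdUnit (x i) (s i) : ℤ) : ZMod 8)

/-- The Gauss sum of a scaled unimodular lattice. -/
theorem quadGauss_two_pow_smul_gram (hb : IsUnimodular b) (hs : ∀ x y, b x y = b y x) {m j : ℕ}
    (he : m = j + 1 → IsEvenForm b) :
    PosRel (quadGauss m ((2 : ℤ_[2]) ^ j • gram b))
      (eighth ((if j + 1 < m then formOddity b else 0) +
        if j + 1 < m then (m - j + 1) • signOddity (formSign b) else 0)) := by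
  rcases lt_trichotomy (j + 1) m with h | h | h
  · obtain ⟨k, rfl⟩ := Nat.exists_eq_add_of_le' (show j ≤ m by omega)
    rw [if_pos h, if_pos h, Nat.add_sub_cancel]
    exact (quadGauss_two_pow_smul k j _).trans (quadGauss_gram hb hs (by omega))
  · obtain rfl := h.symm
    rw [if_neg (lt_irrefl _), if_neg (lt_irrefl _), add_zero, eighth_zero, add_comm]
    exact (quadGauss_two_pow_smul 1 j _).trans (quadGauss_one_of_isEvenForm (he rfl))
  · rw [if_neg h.not_gt, if_neg h.not_gt, add_zero, eighth_zero]
    obtain ⟨i, rfl⟩ := Nat.exists_eq_add_of_le (show m ≤ j by omega)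
    refine posRel_quadGauss_one fun x => ?_
    have h0 := two_pow_eq_zero (le_refl m)
    have h1 : ((2 : ℤ_[2]) ^ (m + i) • gram b).map (PadicInt.toZModPow m) = 0 := by
      ext a c
      have h2 : PadicInt.toZModPow m (2 : ℤ_[2]) ^ m = 0 := by rw [map_ofNat]; exact h0
      simp [pow_add, h2]
    rw [quadMod, h1, Matrix.zero_mulVec, dotProduct_zero]

end FormOddity

namespace JordanDecomposition

variable {L : Type*} [AddCommGroup L] [Module ℤ_[2] L] {Λ : Lattice L}

theorem unscaled_symm (J : JordanDecomposition Λ) (k : ℤ) (x y : J.term k) :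
    J.unscaled k x y = J.unscaled k y x := by
  have h := Λ.symm x y
  rw [J.form_eq, J.form_eq] at h
  exact PadicInt.ext (mul_left_cancel₀ (zpow_ne_zero k two_ne_zero) h)

variable [Module.Free ℤ_[2] L] [Module.Finite ℤ_[2] L]

theorem symbol_type_eq_II_iff (J : JordanDecomposition Λ) (k : ℤ) :
    J.symbol.type k = TermType.II ↔ IsEvenForm (J.unscaled k) := by
  simp only [symbol]
  split_ifs with h <;> simp [h]

theorem symbol_type_eq_I_iff (J : JordanDecomposition Λ) (k : ℤ) :
    J.symbol.type k = TermType.I ↔ ¬ IsEvenForm (J.unscaled k) := by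
  simp only [symbol]
  split_ifs with h <;> simp [h]

theorem finrank_ne_zero_of_type (J : JordanDecomposition Λ) {k : ℤ}
    (h : J.symbol.type k = TermType.I) : Module.finrank ℤ_[2] (J.term k) ≠ 0 := by
  intro h0
  refine (J.symbol_type_eq_I_iff k).1 h fun x => ?_
  have := Module.finrank_zero_iff.1 h0
  rw [Subsingleton.elim x 0]
  simp

theorem exists_finset_support (J : JordanDecomposition Λ) :
    ∃ K : Finset ℤ, ∀ k, Module.finrank ℤ_[2] (J.term k) ≠ 0 → k ∈ K := by
  have : Finite (Σ k, Fin (Module.finrank ℤ_[2] (J.term k))) :=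
    Module.Finite.finite_basis (J.isInternal.collectedBasis fun k => Module.finBasis ℤ_[2] (J.term k))
  have hf : {k | Module.finrank ℤ_[2] (J.term k) ≠ 0}.Finite :=
    Set.Finite.subset (Set.finite_range (Sigma.fst (β := fun k =>
      Fin (Module.finrank ℤ_[2] (J.term k))))) fun k hk => ⟨⟨k, 0, Nat.pos_of_ne_zero hk⟩, rfl⟩
  exact ⟨hf.toFinset, fun k hk => hf.mem_toFinset.2 hk⟩

variable {o : Type*} {c : o → ℤ}

theorem exists_adapted_basis (J : JordanDecomposition Λ) (hc : Function.Injective c)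
    (hK : ∀ k, Module.finrank ℤ_[2] (J.term k) ≠ 0 → k ∈ Set.range c) :
    ∃ w : Module.Basis (Σ i, Fin (Module.finrank ℤ_[2] (J.term (c i)))) ℤ_[2] L,
      ∀ p, w p = (Module.finBasis ℤ_[2] (J.term (c p.1)) p.2 : L) := by
  let f : (Σ i, Fin (Module.finrank ℤ_[2] (J.term (c i)))) →
    Σ k, Fin (Module.finrank ℤ_[2] (J.term k)) := Sigma.map c fun _ => id
  have hf : Function.Bijective f := by
    refine ⟨hc.sigma_map fun _ => Function.injective_id, fun ⟨k, a⟩ => ?_⟩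
    obtain ⟨i, rfl⟩ := hK k (Nat.ne_of_gt a.pos)
    exact ⟨⟨i, a⟩, rfl⟩
  refine ⟨(J.isInternal.collectedBasis fun k => Module.finBasis ℤ_[2] (J.term k)).reindex
    (Equiv.ofBijective f hf).symm, fun p => ?_⟩
  rw [Module.Basis.reindex_apply, Equiv.symm_symm, DirectSum.IsInternal.collectedBasis_coe]
  rfl

theorem form_finBasis (J : JordanDecomposition Λ) (k l : ℤ)
    (a : Fin (Module.finrank ℤ_[2] (J.term k))) (b : Fin (Module.finrank ℤ_[2] (J.term l)))
    (h : k ≠ l) :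
    Λ.form (Module.finBasis ℤ_[2] (J.term k) a) (Module.finBasis ℤ_[2] (J.term l) b) = 0 :=
  J.orthogonal k l h _ (Submodule.coe_mem _) _ (Submodule.coe_mem _)

/-- The norm form of a lattice in terms of a Jordan decomposition. -/
theorem isom_pi [Fintype o] (J : JordanDecomposition Λ) (hc : Function.Injective c)
    (hK : ∀ k, Module.finrank ℤ_[2] (J.term k) ≠ 0 → k ∈ Set.range c) :
    Isom (fun x => Λ.form x x) (fun x : ∀ i, J.term (c i) =>
      ∑ i, (2 : ℚ_[2]) ^ (c i) * ((J.unscaled (c i) (x i) (x i) : ℤ_[2]) : ℚ_[2])) := by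
  classical
  obtain ⟨w, hw⟩ := J.exists_adapted_basis hc hK
  let v := Pi.basis fun i => Module.finBasis ℤ_[2] (J.term (c i))
  let e := v.equiv w (Equiv.refl _)
  have he : ∀ x, e x = ∑ i, (x i : L) := by
    have h : (e : (∀ i, J.term (c i)) →ₗ[ℤ_[2]] L) =
        ∑ i, (J.term (c i)).subtype ∘ₗ LinearMap.proj i := by
      refine v.ext fun p => ?_
      have h1 : e (v p) = w p := v.equiv_apply p w (Equiv.refl _)
      rw [LinearEquiv.coe_coe, h1, hw]
      simp only [v, LinearMap.sum_apply, LinearMap.comp_apply, LinearMap.proj_apply, Submodule.subtype_apply,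
        Pi.basis_apply]
      rw [Finset.sum_eq_single p.1]
      · simp
      · intro i _ hi
        simp [Pi.single_eq_of_ne hi]
      · simp
    intro x
    have := LinearMap.congr_fun h x
    simpa using this
  refine Isom.symm ⟨e, fun x => ?_⟩
  simp only [he, map_sum, LinearMap.sum_apply]
  refine Finset.sum_congr rfl fun i _ => ?_
  rw [Finset.sum_eq_single i]
  · exact J.form_eq _ _ _
  · intro j _ hj
    exact J.orthogonal _ _ (hc.ne hj) _ (Submodule.coe_mem _) _ (Submodule.coe_mem _)
  · simp

end JordanDecomposition

/-- Matrices of a form in two bases are congruent. -/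
theorem quadGauss_eq_of_basis {L : Type*} [AddCommGroup L] [Module ℤ_[2] L] {ι ι' : Type*}
    [Fintype ι] [DecidableEq ι] [Fintype ι'] [DecidableEq ι'] (B : L →ₗ[ℤ_[2]] L →ₗ[ℤ_[2]] ℚ_[2])
    (v : Module.Basis ι ℤ_[2] L) (w : Module.Basis ι' ℤ_[2] L) {G : Matrix ι ι ℤ_[2]}
    {H : Matrix ι' ι' ℤ_[2]} (hv : ∀ i j, B (v i) (v j) = (G i j : ℚ_[2]))
    (hw : ∀ i j, B (w i) (w j) = (H i j : ℚ_[2])) (M : ℕ) : quadGauss M G = quadGauss M H := by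
  let b := Matrix.toBilin v G
  have hb : b.compr₂ (Algebra.linearMap ℤ_[2] ℚ_[2]) = B := by
    refine v.ext fun i => v.ext fun j => ?_
    rw [LinearMap.compr₂_apply, hv, ← LinearMap.BilinForm.toMatrix_apply v b i j,
      LinearMap.BilinForm.toMatrix_toBilin]
    rfl
  let σ := v.indexEquiv w
  let w' := w.reindex σ.symm
  have h := LinearMap.BilinForm.toMatrix_mul_basis_toMatrix v w' b
  have h1 : LinearMap.BilinForm.toMatrix w' b = H.submatrix σ σ := by
    ext i j
    have h2 := hw (σ i) (σ j)
    rw [← hb] at h2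
    rw [LinearMap.BilinForm.toMatrix_apply, Module.Basis.reindex_apply,
      Module.Basis.reindex_apply, Equiv.symm_symm]
    exact PadicInt.ext h2
  rw [LinearMap.BilinForm.toMatrix_toBilin, h1] at h
  rw [← quadGauss_submatrix M H σ, ← h, quadGauss_transform]
  rw [← Module.Basis.det_apply]
  exact v.isUnit_det w'

namespace JordanDecomposition

variable {L : Type*} [AddCommGroup L] [Module ℤ_[2] L] {Λ : Lattice L}
variable [Module.Free ℤ_[2] L] [Module.Finite ℤ_[2] L]

/-- The matrix of `2 ^ c` times the form in an adapted basis. -/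
noncomputable def adaptedGram (J : JordanDecomposition Λ) (K : Finset ℤ) (c : ℕ) :
    Matrix (Σ i : K, Fin (Module.finrank ℤ_[2] (J.term i)))
      (Σ i : K, Fin (Module.finrank ℤ_[2] (J.term i))) ℤ_[2] :=
  Matrix.blockDiagonal' fun i : K => (2 : ℤ_[2]) ^ (i.1 + c).toNat • gram (J.unscaled i)

theorem form_adaptedGram (J : JordanDecomposition Λ) (K : Finset ℤ) (c : ℕ)
    (hc : ∀ k ∈ K, 0 ≤ k + c) (p q : Σ i : K, Fin (Module.finrank ℤ_[2] (J.term i))) :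
    ((2 : ℤ_[2]) ^ c • Λ.form) (Module.finBasis ℤ_[2] (J.term p.1) p.2)
      (Module.finBasis ℤ_[2] (J.term q.1) q.2) = (J.adaptedGram K c p q : ℚ_[2]) := by
  obtain ⟨i, a⟩ := p
  obtain ⟨j, b⟩ := q
  simp only [LinearMap.smul_apply, Algebra.smul_def, map_pow, map_ofNat]
  by_cases h : i = j
  · subst h
    rw [adaptedGram, Matrix.blockDiagonal'_apply_eq, J.form_eq, Matrix.smul_apply, smul_eq_mul,
      coe_two_pow_mul, ← mul_assoc, ← zpow_natCast, ← zpow_natCast, ← zpow_add₀ two_ne_zero,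
      Int.toNat_of_nonneg (hc i i.2), add_comm]
    rfl
  · rw [adaptedGram, Matrix.blockDiagonal'_apply_ne _ _ _ h,
      J.form_finBasis _ _ _ _ (Subtype.coe_injective.ne h), mul_zero, PadicInt.coe_zero]

/-- The Gauss sum of a lattice at a level where the term is of type `II`. -/
theorem quadGauss_adaptedGram (J : JordanDecomposition Λ) (K : Finset ℤ) (c : ℕ)
    (hc : ∀ k ∈ K, 0 ≤ k + c) {k₀ : ℤ} (hk₀ : 0 ≤ k₀ + c) (ht : J.symbol.type k₀ = TermType.II) :
    PosRel (quadGauss ((k₀ + c).toNat + 1) (J.adaptedGram K c))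
      (eighth (∑ k ∈ K with k < k₀, formOddity (J.unscaled k) +
        ∑ k ∈ K with k < k₀, ((k₀ + c).toNat + 1 - (k + c).toNat + 1) •
          signOddity (J.symbol.sign k))) := by
  rw [adaptedGram, quadGauss_blockDiagonal, ← Finset.sum_add_distrib, Finset.sum_filter,
    ← Finset.sum_coe_sort, eighth_sum]
  refine PosRel.prod _ fun i _ => ?_
  have h := quadGauss_two_pow_smul_gram (J.unimodular i) (J.unscaled_symm i)
    (m := (k₀ + c).toNat + 1) (j := (i.1 + c).toNat) (fun h => by
      have := hc i i.2
      obtain rfl : k₀ = i := by omega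
      exact (J.symbol_type_eq_II_iff _).1 ht)
  have h1 : (i.1 + c).toNat + 1 < (k₀ + c).toNat + 1 ↔ i.1 < k₀ := by
    have := hc i i.2
    omega
  simp only [h1] at h
  convert h using 2
  split_ifs
  · rfl
  · simp

variable {L' : Type*} [AddCommGroup L'] [Module ℤ_[2] L'] [Module.Free ℤ_[2] L']
  [Module.Finite ℤ_[2] L'] {Λ' : Lattice L'}

theorem sum_formOddity_eq (J : JordanDecomposition Λ) (J' : JordanDecomposition Λ')
    (hiso : Isometric Λ Λ') (htype : ∀ k, J.symbol.type k = J'.symbol.type k)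
    (hsign : ∀ k, J.symbol.sign k = J'.symbol.sign k) {K : Finset ℤ}
    (hK : ∀ k, Module.finrank ℤ_[2] (J.term k) ≠ 0 → k ∈ K)
    (hK' : ∀ k, Module.finrank ℤ_[2] (J'.term k) ≠ 0 → k ∈ K) {k₀ : ℤ}
    (ht : J.symbol.type k₀ = TermType.II) :
    ∑ k ∈ K with k < k₀, formOddity (J.unscaled k) =
      ∑ k ∈ K with k < k₀, formOddity (J'.unscaled k) := by
  obtain ⟨c, hc, hk₀⟩ : ∃ c : ℕ, (∀ k ∈ K, 0 ≤ k + c) ∧ 0 ≤ k₀ + c := by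
    refine ⟨∑ k ∈ insert k₀ K, k.natAbs, ?_⟩
    have h : ∀ k ∈ insert k₀ K, 0 ≤ k + (∑ k ∈ insert k₀ K, k.natAbs : ℕ) := fun k hk => by
      have := Finset.single_le_sum (f := Int.natAbs) (fun _ _ => Nat.zero_le _) hk
      omega
    exact ⟨fun k hk => h k (Finset.mem_insert_of_mem hk), h _ (Finset.mem_insert_self _ _)⟩
  obtain ⟨e, he⟩ := hiso
  obtain ⟨w, hw⟩ := J.exists_adapted_basis (c := ((↑) : K → ℤ)) Subtype.coe_injective
    fun k hk => ⟨⟨k, hK k hk⟩, rfl⟩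
  obtain ⟨w', hw'⟩ := J'.exists_adapted_basis (c := ((↑) : K → ℤ)) Subtype.coe_injective
    fun k hk => ⟨⟨k, hK' k hk⟩, rfl⟩
  have h := quadGauss_eq_of_basis ((2 : ℤ_[2]) ^ c • Λ.form) w (w'.map e.symm)
    (G := J.adaptedGram K c) (H := J'.adaptedGram K c)
    (fun i j => by rw [hw, hw, form_adaptedGram J K c hc])
    (fun i j => by
      rw [← form_adaptedGram J' K c hc, ← hw', ← hw']
      simp [← he]) ((k₀ + c).toNat + 1)
  have h1 := J.quadGauss_adaptedGram K c hc hk₀ ht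
  have h2 := J'.quadGauss_adaptedGram K c hc hk₀ ((htype k₀).symm.trans ht)
  rw [h] at h1
  simp only [hsign] at h1
  exact add_right_cancel (eq_of_posRel_eighth (h1.symm.trans h2))

end JordanDecomposition

theorem TermType.eq_II {t : TermType} (h : t ≠ TermType.I) : t = TermType.II := by
  cases t <;> simp at h ⊢

theorem IsCompartment.exists_eq_Icc {type : ℤ → TermType} {C : Finset ℤ}
    (hC : IsCompartment type C) : ∃ a b, a ≤ b ∧ C = Finset.Icc a b ∧
      type (a - 1) = TermType.II ∧ type (b + 1) = TermType.II := by
  obtain ⟨hne, hI, hconn⟩ := hC.prop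
  have hIcc : C = Finset.Icc (C.min' hne) (C.max' hne) := by
    ext k
    rw [Finset.mem_Icc]
    exact ⟨fun h => ⟨C.min'_le k h, C.le_max' k h⟩, fun h =>
      hconn.out (C.min'_mem hne) (C.max'_mem hne) h⟩
  have key : ∀ k, (∃ l ∈ C, l = k + 1 ∨ k = l + 1) → k ∉ C → type k = TermType.II := by
    rintro k ⟨l, hl, hkl⟩ hk
    refine TermType.eq_II fun hkI => hk ?_
    refine hC.le_of_ge ⟨Finset.insert_nonempty k C, fun j hj => ?_, ?_⟩
      (Finset.subset_insert k C) (Finset.mem_insert_self k C)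
    · rcases Finset.mem_insert.1 hj with rfl | hj
      · exact hkI
      · exact hI j hj
    · refine ⟨fun x hx y hy z hz => ?_⟩
      simp only [Finset.coe_insert, Set.mem_insert_iff, Finset.mem_coe, Set.mem_Icc] at hx hy hz ⊢
      by_cases hzk : z = k
      · exact Or.inl hzk
      right
      rcases hx with rfl | hx <;> rcases hy with rfl | hy
      · omega
      · rcases hkl with rfl | rfl
        · exact hconn.out hl hy ⟨by omega, hz.2⟩
        · exact hconn.out hl hy ⟨by omega, hz.2⟩
      · rcases hkl with rfl | rfl
        · exact hconn.out hx hl ⟨hz.1, by omega⟩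
        · exact hconn.out hx hl ⟨hz.1, by omega⟩
      · exact hconn.out hx hy hz
  refine ⟨C.min' hne, C.max' hne, C.min'_le_max' hne, hIcc, ?_, ?_⟩
  · refine key _ ⟨_, C.min'_mem hne, Or.inl (by ring)⟩ fun h => ?_
    have := C.min'_le _ h
    omega
  · refine key _ ⟨_, C.max'_mem hne, Or.inr rfl⟩ fun h => ?_
    have := C.le_max' _ h
    omega

namespace JordanDecomposition

variable {L : Type*} [AddCommGroup L] [Module ℤ_[2] L] [Module.Free ℤ_[2] L]
  [Module.Finite ℤ_[2] L] {Λ : Lattice L}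
variable {L' : Type*} [AddCommGroup L'] [Module ℤ_[2] L'] [Module.Free ℤ_[2] L']
  [Module.Finite ℤ_[2] L'] {Λ' : Lattice L'}

/-- Isometric lattices have the same compartment oddities. -/
theorem sum_compartment_eq (J : JordanDecomposition Λ) (J' : JordanDecomposition Λ')
    (hiso : Isometric Λ Λ') (htype : ∀ k, J.symbol.type k = J'.symbol.type k)
    (hsign : ∀ k, J.symbol.sign k = J'.symbol.sign k) {C : Finset ℤ}
    (hC : IsCompartment J.symbol.type C) :
    ∑ k ∈ C, formOddity (J.unscaled k) = ∑ k ∈ C, formOddity (J'.unscaled k) := by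
  obtain ⟨a, b, hab, rfl, ha, hb⟩ := hC.exists_eq_Icc
  obtain ⟨K₁, hK₁⟩ := J.exists_finset_support
  obtain ⟨K₂, hK₂⟩ := J'.exists_finset_support
  let K := K₁ ∪ K₂ ∪ Finset.Icc (a - 1) b
  have hK : ∀ k, Module.finrank ℤ_[2] (J.term k) ≠ 0 → k ∈ K := fun k hk => by
    simp [K, hK₁ k hk]
  have hK' : ∀ k, Module.finrank ℤ_[2] (J'.term k) ≠ 0 → k ∈ K := fun k hk => by
    simp [K, hK₂ k hk]
  have hsplit : ∀ f : ℤ → ZMod 8, f (a - 1) = 0 → ∑ k ∈ K with k < b + 1, f k =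
      ∑ k ∈ K with k < a - 1, f k + ∑ k ∈ Finset.Icc a b, f k := by
    intro f hf
    have h1 : K.filter (· < b + 1) = (K.filter (· < a - 1)).disjUnion
        ((Finset.Icc a b).cons (a - 1) (by simp)) (by
          rw [Finset.disjoint_left]
          intro k hk
          simp only [Finset.mem_filter, Finset.mem_cons, Finset.mem_Icc] at hk ⊢
          omega) := by
      ext k
      simp only [K, Finset.mem_filter, Finset.mem_disjUnion, Finset.mem_cons, Finset.mem_Icc,
        Finset.mem_union]
      by_cases h : k ∈ K₁ ∨ k ∈ K₂ <;> simp only [h, true_or, false_or, true_and] <;> omega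
    rw [h1, Finset.sum_disjUnion, Finset.sum_cons, hf, zero_add]
  have h1 := sum_formOddity_eq J J' hiso htype hsign hK hK' hb
  have h2 := sum_formOddity_eq J J' hiso htype hsign hK hK' ha
  have ha' := (htype _).symm.trans ha
  rw [hsplit _ (formOddity_of_isEvenForm (J.unimodular _) (J.unscaled_symm _)
      ((J.symbol_type_eq_II_iff _).1 ha)),
    hsplit _ (formOddity_of_isEvenForm (J'.unimodular _) (J'.unscaled_symm _)
      ((J'.symbol_type_eq_II_iff _).1 ha')), h2] at h1
  exact add_left_cancel h1

end JordanDecomposition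

@[to_additive]
theorem prod_filter_sigma {β : Type*} [CommMonoid β] {T : Finset ℤ} {n : T → ℕ} (P : ℤ → Prop)
    [DecidablePred P] (f : (Σ k : T, Fin (n k)) → β) (g : ℤ → β)
    (h : ∀ k : T, g k = ∏ i, f ⟨k, i⟩) :
    ∏ p with P p.1.1, f p = ∏ k ∈ T with P k, g k := by
  rw [Finset.prod_filter, Finset.prod_filter, Fintype.prod_sigma,
    ← Finset.prod_coe_sort T fun k => if P k then g k else 1]
  refine Finset.prod_congr rfl fun k _ => ?_
  by_cases hk : P k <;> simp [hk, h]

namespace JordanDecomposition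

section

variable {L : Type*} [AddCommGroup L] [Module ℤ_[2] L] [Module.Free ℤ_[2] L]
  [Module.Finite ℤ_[2] L] {Λ : Lattice L}

/-- The type `I` terms are diagonalizable. -/
theorem exists_isom_stdForm (J : JordanDecomposition Λ) {T : Finset ℤ}
    (hT : ∀ k ∈ T, J.symbol.type k = TermType.I) {n : T → ℕ}
    (hn : ∀ k : T, Module.finrank ℤ_[2] (J.term k) = n k) :
    ∃ x s : (Σ k : T, Fin (n k)) → Bool,
      Isom (fun y : ∀ k : T, J.term k =>
        ∑ k : T, (2 : ℚ_[2]) ^ (k : ℤ) * ((J.unscaled k (y k) (y k) : ℤ_[2]) : ℚ_[2]))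
        (stdForm (fun p => (p.1 : ℤ)) x s) ∧
      (∀ k : T, formSign (J.unscaled k) = ∏ i, bitSign (s ⟨k, i⟩)) ∧
      ∀ k : T, formOddity (J.unscaled k) =
        ∑ i, ((stdUnit (x ⟨k, i⟩) (s ⟨k, i⟩) : ℤ) : ZMod 8) := by
  choose x s h using fun k : T => exists_isom_stdUnit (J.unimodular k) (J.unscaled_symm k)
    ((J.symbol_type_eq_I_iff k).1 (hT k k.2)) (hn k)
  refine ⟨fun p => x p.1 p.2, fun p => s p.1 p.2, ?_,
    fun k => formSign_of_isom_stdUnit (J.unimodular k) (J.unscaled_symm k) (h k),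
    fun k => formOddity_of_isom_stdUnit (J.unimodular k) (J.unscaled_symm k) (h k)⟩
  refine (Isom.pi fun k => (h k).map fun z : ℤ_[2] => (2 : ℚ_[2]) ^ (k : ℤ) * (z : ℚ_[2])).trans
    (Isom.symm ⟨LinearEquiv.piCurry ℤ_[2] fun (k : T) (_ : Fin (n k)) => ℤ_[2], fun y => ?_⟩)
  simp only [stdForm, piSum, unary, Fintype.sum_sigma, LinearEquiv.piCurry_apply, Sigma.curry]
  refine Finset.sum_congr rfl fun k _ => ?_
  rw [← Finset.mul_sum, ← PadicInt.coe_sum]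

theorem isom_prod (J : JordanDecomposition Λ) {T₁ T₂ : Finset ℤ}
    (hc : Function.Injective (Sum.elim (↑) (↑) : T₁ ⊕ T₂ → ℤ))
    (hK : ∀ k, Module.finrank ℤ_[2] (J.term k) ≠ 0 →
      k ∈ Set.range (Sum.elim (↑) (↑) : T₁ ⊕ T₂ → ℤ)) :
    Isom (fun x => Λ.form x x) (fun x : (∀ k : T₁, J.term k) × (∀ k : T₂, J.term k) =>
      ∑ k : T₁, (2 : ℚ_[2]) ^ (k : ℤ) * ((J.unscaled k (x.1 k) (x.1 k) : ℤ_[2]) : ℚ_[2]) +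
      ∑ k : T₂, (2 : ℚ_[2]) ^ (k : ℤ) * ((J.unscaled k (x.2 k) (x.2 k) : ℤ_[2]) : ℚ_[2])) := by
  refine (J.isom_pi hc hK).trans ⟨LinearEquiv.sumPiEquivProdPi ℤ_[2] T₁ T₂ fun i =>
    J.term (Sum.elim (↑) (↑) i), fun x => ?_⟩
  exact (Fintype.sum_sum_type fun i : T₁ ⊕ T₂ => (2 : ℚ_[2]) ^ (Sum.elim (↑) (↑) i : ℤ) *
    ((J.unscaled (Sum.elim (↑) (↑) i) (x i) (x i) : ℤ_[2]) : ℚ_[2])).symm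

end

/-- The scales joined to `k₀` by a chain of type `I` terms form its compartment. -/
theorem isCompartment_filter {type : ℤ → TermType} {T : Finset ℤ}
    (hT : ∀ k, k ∈ T ↔ type k = TermType.I) {k₀ : ℤ} (hk₀ : k₀ ∈ T)
    [DecidablePred fun k => ∀ l ∈ Set.uIcc k₀ k, l ∈ T] :
    IsCompartment type (T.filter fun k => ∀ l ∈ Set.uIcc k₀ k, l ∈ T) := by
  constructor
  · refine ⟨⟨k₀, Finset.mem_filter.2 ⟨hk₀, fun l hl => ?_⟩⟩,
      fun k hk => (hT k).1 (Finset.mem_filter.1 hk).1, ⟨fun x hx y hy z hz => ?_⟩⟩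
    · rw [Set.uIcc_self, Set.mem_singleton_iff] at hl
      exact hl ▸ hk₀
    · simp only [Finset.coe_filter, Set.mem_ofPred_eq] at hx hy ⊢
      have h : ∀ l ∈ Set.uIcc k₀ z, l ∈ T := fun l hl => by
        by_cases h : l ∈ Set.uIcc k₀ x
        · exact hx.2 l h
        · refine hy.2 l ?_
          simp only [Set.mem_uIcc, Set.mem_Icc] at hl hz h ⊢
          omega
      exact ⟨h z Set.right_mem_uIcc, h⟩
  · rintro E ⟨-, hE, hconn⟩ hle k hk
    have hk₀E : k₀ ∈ E := hle (Finset.mem_filter.2 ⟨hk₀, fun l hl => by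
      rw [Set.uIcc_self, Set.mem_singleton_iff] at hl
      exact hl ▸ hk₀⟩)
    exact Finset.mem_filter.2 ⟨(hT k).2 (hE k hk), fun l hl =>
      (hT l).2 (hE l (hconn.uIcc_subset hk₀E hk hl))⟩

variable {L : Type*} [AddCommGroup L] [Module ℤ_[2] L] [Module.Free ℤ_[2] L]
  [Module.Finite ℤ_[2] L] {Λ : Lattice L}
variable {L' : Type*} [AddCommGroup L'] [Module ℤ_[2] L'] [Module.Free ℤ_[2] L']
  [Module.Finite ℤ_[2] L'] {Λ' : Lattice L'}

open Classical in
theorem isom_typeI (J : JordanDecomposition Λ) (J' : JordanDecomposition Λ') {T : Finset ℤ}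
    (hT : ∀ k, k ∈ T ↔ J.symbol.type k = TermType.I)
    (hT' : ∀ k, k ∈ T ↔ J'.symbol.type k = TermType.I)
    (hdim : ∀ k, J.symbol.dim k = J'.symbol.dim k) (hsign : ∀ k, J.symbol.sign k = J'.symbol.sign k)
    (hodd : ∀ C, IsCompartment J.symbol.type C →
      ∑ k ∈ C, formOddity (J.unscaled k) = ∑ k ∈ C, formOddity (J'.unscaled k)) :
    Isom (fun y : ∀ k : T, J.term k =>
        ∑ k : T, (2 : ℚ_[2]) ^ (k : ℤ) * ((J.unscaled k (y k) (y k) : ℤ_[2]) : ℚ_[2]))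
      (fun y : ∀ k : T, J'.term k =>
        ∑ k : T, (2 : ℚ_[2]) ^ (k : ℤ) * ((J'.unscaled k (y k) (y k) : ℤ_[2]) : ℚ_[2])) := by
  obtain ⟨x, s, h, hs, ho⟩ := J.exists_isom_stdForm (fun k hk => (hT k).1 hk)
    (n := fun k : T => Module.finrank ℤ_[2] (J.term k)) fun _ => rfl
  obtain ⟨x', s', h', hs', ho'⟩ := J'.exists_isom_stdForm (fun k hk => (hT' k).1 hk)
    (n := fun k : T => Module.finrank ℤ_[2] (J.term k)) fun k => (hdim k).symm
  refine h.trans (Isom.trans ?_ h'.symm)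
  refine isom_stdForm (fun k => ?_) fun i => ?_
  · rw [prod_filter_sigma (· = k) _ (fun k => formSign (J.unscaled k)) hs,
      prod_filter_sigma (· = k) _ (fun k => formSign (J'.unscaled k)) hs']
    exact Finset.prod_congr rfl fun k _ => hsign k
  · have hr : ∀ k, (∃ r : Σ k : T, Fin (Module.finrank ℤ_[2] (J.term k)), (r.1 : ℤ) = k) ↔
        k ∈ T := fun k => by
      refine ⟨?_, fun hk => ⟨⟨⟨k, hk⟩, ⟨0, Nat.pos_of_ne_zero ?_⟩⟩, rfl⟩⟩
      · rintro ⟨r, rfl⟩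
        exact r.1.2
      · exact J.finrank_ne_zero_of_type ((hT k).1 hk)
    have hl : ∀ j, Linked (fun p : Σ k : T, Fin (Module.finrank ℤ_[2] (J.term k)) => (p.1 : ℤ)) i j
        ↔ ∀ l ∈ Set.uIcc (i.1 : ℤ) j.1, l ∈ T := fun j => by simp only [Linked, hr]
    simp only [hl]
    rw [sum_filter_sigma (fun k => ∀ l ∈ Set.uIcc (i.1 : ℤ) k, l ∈ T) _
        (fun k => formOddity (J.unscaled k)) ho,
      sum_filter_sigma (fun k => ∀ l ∈ Set.uIcc (i.1 : ℤ) k, l ∈ T) _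
        (fun k => formOddity (J'.unscaled k)) ho']
    exact hodd _ (isCompartment_filter hT i.1.2)

open Classical in
theorem isometric_of_oddity (J : JordanDecomposition Λ) (J' : JordanDecomposition Λ')
    (hdim : ∀ k, J.symbol.dim k = J'.symbol.dim k)
    (htype : ∀ k, J.symbol.type k = J'.symbol.type k)
    (hsign : ∀ k, J.symbol.sign k = J'.symbol.sign k)
    (hodd : ∀ C, IsCompartment J.symbol.type C →
      ∑ k ∈ C, formOddity (J.unscaled k) = ∑ k ∈ C, formOddity (J'.unscaled k)) :
    Isometric Λ Λ' := by
  obtain ⟨K, hK⟩ := J.exists_finset_support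
  let T₁ := K.filter fun k => J.symbol.type k = TermType.I
  let T₂ := K.filter fun k => J.symbol.type k = TermType.II
  have hT₁ : ∀ k, k ∈ T₁ ↔ J.symbol.type k = TermType.I := fun k => by
    rw [Finset.mem_filter, and_iff_right_iff_imp]
    exact fun h => hK k (J.finrank_ne_zero_of_type h)
  have hT₂ : ∀ k ∈ T₂, J.symbol.type k = TermType.II := fun k hk => (Finset.mem_filter.1 hk).2
  let c : T₁ ⊕ T₂ → ℤ := Sum.elim (↑) (↑)
  have hc : Function.Injective c := by
    refine Subtype.coe_injective.sumElim Subtype.coe_injective fun i j h => ?_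
    have h1 := (hT₁ i).1 i.2
    rw [h, hT₂ j j.2] at h1
    exact TermType.noConfusion h1
  have hcover : ∀ k, Module.finrank ℤ_[2] (J.term k) ≠ 0 → k ∈ Set.range c := fun k hk => by
    by_cases h : J.symbol.type k = TermType.I
    · exact ⟨Sum.inl ⟨k, (hT₁ k).2 h⟩, rfl⟩
    · exact ⟨Sum.inr ⟨k, Finset.mem_filter.2 ⟨hK k hk, TermType.eq_II h⟩⟩, rfl⟩
  have hcover' : ∀ k, Module.finrank ℤ_[2] (J'.term k) ≠ 0 → k ∈ Set.range c := fun k hk =>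
    hcover k (fun h => hk ((hdim k).symm.trans h))
  have h₁ := isom_typeI J J' hT₁ (fun k => by rw [hT₁, htype]) hdim hsign hodd
  have h₂ : Isom (fun y : ∀ k : T₂, J.term k =>
        ∑ k : T₂, (2 : ℚ_[2]) ^ (k : ℤ) * ((J.unscaled k (y k) (y k) : ℤ_[2]) : ℚ_[2]))
      (fun y : ∀ k : T₂, J'.term k =>
        ∑ k : T₂, (2 : ℚ_[2]) ^ (k : ℤ) * ((J'.unscaled k (y k) (y k) : ℤ_[2]) : ℚ_[2])) :=
    Isom.pi fun k : T₂ => (isom_of_isEvenForm (J.unimodular k) (J'.unimodular k) (J.unscaled_symm k)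
      (J'.unscaled_symm k) ((J.symbol_type_eq_II_iff k).1 (hT₂ k k.2))
      ((J'.symbol_type_eq_II_iff k).1 ((htype k).symm.trans (hT₂ k k.2))) (hdim k)
      (hsign k)).map fun z : ℤ_[2] => (2 : ℚ_[2]) ^ (k : ℤ) * (z : ℚ_[2])
  obtain ⟨e, he⟩ := (J.isom_prod hc hcover).trans
    ((h₁.prod h₂).trans (J'.isom_prod hc hcover').symm)
  refine ⟨e, fun x y => ?_⟩
  have h := he (x + y)
  simp only [map_add, LinearMap.add_apply, he, Λ.symm y x, Λ'.symm (e y) (e x)] at h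
  have h2 : (2 : ℚ_[2]) * Λ'.form (e x) (e y) = 2 * Λ.form x y := by linear_combination h
  exact mul_left_cancel₀ two_ne_zero h2

end JordanDecomposition

theorem signOddity_inv (ε : ℤˣ) : signOddity ε⁻¹ = -signOddity ε := by
  rcases Int.units_eq_one_or ε with rfl | rfl <;> decide

namespace Symbol

theorem eq_iff_oddity {S S' : Symbol} (hdim : ∀ k, S.dim k = S'.dim k)
    (htype : ∀ k, S.type k = S'.type k) (hsign : ∀ k, S.sign k = S'.sign k) :
    S = S' ↔ ∀ (C : Finset ℤ) (hC : IsCompartment S.type C) (hC' : IsCompartment S'.type C),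
      S.oddity ⟨C, hC⟩ = S'.oddity ⟨C, hC'⟩ := by
  refine ⟨fun h => by subst h; exact fun _ _ _ => rfl, fun h => ?_⟩
  obtain ⟨d, t, s, o⟩ := S
  obtain ⟨d', t', s', o'⟩ := S'
  obtain rfl : d = d' := funext hdim
  obtain rfl : t = t' := funext htype
  obtain rfl : s = s' := funext hsign
  obtain rfl : o = o' := funext fun C => h C.1 C.2 C.2
  rfl

variable {S : Symbol}

theorem CanWalk.lt {i j : ℤ} (h : S.CanWalk i j) : i < j := by
  rcases h.2.2 with h | h | h <;> have := h.1 <;> omega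

theorem CanWalk.eq_or {i j : ℤ} (h : S.CanWalk i j) :
    j = i + 1 ∨ j = i + 2 ∧ S.dim (i + 1) = 0 := by
  rcases h.2.2 with h | h | h
  · exact Or.inl h.1
  · exact Or.inl h.1
  · exact Or.inr ⟨h.1, h.2.2.2⟩

theorem add_self_of_mem_walkGroup {a : S.Coordinates} (ha : a ∈ S.walkGroup) : a + a = 0 := by
  induction ha using AddSubgroup.closure_induction with
  | mem a ha =>
    obtain ⟨i, j, -, rfl⟩ := ha
    refine Prod.ext (funext fun k => ?_) (funext fun C => ?_)
    · change (S.walk i j).1 k + (S.walk i j).1 k = 0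
      simp only [walk]
      split_ifs <;> rfl
    · change ite _ _ _ + ite _ _ _ = (0 : ZMod 8)
      split_ifs <;> decide
  | zero => exact add_zero 0
  | add a b _ _ ha hb => rw [add_add_add_comm, ha, hb, add_zero]
  | neg a _ ha => rw [← neg_add, ha, neg_zero]

/-- The product of the signs of the terms up to a given scale. -/
theorem prod_walk [Fintype {k // S.dim k ≠ 0}] {i j : ℤ} (h : S.CanWalk i j) (k : ℤ) :
    ∏ l with l.1 ≤ k, ((S.walk i j).1 l).toMul = if i ≤ k ∧ k < j then -1 else 1 := by
  classical
  have hij := h.lt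
  have h1 : ∀ l : {k // S.dim k ≠ 0},
      (if l.1 ≤ k then ((S.walk i j).1 l).toMul else 1) =
        (if l = ⟨i, h.1⟩ then (if i ≤ k then -1 else 1) else 1) *
          (if l = ⟨j, h.2.1⟩ then (if j ≤ k then -1 else 1) else 1) := by
    rintro ⟨l, hl⟩
    simp only [walk, toMul_ofMul, Subtype.mk.injEq]
    by_cases h1 : l = i
    · subst h1
      simp [hij.ne]
    · by_cases h2 : l = j
      · subst h2
        simp [h1]
      · simp [h1, h2]
  rw [Finset.prod_filter, Finset.prod_congr rfl fun l _ => h1 l, Finset.prod_mul_distrib,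
    Fintype.prod_ite_eq', Fintype.prod_ite_eq']
  by_cases h1 : i ≤ k <;> by_cases h2 : j ≤ k
  · simp [h1, h2]
  · simp [h1, h2, not_le.1 h2]
  · omega
  · simp [h1, h2]

/-- The effect of sign walks on a compartment is determined by their effect on signs. -/
theorem snd_eq_of_mem_walkGroup [Fintype {k // S.dim k ≠ 0}]
    {C : {C : Finset ℤ // IsCompartment S.type C}} {a b : ℤ} (hab : a ≤ b)
    (hC : C.1 = Finset.Icc a b) (hdim : ∀ k ∈ C.1, S.dim k ≠ 0) {x : S.Coordinates}
    (hx : x ∈ S.walkGroup) :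
    x.2 C = ∑ k ∈ Finset.Icc (a - 1) b, signOddity (∏ l with l.1 ≤ k, (x.1 l).toMul) := by
  induction hx using AddSubgroup.closure_induction with
  | mem x hx =>
    obtain ⟨i, j, h, rfl⟩ := hx
    simp only [prod_walk h]
    change ite (i ∈ C.1 ∨ j ∈ C.1) (4 : ZMod 8) 0 = _
    have hlt := h.lt
    have heq := h.eq_or
    have hdim' : ∀ k, a ≤ k → k ≤ b → S.dim k ≠ 0 := fun k h1 h2 =>
      hdim k (by rw [hC]; exact Finset.mem_Icc.2 ⟨h1, h2⟩)
    have ha := hdim' a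
    have hi := hdim' (i + 1)
    rw [hC]
    simp only [Finset.mem_Icc]
    split_ifs with hmem
    · rw [Finset.sum_eq_single (if a ≤ i then i else a - 1)]
      · rw [if_pos]
        · rfl
        · split_ifs <;> omega
      · intro k hk hne
        rw [Finset.mem_Icc] at hk
        rw [if_neg]
        · rfl
        · intro hk'
          split_ifs at hne <;> omega
      · intro hk
        rw [Finset.mem_Icc] at hk
        split_ifs at hk <;> omega
    · refine (Finset.sum_eq_zero fun k hk => ?_).symm
      rw [Finset.mem_Icc] at hk
      rw [if_neg]
      · rfl
      · intro hk'
        have : i = a - 1 := by omega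
        subst this
        rw [sub_add_cancel] at heq
        omega
  | zero =>
    refine (Finset.sum_eq_zero fun k _ => ?_).symm
    simp [signOddity]
  | add x y _ _ hx hy =>
    simp only [Prod.snd_add, Prod.fst_add, Pi.add_apply, toMul_add, Finset.prod_mul_distrib,
      signOddity_mul, Finset.sum_add_distrib, hx, hy]
  | neg x _ hx =>
    simp only [Prod.snd_neg, Prod.fst_neg, Pi.neg_apply, toMul_neg, Finset.prod_inv_distrib,
      signOddity_inv, Finset.sum_neg_distrib, hx]

end Symbol

namespace JordanDecomposition

variable {L : Type*} [AddCommGroup L] [Module ℤ_[2] L] [Module.Free ℤ_[2] L]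
  [Module.Finite ℤ_[2] L] {Λ : Lattice L}

theorem injective_walkGroup_fst (J : JordanDecomposition Λ) :
    Function.Injective (fun a : J.symbol.walkGroup => (a : J.symbol.Coordinates).1) := by
  obtain ⟨K, hK⟩ := J.exists_finset_support
  have : Finite {k // J.symbol.dim k ≠ 0} := (K.finite_toSet.subset hK).to_subtype
  have := Fintype.ofFinite {k // J.symbol.dim k ≠ 0}
  rintro ⟨x, hx⟩ ⟨y, hy⟩ h
  refine Subtype.ext (Prod.ext h (funext fun C => ?_))
  obtain ⟨a, b, hab, hC, -, -⟩ := C.2.exists_eq_Icc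
  have hdim : ∀ k ∈ C.1, J.symbol.dim k ≠ 0 := fun k hk =>
    J.finrank_ne_zero_of_type (C.2.prop.2.1 k hk)
  change x.1 = y.1 at h
  rw [Symbol.snd_eq_of_mem_walkGroup hab hC hdim hx, Symbol.snd_eq_of_mem_walkGroup hab hC hdim hy,
    h]

end JordanDecomposition

end TwoAdic

theorem mainTheorem4
    {L : Type*} [AddCommGroup L] [Module ℤ_[2] L] [Module.Free ℤ_[2] L] [Module.Finite ℤ_[2] L]
    {L' : Type*} [AddCommGroup L'] [Module ℤ_[2] L'] [Module.Free ℤ_[2] L']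
    [Module.Finite ℤ_[2] L']
    (Λ : TwoAdic.Lattice L) (Λ' : TwoAdic.Lattice L')
    (J : TwoAdic.JordanDecomposition Λ) (J' : TwoAdic.JordanDecomposition Λ')
    (hdim : ∀ k, J.symbol.dim k = J'.symbol.dim k)
    (htype : ∀ k, J.symbol.type k = J'.symbol.type k)
    (hsign : ∀ k, J.symbol.sign k = J'.symbol.sign k) :
    (TwoAdic.Isometric Λ Λ' ↔ J.symbol = J'.symbol) ∧
    (J.symbol = J'.symbol ↔
      ∀ (C : Finset ℤ) (hC : TwoAdic.IsCompartment J.symbol.type C)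
        (hC' : TwoAdic.IsCompartment J'.symbol.type C),
        J.symbol.oddity ⟨C, hC⟩ = J'.symbol.oddity ⟨C, hC'⟩) ∧
    (∀ a ∈ J.symbol.walkGroup, a + a = 0) ∧
    Function.Injective (fun a : J.symbol.walkGroup => (a : J.symbol.Coordinates).1) := by
  have h := TwoAdic.Symbol.eq_iff_oddity hdim htype hsign
  refine ⟨⟨fun hiso => h.2 fun C hC _ => J.sum_compartment_eq J' hiso htype hsign hC, fun hS =>
    J.isometric_of_oddity J' hdim htype hsign fun C hC => h.1 hS C hC ?_⟩, h,
    fun a ha => TwoAdic.Symbol.add_self_of_mem_walkGroup ha, J.injective_walkGroup_fst⟩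
  rwa [← funext htype]
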